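/- Fix $\hbar\in\mathbb{C}\setminus\{0\}$ and $m,n\ge 0$, and write $f^{[k]}(u)=f(u+\tfrac{\hbar}{2}k)$. Given functions $Q_a$ ($1\le a\le m$), $Q_{i}$ ($1\le i\le n$) and $Q_{a|i}$ of $u$ with $$Q_{a|i}^{[1]}-Q_{a|i}^{[-1]}=Q_a\,Q_i ,$$ their supersymmetric Wronskian is, for $m\ge n$, the determinant of the $m\times m$ matrix whose $a$-th row is $$\bigl(Q_{a|1}^{[m-n]},\dots,Q_{a|n}^{[m-n]},\,Q_a^{[m-n-1]},Q_a^{[m-n-3]},\dots,Q_a^{[-(m-n)+1]}\bigr),$$ and for $m<n$ the determinant of the $n\times n$ matrix obtained by exchanging the roles of the two kinds of indices. Consider the following two systems. (1) Twisted case. Let $x_1,\dots,x_m,y_1,\dots,y_n$ be pairwise distinct non-zero complex numbers and $\Lambda=[\lambda_1,\dots,\lambda_m|\nu_1,\dots,\nu_n]$ a tuple of non-negative integers; put $L=\sum_a\lambda_a+\sum_i\nu_i$. Let $Q_a=x_a^{u/\hbar}q_a(u)$ and $Q_i=y_i^{-u/\hbar}q_i(u)$, where $q_a,q_i$ are monic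 polynomials in $u$ of degrees $\lambda_a,\nu_i$ whose $L$ non-leading coefficients are independent variables $c_1,\dots,c_L$. Let $Q_{a|i}=(x_a/y_i)^{u/\hbar}f_{a|i}(u)$, where $f_{a|i}$ is the unique polynomial in $u$ for which the relation above holds. (2) Twist-less case. Let $\Lambda$ be a Young diagram with $L$ boxes, row lengths $\underline\lambda_1\ge\underline\lambda_2\ge\cdots$ and column lengths $\underline\lambda'_1\ge\underline\lambda'_2\ge\cdots$, such that $\underline\lambda_{m+1}\le n$. Let $r=\min\{k\ge 0:\underline\lambda_{m-k}+k-n\ge 0\}$ (with $\underline\lambda_0=\infty$) and replace $(m,n)$ by $(m-r,n-r)$. For the new $(m,n)$ let $\hat\lambda_a=\underline\lambda_a-a-n+m$ ($1\le a\le m$) and $\hat\nu_i=\underline\lambda'_i-i-m+n$ ($1\le i\le n$). Let $Q_a$ be a monic polynomial of degree $\hat\lambda_a$ whose coefficients of $u^{\hat\lambda_b}$, $b\ne a$, are zero, and $Q_i$ a monic polynomial of degree $\hat\nu_i$ whose coefficients of $u^{\hat\nu_j}$, $j\ne i$, are zero; let $Q_{a|i}$ be a polynomial for which the relation above holds, which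 fixes it up to its constant term. The remaining non-leading coefficients of the $Q_a$ and $Q_i$, together with the constant terms of the monic polynomials proportional to the $Q_{a|i}$, are independent variables $c_1,\dots,c_L$ (there are exactly $L$ of them). In each case let $\mathrm{SW}(u)$ be the polynomial part of the supersymmetric Wronskian (i.e. with its exponential prefactor dropped), normalised to be a monic polynomial in $u$ of degree $L$, and define $\mathrm{SW}_1,\dots,\mathrm{SW}_L\in\mathbb{C}[c]=\mathbb{C}[c_1,\dots,c_L]$ by $$\mathrm{SW}(u)=u^L+\sum_{\ell=1}^L(-1)^\ell\,\mathrm{SW}_\ell(c)\,u^{L-\ell}.$$ The Wronskian Bethe equations at $\bar\chi\in\mathbb{C}^L$ are $\mathrm{SW}_\ell(c)=\bar\chi_\ell$, $\ell=1,\dots,L$, and their algebraic number of solutions (the number of solutions counted with multiplicity) is $\dim_{\mathbb{C}}\mathbb{C}[c]/\langle \mathrm{SW}_\ell(c)-\bar\chi_\ell\rangle_{\ell=1}^L$. The Wronskian algebra is the $\mathbb{C}[\chi]=\mathbb{C}[\chi_1,\dots,\chi_L]$-algebra $$\mathcal{W}_\Lambda=\mathbb{C}[\chi][c]/\langle\chi_1-\mathrm{SW}_1(c),\dots,\chi_L-\mathrm{SW}_L(c)\rangle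 .$$ Proposition. In both cases: $\mathcal{W}_\Lambda$ is isomorphic to $\mathbb{C}[c]$ as a $\mathbb{C}$-algebra by $c_\ell\mapsto c_\ell$, with $\chi_\ell$ corresponding to $\mathrm{SW}_\ell(c)$, and $\mathcal{W}_\Lambda$ is a free $\mathbb{C}[\chi]$-module of finite rank. Consequently, for every $\bar\chi\in\mathbb{C}^L$ the algebraic number of solutions of the Wronskian Bethe equations at $\bar\chi$ is finite and equal to the rank of $\mathcal{W}_\Lambda$ over $\mathbb{C}[\chi]$; in particular it does not depend on $\bar\chi$. -/

import Mathlib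

open Polynomial

noncomputable section

namespace WronskianBethe

section QFunctions

variable {R : Type*} [CommRing R] [Algebra ℂ R]

/-- A Q-function is a quasi-polynomial `Q(u) = exp (κ * u / ħ) * f(u)` and is represented by its
polynomial part `f`, with `κ` remembered separately. This is the polynomial part
`exp (κ * k / 2) * f(u + ħ * k / 2)` of the shifted function `Q^[k] = Q(u + ħ * k / 2)`. -/
def qshift (ħ κ : ℂ) (k : ℤ) : R[X] →ₗ[R] R[X] :=
  algebraMap ℂ R (Complex.exp (κ * k / 2)) • Polynomial.taylor (algebraMap ℂ R (ħ * k / 2))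

/-- The polynomial part of `Q^[1] - Q^[-1]`. -/
def qdiff (ħ κ : ℂ) : R[X] →ₗ[R] R[X] := qshift ħ κ 1 - qshift ħ κ (-1)

/-- The Neumann series for the inverse of an operator `A` for which `1 - A` lowers degrees. -/
def neumannInv (A : R[X] →ₗ[R] R[X]) (g : R[X]) : R[X] :=
  ∑ k ∈ Finset.range (g.natDegree + 1), ((1 - A) ^ k) g

/-- The antiderivative of `f` with zero constant term. -/
def antideriv : R[X] →ₗ[R] R[X] :=
  Polynomial.lsum fun k : ℕ => algebraMap ℂ R ((k : ℂ) + 1)⁻¹ • Polynomial.monomial (k + 1)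

/-- For `exp κ ≠ 1`: the unique solution `f` of `qdiff ħ κ f = g`. -/
def twistedSolution (ħ κ : ℂ) (g : R[X]) : R[X] :=
  algebraMap ℂ R (Complex.exp (κ / 2) - Complex.exp (-κ / 2))⁻¹ •
    neumannInv
      (algebraMap ℂ R (Complex.exp (κ / 2) - Complex.exp (-κ / 2))⁻¹ • qdiff ħ κ) g

/-- For `ħ ≠ 0`: the unique solution `f` of `qdiff ħ 0 f = g` with zero constant term. -/
def twistlessSolution (ħ : ℂ) (g : R[X]) : R[X] :=
  algebraMap ℂ R ħ⁻¹ •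
    antideriv (neumannInv (algebraMap ℂ R ħ⁻¹ • (qdiff ħ 0 ∘ₗ antideriv)) g)

/-- For `n ≤ m`: the `m × m` determinant whose row `a` is
`Q_{a|1}^[m-n], …, Q_{a|n}^[m-n], Q_a^[m-n-1], Q_a^[m-n-3], …, Q_a^[-(m-n)+1]`,
with the exponential prefactor dropped. Here `q a` and `F a i` are the polynomial parts of
`Q_a = exp (κ a * u / ħ) * q a` and `Q_{a|i} = exp ((κ a + ρ i) * u / ħ) * F a i`. -/
def wronskianDet (ħ : ℂ) (m n : ℕ) (κ : Fin m → ℂ) (ρ : Fin n → ℂ)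
    (q : Fin m → R[X]) (F : Fin m → Fin n → R[X]) : R[X] :=
  Matrix.det (Matrix.of fun a j : Fin m =>
    if h : (j : ℕ) < n then
      qshift ħ (κ a + ρ ⟨j, h⟩) ((m : ℤ) - n) (F a ⟨j, h⟩)
    else
      qshift ħ (κ a) ((m : ℤ) - n - 1 - 2 * ((j : ℤ) - n)) (q a))

/-- The supersymmetric Wronskian of `Q_{a|∅} = exp (κ a * u / ħ) * q a`,
`Q_{∅|i} = exp (ρ i * u / ħ) * p i` and `Q_{a|i} = exp ((κ a + ρ i) * u / ħ) * F a i`, up to a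
normalisation and an exponential prefactor. For `m < n` the roles of the two families of indices
are exchanged. -/
def superWronskian (ħ : ℂ) (m n : ℕ) (κ : Fin m → ℂ) (ρ : Fin n → ℂ)
    (q : Fin m → R[X]) (p : Fin n → R[X]) (F : Fin m → Fin n → R[X]) : R[X] :=
  if n ≤ m then wronskianDet ħ m n κ ρ q F
  else wronskianDet ħ n m ρ κ p (fun i a => F a i)

end QFunctions

section Normalisation

variable {σ : Type*}

/-- Normalisation of `D(u)`, whose coefficient of `u ^ L` is a constant, so that this
coefficient becomes `1`. -/
def normalise (L : ℕ) (D : (MvPolynomial σ ℂ)[X]) : (MvPolynomial σ ℂ)[X] :=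
  Polynomial.C (MvPolynomial.C (MvPolynomial.constantCoeff (D.coeff L))⁻¹) * D

/-- The polynomials `SW_1, …, SW_L` defined by
`SW(u) = u ^ L + ∑ ℓ = 1 .. L, (-1) ^ ℓ * SW_ℓ * u ^ (L - ℓ)`; the index `ℓ : Fin L` stands for
`ℓ + 1`. With this sign the equation `SW(u) = ∏ (u - θ_ℓ)` reads `SW_ℓ = e_ℓ(θ)`. -/
def signedCoeffs (L : ℕ) (S : (MvPolynomial σ ℂ)[X]) (l : Fin L) : MvPolynomial σ ℂ :=
  (-1) ^ ((l : ℕ) + 1) * S.coeff (L - ((l : ℕ) + 1))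

end Normalisation

section Twisted

variable {m n : ℕ}

/-- The variables in the twisted case: the variable with index `⟨a, k⟩` (resp. `⟨i, k⟩`) is the
coefficient of `u ^ k` in the monic polynomial `q_{a|∅}` (resp. `q_{∅|i}`). -/
abbrev TwistedVar (lam : Fin m → ℕ) (nu : Fin n → ℕ) : Type :=
  (Σ a : Fin m, Fin (lam a)) ⊕ (Σ i : Fin n, Fin (nu i))

/-- `q_{a|∅} = u ^ λ_a + …`, the polynomial part of `Q_{a|∅} = x_a ^ (u / ħ) * q_{a|∅}`. -/
def twistedBoson (lam : Fin m → ℕ) (nu : Fin n → ℕ) (a : Fin m) :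
    (MvPolynomial (TwistedVar lam nu) ℂ)[X] :=
  X ^ lam a + ∑ k : Fin (lam a), C (MvPolynomial.X (Sum.inl ⟨a, k⟩)) * X ^ (k : ℕ)

/-- `q_{∅|i} = u ^ ν_i + …`, the polynomial part of `Q_{∅|i} = y_i ^ (-u / ħ) * q_{∅|i}`. -/
def twistedFermion (lam : Fin m → ℕ) (nu : Fin n → ℕ) (i : Fin n) :
    (MvPolynomial (TwistedVar lam nu) ℂ)[X] :=
  X ^ nu i + ∑ k : Fin (nu i), C (MvPolynomial.X (Sum.inr ⟨i, k⟩)) * X ^ (k : ℕ)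

/-- The length `L` of the chain in the twisted case. -/
def twistedLength (lam : Fin m → ℕ) (nu : Fin n → ℕ) : ℕ := ∑ a, lam a + ∑ i, nu i

/-- `SW(u)` in the twisted case. The functions `Q_{a|i}` are determined by
`Q_{a|i}^[1] - Q_{a|i}^[-1] = Q_{a|∅} * Q_{∅|i}`. -/
def twistedSWPoly (ħ : ℂ) (x : Fin m → ℂ) (y : Fin n → ℂ) (lam : Fin m → ℕ) (nu : Fin n → ℕ) :
    (MvPolynomial (TwistedVar lam nu) ℂ)[X] :=
  normalise (twistedLength lam nu)
    (superWronskian ħ m n (fun a => Complex.log (x a)) (fun i => -Complex.log (y i))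
      (twistedBoson lam nu) (twistedFermion lam nu)
      (fun a i => twistedSolution ħ (Complex.log (x a) + -Complex.log (y i))
        (twistedBoson lam nu a * twistedFermion lam nu i)))

/-- The polynomials `SW_1(c), …, SW_L(c)` in the twisted case. -/
def twistedSW (ħ : ℂ) (x : Fin m → ℂ) (y : Fin n → ℂ) (lam : Fin m → ℕ) (nu : Fin n → ℕ) :
    Fin (twistedLength lam nu) → MvPolynomial (TwistedVar lam nu) ℂ :=
  signedCoeffs (twistedLength lam nu) (twistedSWPoly ħ x y lam nu)

end Twisted

section Twistless

/-- `r = min {k | λ_{m-k} + k - n ≥ 0}` for the partition `λ` given by the rows of `Y`, where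
`λ_0 = ∞`. -/
def hookDefect (Y : YoungDiagram) (m n : ℕ) : ℕ :=
  sInf {k : ℕ | m ≤ k ∨ n ≤ Y.rowLen (m - k - 1) + k}

/-- Shifted weights `λ_a - a - n + m` (for `a = 1, …, m`). The index `a : Fin m` stands for
`a + 1`. They are natural numbers when `(m, n)` lies on the boundary of `Y`. -/
def shiftedRow (Y : YoungDiagram) (m n : ℕ) (a : Fin m) : ℕ :=
  Y.rowLen a + m - (n + ((a : ℕ) + 1))

/-- Shifted weights `λ'_i - i - m + n` (for `i = 1, …, n`). The index `i : Fin n` stands for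
`i + 1`. They are natural numbers when `(m, n)` lies on the boundary of `Y`. -/
def shiftedCol (Y : YoungDiagram) (m n : ℕ) (i : Fin n) : ℕ :=
  Y.colLen i + n - (m + ((i : ℕ) + 1))

variable {m n : ℕ}

/-- The variables in the twist-less case for polynomials of degrees `d a` and `e i`:
the coefficient of `u ^ k` in `Q_{a|∅}` for `k < d a` with `k` none of the degrees `d b`,
the coefficient of `u ^ k` in `Q_{∅|i}` for `k < e i` with `k` none of the degrees `e j`, and
the constant coefficient of the monic polynomial proportional to `Q_{a|i}`. -/
abbrev TwistlessVar (d : Fin m → ℕ) (e : Fin n → ℕ) : Type :=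
  (Σ a : Fin m, {k : Fin (d a) // ∀ b, d b ≠ k}) ⊕
    ((Σ i : Fin n, {k : Fin (e i) // ∀ j, e j ≠ k}) ⊕ (Fin m × Fin n))

/-- The monic polynomial `Q_{a|∅}` of degree `d a`. -/
def twistlessBoson (d : Fin m → ℕ) (e : Fin n → ℕ) (a : Fin m) :
    (MvPolynomial (TwistlessVar d e) ℂ)[X] :=
  X ^ d a + ∑ k : {k : Fin (d a) // ∀ b, d b ≠ k},
    C (MvPolynomial.X (Sum.inl ⟨a, k⟩)) * X ^ (k.1 : ℕ)

/-- The monic polynomial `Q_{∅|i}` of degree `e i`. -/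
def twistlessFermion (d : Fin m → ℕ) (e : Fin n → ℕ) (i : Fin n) :
    (MvPolynomial (TwistlessVar d e) ℂ)[X] :=
  X ^ e i + ∑ k : {k : Fin (e i) // ∀ j, e j ≠ k},
    C (MvPolynomial.X (Sum.inr (Sum.inl ⟨i, k⟩))) * X ^ (k.1 : ℕ)

/-- The solution `Q_{a|i}` of `Q_{a|i}^[1] - Q_{a|i}^[-1] = Q_{a|∅} * Q_{∅|i}`, of degree
`d a + e i + 1` with leading coefficient `1 / (ħ * (d a + e i + 1))`, for which the monic
polynomial `ħ * (d a + e i + 1) * Q_{a|i}` has the variable `c_{a|i}` as constant coefficient. -/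
def twistlessMixed (ħ : ℂ) (d : Fin m → ℕ) (e : Fin n → ℕ) (a : Fin m) (i : Fin n) :
    (MvPolynomial (TwistlessVar d e) ℂ)[X] :=
  twistlessSolution ħ (twistlessBoson d e a * twistlessFermion d e i) +
    C (MvPolynomial.C (ħ * ((d a : ℂ) + e i + 1))⁻¹ *
      MvPolynomial.X (Sum.inr (Sum.inr (a, i))))

/-- `SW(u)` in the twist-less case, for `L` sites and for Q-functions with polynomial degrees
`d a` and `e i`. -/
def twistlessSWPoly (ħ : ℂ) (L : ℕ) (d : Fin m → ℕ) (e : Fin n → ℕ) :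
    (MvPolynomial (TwistlessVar d e) ℂ)[X] :=
  normalise L
    (superWronskian ħ m n (fun _ => 0) (fun _ => 0)
      (twistlessBoson d e) (twistlessFermion d e) (twistlessMixed ħ d e))

/-- The variables in the twist-less case for the Young diagram `Y` in the `m|n` hook. -/
abbrev YoungVar (m n : ℕ) (Y : YoungDiagram) : Type :=
  TwistlessVar
    (shiftedRow Y (m - hookDefect Y m n) (n - hookDefect Y m n))
    (shiftedCol Y (m - hookDefect Y m n) (n - hookDefect Y m n))

/-- The polynomials `SW_1(c), …, SW_L(c)` in the twist-less case, for the Young diagram `Y` with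
`L` boxes in the `m|n` hook. -/
def twistlessSW (ħ : ℂ) (m n : ℕ) (Y : YoungDiagram) :
    Fin Y.card → MvPolynomial (YoungVar m n Y) ℂ :=
  signedCoeffs Y.card (twistlessSWPoly ħ Y.card
    (shiftedRow Y (m - hookDefect Y m n) (n - hookDefect Y m n))
    (shiftedCol Y (m - hookDefect Y m n) (n - hookDefect Y m n)))

end Twistless

section Algebra

variable {σ : Type*} {L : ℕ}

/-- The ideal `⟨χ_1 - SW_1(c), …, χ_L - SW_L(c)⟩` of `ℂ[χ][c]`. -/
def wronskianIdeal (SW : Fin L → MvPolynomial σ ℂ) :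
    Ideal (MvPolynomial σ (MvPolynomial (Fin L) ℂ)) :=
  Ideal.span (Set.range fun l =>
    MvPolynomial.C (MvPolynomial.X l) - MvPolynomial.map MvPolynomial.C (SW l))

/-- The Wronskian algebra `ℂ[χ][c] / ⟨χ_ℓ - SW_ℓ(c)⟩`, with its natural `ℂ[χ]`-algebra
structure. -/
abbrev WronskianAlgebra (SW : Fin L → MvPolynomial σ ℂ) : Type _ :=
  MvPolynomial σ (MvPolynomial (Fin L) ℂ) ⧸ wronskianIdeal SW

/-- The specialised Wronskian algebra `ℂ[c] / ⟨SW_ℓ(c) - χ̄_ℓ⟩`. -/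
abbrev SpecialisedAlgebra (SW : Fin L → MvPolynomial σ ℂ) (chi : Fin L → ℂ) : Type _ :=
  MvPolynomial σ ℂ ⧸ Ideal.span (Set.range fun l => SW l - MvPolynomial.C (chi l))

/-- The algebraic number of solutions (counted with multiplicity) of the system
`SW_ℓ(c) = χ̄_ℓ`, that is the dimension of the quotient ring. -/
def algebraicNumberOfSolutions (SW : Fin L → MvPolynomial σ ℂ) (chi : Fin L → ℂ) : ℕ :=
  Module.finrank ℂ (SpecialisedAlgebra SW chi)

end Algebra

section Facts

variable {R : Type*} [CommRing R]

theorem apply_neumannInv (A : R[X] →ₗ[R] R[X])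
    (hA : ∀ (n : ℕ) (f : R[X]), f ∈ degreeLT R (n + 1) → (1 - A) f ∈ degreeLT R n) (g : R[X]) :
    A (neumannInv A g) = g := by
  have key : ∀ (k n : ℕ) (f : R[X]), f ∈ degreeLT R (n + k) → ((1 - A) ^ k) f ∈ degreeLT R n := by
    intro k
    induction k with
    | zero => intro n f hf; simpa using hf
    | succ k ih =>
      intro n f hf
      rw [pow_succ']
      exact hA n _ (ih (n + 1) f (by rwa [show n + 1 + k = n + (k + 1) by ring]))
  have h0 : ((1 - A) ^ (g.natDegree + 1)) g = 0 := by
    have := key (g.natDegree + 1) 0 g (by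
      rw [mem_degreeLT, zero_add]
      exact lt_of_le_of_lt degree_le_natDegree (by exact_mod_cast Nat.lt_succ_self _))
    rw [mem_degreeLT] at this
    simpa [Nat.WithBot.lt_zero_iff] using this
  have h1 := congrArg (fun B : Module.End R R[X] => B g) (mul_neg_geom_sum (1 - A) (g.natDegree + 1))
  simp only [sub_sub_cancel, LinearMap.sub_apply, h0, sub_zero, Module.End.one_apply] at h1
  rw [Module.End.mul_apply, LinearMap.sum_apply] at h1
  exact h1

theorem lowers_of_monomial (B : R[X] →ₗ[R] R[X])
    (hB : ∀ k : ℕ, B (X ^ k) ∈ degreeLT R k) (n : ℕ) (f : R[X]) (hf : f ∈ degreeLT R (n + 1)) :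
    B f ∈ degreeLT R n := by
  classical
  rw [degreeLT_eq_span_X_pow] at hf
  induction hf using Submodule.span_induction with
  | mem x hx =>
    simp only [Finset.coe_image, Set.mem_image, Finset.coe_range, Set.mem_Iio] at hx
    obtain ⟨k, hk, rfl⟩ := hx
    exact degreeLT_mono (by omega) (hB k)
  | zero => simp
  | add x y _ _ hx hy => rw [map_add]; exact Submodule.add_mem _ hx hy
  | smul a x _ hx => rw [map_smul]; exact Submodule.smul_mem _ _ hx

theorem taylor_X_pow_sub_mem (r : R) (k : ℕ) :
    Polynomial.taylor r (X ^ k) - X ^ k ∈ degreeLT R k := by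
  nontriviality R
  rw [mem_degreeLT]
  have hm : (X ^ k : R[X]).degree = k := degree_X_pow k
  have hd : (Polynomial.taylor r (X ^ k)).degree = (X ^ k : R[X]).degree := degree_taylor _ _
  rw [← hm, ← hd]
  refine degree_sub_lt_left hd ?_ ?_
  · rw [Ne, taylor_eq_zero]; exact (monic_X_pow k).ne_zero
  · rw [leadingCoeff_taylor]

theorem taylor_X_pow_succ_sub_mem (r : R) (k : ℕ) :
    Polynomial.taylor r (X ^ (k + 1)) - X ^ (k + 1) - C (((k : R) + 1) * r) * X ^ k ∈
      degreeLT R k := by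
  rw [taylor_X_pow]
  induction k with
  | zero => simp
  | succ k ih =>
    have e : (X + C r : R[X]) ^ (k + 1 + 1) - X ^ (k + 1 + 1) -
        C ((((k + 1 : ℕ) : R) + 1) * r) * X ^ (k + 1) =
        (X + C r) * ((X + C r) ^ (k + 1) - X ^ (k + 1) - C (((k : R) + 1) * r) * X ^ k) +
          C (((k : R) + 1) * r * r) * X ^ k := by
      push_cast
      simp only [C_mul, C_add, C_1]
      ring
    rw [e]
    nontriviality R
    refine Submodule.add_mem _ ?_ ?_
    · rw [mem_degreeLT] at ih ⊢
      rcases eq_or_ne ((X + C r : R[X]) ^ (k + 1) - X ^ (k + 1) - C (((k : R) + 1) * r) * X ^ k) 0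
        with h0 | h0
      · rw [h0, mul_zero, degree_zero]; exact WithBot.bot_lt_coe _
      · rw [mul_comm, (monic_X_add_C r).degree_mul, degree_X_add_C]
        rw [degree_eq_natDegree h0] at ih ⊢
        have ih' := WithBot.coe_lt_coe.1 ih
        exact_mod_cast Nat.succ_lt_succ ih'
    · rw [mem_degreeLT]
      exact lt_of_le_of_lt (degree_C_mul_X_pow_le _ _) (by exact_mod_cast Nat.lt_succ_self k)

variable [Algebra ℂ R]

/-- `twistedSolution` solves the difference equation it is designed for. -/
theorem qdiff_twistedSolution (ħ κ : ℂ) (hκ : Complex.exp (κ / 2) - Complex.exp (-κ / 2) ≠ 0)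
    (g : R[X]) : qdiff ħ κ (twistedSolution ħ κ g) = g := by
  rw [twistedSolution, map_smul, ← LinearMap.smul_apply]
  refine apply_neumannInv _ (lowers_of_monomial _ fun k => ?_) g
  set t := Complex.exp (κ / 2) - Complex.exp (-κ / 2) with ht
  have h1 : algebraMap ℂ R t⁻¹ * algebraMap ℂ R t = 1 := by
    rw [← map_mul, inv_mul_cancel₀ hκ, map_one]
  have e1 : ∀ r : R, Polynomial.taylor r (X ^ k) = X ^ k + (Polynomial.taylor r (X ^ k) - X ^ k) :=
    fun r => by ring
  have : (1 - algebraMap ℂ R t⁻¹ • qdiff ħ κ : R[X] →ₗ[R] R[X]) (X ^ k : R[X]) =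
      -(algebraMap ℂ R t⁻¹ •
        (algebraMap ℂ R (Complex.exp (κ / 2)) •
          (Polynomial.taylor (algebraMap ℂ R (ħ / 2)) (X ^ k) - X ^ k) -
        algebraMap ℂ R (Complex.exp (-κ / 2)) •
          (Polynomial.taylor (algebraMap ℂ R (-ħ / 2)) (X ^ k) - X ^ k))) := by
    have h2 : (X ^ k : R[X]) = algebraMap ℂ R t⁻¹ • (algebraMap ℂ R (Complex.exp (κ / 2)) • X ^ k -
        algebraMap ℂ R (Complex.exp (-κ / 2)) • X ^ k) := by
      rw [← sub_smul, ← map_sub, ← ht, smul_smul, h1, one_smul]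
    simp only [qdiff, qshift, LinearMap.sub_apply, LinearMap.smul_apply, Module.End.one_apply,
      Int.cast_one, Int.cast_neg, mul_one, mul_neg, smul_sub] at h2 ⊢
    linear_combination h2
  rw [this]
  exact Submodule.neg_mem _ (Submodule.smul_mem _ _ (Submodule.sub_mem _
    (Submodule.smul_mem _ _ (taylor_X_pow_sub_mem _ _))
    (Submodule.smul_mem _ _ (taylor_X_pow_sub_mem _ _))))

/-- `twistlessSolution` solves the difference equation it is designed for. -/
theorem qdiff_twistlessSolution (ħ : ℂ) (hħ : ħ ≠ 0) (g : R[X]) :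
    qdiff ħ 0 (twistlessSolution ħ g) = g := by
  rw [twistlessSolution, map_smul, ← LinearMap.comp_apply, ← LinearMap.smul_apply]
  refine apply_neumannInv _ (lowers_of_monomial _ fun k => ?_) g
  have hk : (k : ℂ) + 1 ≠ 0 := by exact_mod_cast Nat.succ_ne_zero k
  have ha : antideriv (X ^ k : R[X]) = algebraMap ℂ R ((k : ℂ) + 1)⁻¹ • X ^ (k + 1) := by
    rw [antideriv, lsum_apply, X_pow_eq_monomial, sum_monomial_index _ _ (by simp)]
    simp [X_pow_eq_monomial]
  have h1 : algebraMap ℂ R ħ⁻¹ * (algebraMap ℂ R ((k : ℂ) + 1)⁻¹ *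
      (((k : R) + 1) * algebraMap ℂ R (ħ / 2) - ((k : R) + 1) * algebraMap ℂ R (-ħ / 2))) = 1 := by
    have : ((k : R) + 1) = algebraMap ℂ R ((k : ℂ) + 1) := by simp
    rw [this, ← map_mul, ← map_mul, ← map_sub, ← map_mul, ← map_mul, ← map_one (algebraMap ℂ R)]
    congr 1
    field_simp
    ring
  have h2 : (X ^ k : R[X]) = C (algebraMap ℂ R ħ⁻¹ * (algebraMap ℂ R ((k : ℂ) + 1)⁻¹ *
      (((k : R) + 1) * algebraMap ℂ R (ħ / 2) - ((k : R) + 1) * algebraMap ℂ R (-ħ / 2)))) *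
      X ^ k := by
    rw [h1, C_1, one_mul]
  have : (1 - algebraMap ℂ R ħ⁻¹ • (qdiff ħ 0 ∘ₗ antideriv) : R[X] →ₗ[R] R[X]) (X ^ k : R[X]) =
      -(algebraMap ℂ R ħ⁻¹ • (algebraMap ℂ R ((k : ℂ) + 1)⁻¹ •
        ((Polynomial.taylor (algebraMap ℂ R (ħ / 2)) (X ^ (k + 1)) - X ^ (k + 1) -
          C (((k : R) + 1) * algebraMap ℂ R (ħ / 2)) * X ^ k) -
        (Polynomial.taylor (algebraMap ℂ R (-ħ / 2)) (X ^ (k + 1)) - X ^ (k + 1) -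
          C (((k : R) + 1) * algebraMap ℂ R (-ħ / 2)) * X ^ k)))) := by
    simp only [LinearMap.sub_apply, LinearMap.smul_apply, Module.End.one_apply,
      LinearMap.comp_apply, ha, map_smul, qdiff, qshift, neg_zero, zero_div, Complex.exp_zero,
      map_one, one_smul, Int.cast_one, Int.cast_neg, mul_one, mul_neg]
    simp only [smul_eq_C_mul, C_mul, C_sub] at h2 ⊢
    linear_combination h2
  rw [this]
  exact Submodule.neg_mem _ (Submodule.smul_mem _ _ (Submodule.smul_mem _ _ (Submodule.sub_mem _
    (taylor_X_pow_succ_sub_mem _ _) (taylor_X_pow_succ_sub_mem _ _))))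

theorem twistlessSolution_coeff_zero (ħ : ℂ) (g : R[X]) :
    (twistlessSolution ħ g).coeff 0 = 0 := by
  have : ∀ f : R[X], (antideriv f).coeff 0 = 0 := by
    intro f
    simp only [antideriv, lsum_apply, Polynomial.sum, finsetSum_coeff]
    refine Finset.sum_eq_zero fun k _ => ?_
    simp [coeff_monomial]
  rw [twistlessSolution, coeff_smul, this, smul_zero]

end Facts



end WronskianBethe

end

/-! Eliminating χ identifies the Wronskian algebra with ℂ[c], where χ_ℓ acts as multiplication by
SW_ℓ. It remains to find a finite basis of ℂ[c] over A = ℂ[χ]; a basis survives every specialisation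
of χ, which gives the count of solutions.

Give u weight 1 and give each c the positive weight that makes the Q-functions homogeneous. Since ħ
has weight 0, shifts act by a scalar up to lower weight. Hence the Wronskian has a leading part
T(u), homogeneous of weight L, and SW_ℓ is a leading form of weight ℓ plus terms of lower weight.
Everything is reduced to one fact: T(u) is a constant multiple of u^L only at c = 0, that is, the
leading forms have no common zero besides the origin.

Granting this, the Nullstellensatz makes the quotient by the leading forms finite-dimensional. A
monomial basis of it generates ℂ[c] over A by induction on the weight (`exists_eq_sum_aeval_mul`).
There are as many equations as variables, so the resulting finite A-algebra is projective
(`projective_of_monic`, an explicit dual basis built from Bezoutian determinants and a residue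
functional). A splitting and Nakayama's lemma then kill all relations for the leading forms
(`eq_zero_of_graded`), and comparing top weights kills them for the SW_ℓ
(`eq_zero_of_sum_aeval_mul_eq_zero`).

Twisted case: T is a nonzero constant times the product of all q_a and q_i, the constant being a
Cauchy–Vandermonde determinant. If this product is u^L, every factor is a power of u.

Twist-less case: up to a constant, T is a determinant of antiderivatives of q_a q_i, with
integration constants, and of divided derivatives of q_a. Constant changes of the two families make
the orders of vanishing at u = 0 distinct and leave at most one constant in each row and column. The
order of the determinant can then be read off exactly, once more by Cauchy–Vandermonde
(`det_gramWronskian_order`). The gauge conditions bound the orders from above, and order L forces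
all bounds to be attained: all q are monomials and all constants vanish
(`gramWronskian_zero_fibre`). -/

set_option linter.unusedSectionVars false

noncomputable section

namespace WronskianBethe

/-! ### Projectivity of finite complete intersections through Bezoutians and residues -/

section Bezoutian

variable {ι B : Type*} [Fintype ι] [DecidableEq ι] [CommRing B]

/-- Exactness of the Koszul complex of the variables: the coefficient of the last variable involved
lies in the ideal of the other ones, so Koszul relations remove it and shorten the syzygy. The
target is an arbitrary submodule so that it can be a preimage under a linear map. -/
theorem mem_of_sum_mul_X_eq_zero (N : Submodule (MvPolynomial ι B) (ι → MvPolynomial ι B))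
    (hN : ∀ j k : ι, (Pi.single j (MvPolynomial.X k) - Pi.single k (MvPolynomial.X j) :
      ι → MvPolynomial ι B) ∈ N)
    (v : ι → MvPolynomial ι B) (hv : ∑ j, v j * MvPolynomial.X j = 0) : v ∈ N := by
  suffices H : ∀ (t : Finset ι) (v : ι → MvPolynomial ι B), (∀ j ∉ t, v j = 0) →
      ∑ j ∈ t, v j * MvPolynomial.X j = 0 → v ∈ N from H Finset.univ v (by simp) hv
  intro t
  induction t using Finset.induction_on with
  | empty =>
    intro v h0 _
    have : v = 0 := funext fun j => h0 j (by simp)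
    rw [this]; exact N.zero_mem
  | insert k t hk ih =>
    intro v h0 h1
    rw [Finset.sum_insert hk] at h1
    -- Monomial by monomial: if `m` occurs in `v k`, then `m` times `X k` is divisible by some `X i`
    -- with `i ∈ t`, and `i ≠ k` passes the divisibility on to `m`.
    have hspan : v k ∈ Ideal.span (MvPolynomial.X '' (t : Set ι)) := by
      rw [MvPolynomial.mem_ideal_span_X_image]
      intro m hm
      have hmem : v k * MvPolynomial.X k ∈
          Ideal.span (MvPolynomial.X '' (t : Set ι) : Set (MvPolynomial ι B)) := by
        rw [eq_neg_of_add_eq_zero_left h1]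
        refine neg_mem (Ideal.sum_mem _ fun j hj => Ideal.mul_mem_left _ _ ?_)
        exact Ideal.subset_span ⟨j, hj, rfl⟩
      rw [MvPolynomial.mem_ideal_span_X_image] at hmem
      obtain ⟨i, hi, hne⟩ := hmem (m + Finsupp.single k 1) (by
        rw [MvPolynomial.mem_support_iff, MvPolynomial.coeff_mul_X]
        exact MvPolynomial.mem_support_iff.1 hm)
      refine ⟨i, hi, ?_⟩
      have hik : k ≠ i := fun e => hk (e ▸ hi)
      simpa [Finsupp.single_apply, hik] using hne
    obtain ⟨a, ha⟩ : ∃ a : ι → MvPolynomial ι B, v k = ∑ j ∈ t, a j * MvPolynomial.X j := by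
      obtain ⟨l, hl, hl2⟩ := (Finsupp.mem_span_image_iff_linearCombination _).1 hspan
      refine ⟨l, ?_⟩
      rw [← hl2, Finsupp.linearCombination_apply, Finsupp.sum_of_support_subset l
        (s := t) (by exact_mod_cast hl) _ (by simp)]
      rfl
    have e1 : v = (v + ∑ j ∈ t, a j •
          (Pi.single j (MvPolynomial.X k) - Pi.single k (MvPolynomial.X j))) -
        ∑ j ∈ t, a j • (Pi.single j (MvPolynomial.X k) - Pi.single k (MvPolynomial.X j)) := by
      abel
    rw [e1]
    refine sub_mem (ih _ ?_ ?_) (sum_mem fun j _ => N.smul_mem _ (hN _ _))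
    · intro i hi
      rcases eq_or_ne i k with rfl | hik
      · have : ∀ j ∈ t, (a j • (Pi.single j (MvPolynomial.X i) - Pi.single i (MvPolynomial.X j)) :
            ι → MvPolynomial ι B) i = - (a j * MvPolynomial.X j) := by
          intro j hj
          have : i ≠ j := fun e => hk (e ▸ hj)
          simp [this]
        rw [Pi.add_apply, Finset.sum_apply, Finset.sum_congr rfl this, ha]
        simp
      · rw [Pi.add_apply, Finset.sum_apply, h0 i (by simp [hik, hi]), zero_add]
        refine Finset.sum_eq_zero fun j hj => ?_
        have : i ≠ j := fun e => hi (e ▸ hj)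
        simp [this, hik]
    · have : ∀ i ∈ t, (v + ∑ j ∈ t, a j •
          (Pi.single j (MvPolynomial.X k) - Pi.single k (MvPolynomial.X j)) :
            ι → MvPolynomial ι B) i = v i + a i * MvPolynomial.X k := by
        intro i hi
        have hik : i ≠ k := fun e => hk (e ▸ hi)
        rw [Pi.add_apply, Finset.sum_apply, Finset.sum_eq_single i]
        · simp [hik]
        · intro j _ hj
          simp [hj.symm, hik]
        · exact fun h => absurd hi h
      rw [Finset.sum_congr rfl fun i hi => by rw [this i hi, add_mul]]
      rw [Finset.sum_add_distrib, ← h1, ha, Finset.sum_mul, add_comm]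
      congr 1
      exact Finset.sum_congr rfl fun i _ => by ring

/-- Cramer's rule for the minors of the rows of `P` other than row `i`. -/
theorem det_updateRow_single_mul_sub_mem {R : Type*} [CommRing R] (P : Matrix ι ι R) (z : ι → R)
    (i j k : ι) :
    (P.updateRow i (Pi.single k 1)).det * z j - (P.updateRow i (Pi.single j 1)).det * z k ∈
      Ideal.span (Set.range (P.mulVec z)) := by
  set Q := P.updateRow i (Pi.single k 1) with hQ
  have h1 : Q.det * z j = ∑ l, Q.adjugate j l * Q.mulVec z l := by
    have : (Q.adjugate.mulVec (Q.mulVec z)) j = Q.det * z j := by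
      rw [Matrix.mulVec_mulVec, Matrix.adjugate_mul, Matrix.smul_mulVec, Matrix.one_mulVec]
      simp
    rw [← this]; rfl
  have h2 : Q.mulVec z i = z k := by
    simp [Matrix.mulVec, hQ]
  have h3 : ∀ l ≠ i, Q.mulVec z l = P.mulVec z l := by
    intro l hl
    simp [Matrix.mulVec, hQ, Matrix.updateRow_ne hl]
  have h4 : Q.adjugate j i = (P.updateRow i (Pi.single j 1)).det := by
    rw [Matrix.adjugate_apply, hQ, Matrix.updateRow_idem]
  rw [h1, ← Finset.add_sum_erase _ _ (Finset.mem_univ i), h2, h4, add_sub_cancel_left]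
  refine Ideal.sum_mem _ fun l hl => Ideal.mul_mem_left _ _ (Ideal.subset_span ⟨l, ?_⟩)
  exact (h3 l (Finset.ne_of_mem_erase hl)).symm

/-- The determinant is linear in the row `v`, so Koszul exactness reduces to `v = X_k e_j − X_j
e_k`, where the claim is Cramer's rule. -/
theorem det_updateRow_mem (P : Matrix ι ι (MvPolynomial ι B)) (i : ι) (v : ι → MvPolynomial ι B)
    (hv : ∑ j, v j * MvPolynomial.X j = 0) :
    (P.updateRow i v).det ∈ Ideal.span (Set.range (P.mulVec MvPolynomial.X)) := by
  let φ : (ι → MvPolynomial ι B) →ₗ[MvPolynomial ι B] MvPolynomial ι B :=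
    { toFun := fun v => (P.updateRow i v).det
      map_add' := fun u v => Matrix.det_updateRow_add _ _ _ _
      map_smul' := fun c v => Matrix.det_updateRow_smul _ _ _ _ }
  refine mem_of_sum_mul_X_eq_zero
    (Submodule.comap φ (Ideal.span (Set.range (P.mulVec MvPolynomial.X)))) (fun j k => ?_) v hv
  rw [Submodule.mem_comap, map_sub]
  have e : ∀ (j k : ι), φ (Pi.single j (MvPolynomial.X k)) =
      (P.updateRow i (Pi.single j 1)).det * MvPolynomial.X k := by
    intro j k
    have : (Pi.single j (MvPolynomial.X k) : ι → MvPolynomial ι B) =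
        (MvPolynomial.X k : MvPolynomial ι B) • Pi.single j 1 := by
      rw [← Pi.single_smul, smul_eq_mul, mul_one]
    rw [this, map_smul, smul_eq_mul, mul_comm]
    rfl
  rw [e, e]
  exact det_updateRow_single_mul_sub_mem P _ i k j

/-- Exchange one row at a time. All hybrid matrices have the same product with the variables, hence
the same ideal, and each exchanged row differs from the old one by a syzygy. -/
theorem det_sub_det_mem_of_mulVec_X_eq (P P' : Matrix ι ι (MvPolynomial ι B))
    (h : P.mulVec MvPolynomial.X = P'.mulVec MvPolynomial.X) :
    P'.det - P.det ∈ Ideal.span (Set.range (P.mulVec MvPolynomial.X)) := by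
  suffices H : ∀ t : Finset ι,
      (Matrix.of fun i => if i ∈ t then P' i else P i).det - P.det ∈
        Ideal.span (Set.range (P.mulVec MvPolynomial.X)) by
    convert H Finset.univ
    ext; simp
  intro t
  induction t using Finset.induction_on with
  | empty =>
    have : (Matrix.of fun i => if i ∈ (∅ : Finset ι) then P' i else P i) = P := by
      ext i j; simp
    rw [this, sub_self]
    exact zero_mem _
  | insert k t hk ih =>
    set H : Matrix ι ι (MvPolynomial ι B) := Matrix.of fun i => if i ∈ t then P' i else P i with hH
    have hz : H.mulVec MvPolynomial.X = P.mulVec MvPolynomial.X := by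
      ext1 i
      by_cases hi : i ∈ t
      · rw [h]; simp [Matrix.mulVec, hH, hi]
      · simp [Matrix.mulVec, hH, hi]
    have e : (Matrix.of fun i => if i ∈ insert k t then P' i else P i) =
        H.updateRow k (P k + (P' k - P k)) := by
      ext i j : 2
      rcases eq_or_ne i k with rfl | hik
      · simp
      · rw [Matrix.updateRow_ne hik]; simp [hH, hik]
    have e2 : H.updateRow k (P k) = H := by
      ext i j : 2
      rcases eq_or_ne i k with rfl | hik
      · simp [hH, hk]
      · rw [Matrix.updateRow_ne hik]
    rw [e, Matrix.det_updateRow_add, e2, add_sub_right_comm]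
    refine add_mem ih ?_
    rw [← hz]
    refine det_updateRow_mem _ _ _ ?_
    have := congrFun h k
    simp only [Matrix.mulVec, dotProduct] at this
    simp only [Pi.sub_apply, sub_mul, Finset.sum_sub_distrib, this, sub_self]

theorem det_sub_det_mem_of_mulVec_eq (y : ι → B) (P P' : Matrix ι ι (MvPolynomial ι B))
    (h : P.mulVec (fun j => MvPolynomial.X j - MvPolynomial.C (y j)) =
      P'.mulVec (fun j => MvPolynomial.X j - MvPolynomial.C (y j))) :
    P'.det - P.det ∈ Ideal.span
      (Set.range (P.mulVec (fun j => MvPolynomial.X j - MvPolynomial.C (y j)))) := by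
  let φ : MvPolynomial ι B →ₐ[B] MvPolynomial ι B :=
    MvPolynomial.aeval fun j => MvPolynomial.X j + MvPolynomial.C (y j)
  let ψ : MvPolynomial ι B →ₐ[B] MvPolynomial ι B :=
    MvPolynomial.aeval fun j => MvPolynomial.X j - MvPolynomial.C (y j)
  have hψφ : ψ.comp φ = AlgHom.id B _ := by
    ext j; simp [φ, ψ, ← MvPolynomial.algebraMap_eq]
  have hX : (φ ∘ fun j => MvPolynomial.X j - MvPolynomial.C (y j)) = MvPolynomial.X := by
    ext1 j; simp [φ, ← MvPolynomial.algebraMap_eq]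
  have hP : ∀ P : Matrix ι ι (MvPolynomial ι B),
      (φ.toRingHom.mapMatrix P).mulVec MvPolynomial.X =
        φ ∘ P.mulVec (fun j => MvPolynomial.X j - MvPolynomial.C (y j)) := by
    intro P
    ext1 i
    have := RingHom.map_mulVec φ.toRingHom P
      (fun j => MvPolynomial.X j - MvPolynomial.C (y j)) i
    simp only [AlgHom.toRingHom_eq_coe, RingHom.coe_coe] at this
    rw [Function.comp_apply, this, hX]
    rfl
  have key := det_sub_det_mem_of_mulVec_X_eq (φ.toRingHom.mapMatrix P) (φ.toRingHom.mapMatrix P')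
    (by rw [hP, hP, h])
  rw [hP, ← RingHom.map_det, ← RingHom.map_det, ← map_sub] at key
  have key2 := Ideal.mem_map_of_mem ψ.toRingHom key
  have hid : ∀ p, ψ.toRingHom (φ.toRingHom p) = p := fun p => DFunLike.congr_fun hψφ p
  rw [hid, Ideal.map_span, ← Set.range_comp] at key2
  convert key2 using 4
  ext1 i
  exact (hid _).symm

theorem sub_C_eval_mem {κ : Type*} (y : κ → B) (p : MvPolynomial κ B) :
    p - MvPolynomial.C (MvPolynomial.eval y p) ∈
      Ideal.span (Set.range fun j => MvPolynomial.X j - MvPolynomial.C (y j)) := by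
  rw [← Ideal.Quotient.mk_eq_mk_iff_sub_mem]
  induction p using MvPolynomial.induction_on with
  | C a => simp
  | add p q hp hq => simp only [map_add, hp, hq]
  | mul_X p i hp =>
    simp only [map_mul, hp, MvPolynomial.eval_X]
    congr 1
    rw [Ideal.Quotient.mk_eq_mk_iff_sub_mem]
    exact Ideal.subset_span ⟨i, rfl⟩

/-- The coefficient of `X ^ (deg g - 1)` of the remainder modulo `g`. -/
def remainderTop {R : Type*} [CommRing R] (g : R[X]) : R[X] →ₗ[R] R :=
  Polynomial.lcoeff R (g.natDegree - 1) ∘ₗ Polynomial.modByMonicHom g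

/-- The product of the functionals `remainderTop (g i)` on `R[x_i : i ∈ ι]`. -/
def residue {R : Type*} [CommRing R] (g : ι → R[X]) : MvPolynomial ι R →ₗ[R] R :=
  (MvPolynomial.basisMonomials ι R).constr R fun k => ∏ i, remainderTop (g i) (X ^ k i)

section Residue

variable {R : Type*} [CommRing R] (g : ι → R[X])

theorem residue_monomial (k : ι →₀ ℕ) :
    residue g (MvPolynomial.monomial k 1) = ∏ i, remainderTop (g i) (X ^ k i) := by
  have := Module.Basis.constr_basis (MvPolynomial.basisMonomials ι R) R
    (fun k => ∏ i, remainderTop (g i) (X ^ k i)) k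
  rwa [MvPolynomial.coe_basisMonomials] at this

/-- The functional is multiplicative across different variables. The extra monomial absorbs the
powers of a variable split off in the induction. -/
theorem residue_prod_mul_monomial (h : ι → R[X]) (s : Finset ι) (k : ι →₀ ℕ) :
    residue g ((∏ i ∈ s, aeval (MvPolynomial.X i) (h i)) * MvPolynomial.monomial k 1) =
      ∏ i, remainderTop (g i) ((if i ∈ s then h i else 1) * X ^ k i) := by
  induction s using Finset.induction_on generalizing k with
  | empty => simp [residue_monomial]
  | insert j s hj ih =>
    have e1 : (∏ i ∈ insert j s, aeval (MvPolynomial.X i : MvPolynomial ι R) (h i)) *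
        MvPolynomial.monomial k 1 = ∑ n ∈ (h j).support, (h j).coeff n •
          ((∏ i ∈ s, aeval (MvPolynomial.X i) (h i)) *
            MvPolynomial.monomial (k + Finsupp.single j n) 1) := by
      rw [Finset.prod_insert hj, mul_comm (aeval _ _), mul_assoc, aeval_eq_sum_range' (Nat.lt_succ_self _)]
      rw [← Finset.sum_subset (supp_subset_range_natDegree_succ (p := h j)) (by
        intro n _ hn; simp [notMem_support_iff.1 hn])]
      rw [Finset.sum_mul, Finset.mul_sum]
      refine Finset.sum_congr rfl fun n _ => ?_
      rw [smul_mul_assoc, mul_smul_comm, MvPolynomial.X_pow_eq_monomial,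
        MvPolynomial.monomial_mul, one_mul, add_comm]
    have e2 : ∀ n, ∏ i, remainderTop (g i) ((if i ∈ s then h i else 1) *
        X ^ (k + Finsupp.single j n) i) = remainderTop (g j) (X ^ n * X ^ k j) *
          ∏ i ∈ Finset.univ.erase j, remainderTop (g i) ((if i ∈ s then h i else 1) * X ^ k i) := by
      intro n
      rw [← Finset.mul_prod_erase _ _ (Finset.mem_univ j), if_neg hj]
      congr 1
      · simp [pow_add, mul_comm]
      · refine Finset.prod_congr rfl fun i hi => ?_
        simp [(Finset.ne_of_mem_erase hi).symm]
    rw [e1, map_sum]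
    simp only [map_smul, ih, e2, smul_eq_mul, ← mul_assoc]
    rw [← Finset.sum_mul, ← Finset.mul_prod_erase _ _ (Finset.mem_univ j)]
    congr 1
    · rw [if_pos (Finset.mem_insert_self _ _)]
      conv_rhs => rw [(h j).as_sum_support_C_mul_X_pow, Finset.sum_mul, map_sum]
      refine Finset.sum_congr rfl fun n _ => ?_
      rw [mul_assoc, ← smul_eq_C_mul, map_smul, smul_eq_mul]
    · refine Finset.prod_congr rfl fun i hi => ?_
      simp [Finset.ne_of_mem_erase hi]

theorem residue_aeval_mul (hg : ∀ i, (g i).Monic) (i : ι) (q : MvPolynomial ι R) :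
    residue g (aeval (MvPolynomial.X i) (g i) * q) = 0 := by
  induction q using MvPolynomial.induction_on' with
  | monomial k a =>
    have := residue_prod_mul_monomial g g {i} k
    rw [Finset.prod_singleton] at this
    have e : MvPolynomial.monomial k a = a • MvPolynomial.monomial k (1 : R) := by
      rw [MvPolynomial.smul_monomial, smul_eq_mul, mul_one]
    rw [e, mul_smul_comm, map_smul, this, Finset.prod_eq_zero (Finset.mem_univ i), smul_zero]
    simp [remainderTop, modByMonicHom, self_mul_modByMonic (hg i)]
  | add p q hp hq => rw [mul_add, map_add, hp, hq, add_zero]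

theorem residue_eq_zero_of_mem (hg : ∀ i, (g i).Monic) (q : MvPolynomial ι R)
    (hq : q ∈ Ideal.span (Set.range fun i => aeval (MvPolynomial.X i : MvPolynomial ι R) (g i))) :
    residue g q = 0 := by
  obtain ⟨c, rfl⟩ := Submodule.mem_span_range_iff_exists_fun _ |>.1 hq
  rw [map_sum]
  refine Finset.sum_eq_zero fun i _ => ?_
  rw [smul_eq_mul, mul_comm, residue_aeval_mul g hg]

/-- Each `h i` is its own remainder modulo `g i`, and the coefficient read off is its leading one.
-/
theorem residue_prod_eq_one [Nontrivial R] (hg : ∀ i, (g i).Monic) (h : ι → R[X])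
    (hh : ∀ i, (h i).Monic) (hd : ∀ i, (g i).natDegree = (h i).natDegree + 1) :
    residue g (∏ i, aeval (MvPolynomial.X i) (h i)) = 1 := by
  have := residue_prod_mul_monomial g h Finset.univ 0
  rw [MvPolynomial.monomial_zero', MvPolynomial.C_1, mul_one] at this
  rw [this]
  refine Finset.prod_eq_one fun i _ => ?_
  have e : h i %ₘ g i = h i := by
    rw [modByMonic_eq_self_iff (hg i)]
    exact degree_lt_degree (by rw [hd]; exact Nat.lt_succ_self _)
  simp [remainderTop, modByMonicHom, e, hd, hh i]

theorem residue_map {B : Type*} [CommRing B] [Nontrivial B] (φ : R →+* B)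
    (hg : ∀ i, (g i).Monic) (p : MvPolynomial ι R) :
    residue (fun i => (g i).map φ) (MvPolynomial.map φ p) = φ (residue g p) := by
  induction p using MvPolynomial.induction_on' with
  | monomial k a =>
    have e1 : MvPolynomial.monomial k a = a • MvPolynomial.monomial k 1 := by
      rw [MvPolynomial.smul_monomial, smul_eq_mul, mul_one]
    have e2 : MvPolynomial.monomial k (φ a) = φ a • MvPolynomial.monomial k 1 := by
      rw [MvPolynomial.smul_monomial, smul_eq_mul, mul_one]
    rw [MvPolynomial.map_monomial, e1, e2, map_smul, map_smul, residue_monomial, residue_monomial,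
      smul_eq_mul, smul_eq_mul, map_mul, map_prod]
    congr 1
    refine Finset.prod_congr rfl fun i _ => ?_
    simp only [remainderTop, modByMonicHom, LinearMap.comp_apply, LinearMap.coe_mk,
      AddHom.coe_mk, lcoeff_apply]
    rw [(hg i).natDegree_map, ← coeff_map, map_modByMonic _ (hg i), Polynomial.map_pow, map_X]
  | add p q hp hq => rw [map_add, map_add, hp, hq, map_add, map_add]

end Residue

/-- Let y_i be the class of X_i in B and z_j = X_j − y_j. Over R one has g = M f, over B one has f =
P z, and division of g_i by X_i − y_i gives g = diag(h) z. So det M · det P agrees with ∏ h_i modulo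
g and has residue 1. It follows that the residue of s · det M · det P is the class of s; expanding
det P into monomials with coefficients in B turns this into a finite dual basis of B. -/
theorem projective_of_monic {R : Type*} [CommRing R] [Algebra R B]
    (mk : MvPolynomial ι R →ₐ[R] B) (hmk : Function.Surjective mk) (f : ι → MvPolynomial ι R)
    (hker : ∀ p, p ∈ Ideal.span (Set.range f) → mk p = 0)
    (hker' : ∀ p, mk p = 0 → p ∈ Ideal.span (Set.range f))
    (g : ι → R[X]) (hg : ∀ i, (g i).Monic)
    (hgf : ∀ i, mk (aeval (MvPolynomial.X i : MvPolynomial ι R) (g i)) = 0) :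
    Module.Projective R B := by
  rcases subsingleton_or_nontrivial B with hB | hB
  · infer_instance
  let φ : R →+* B := algebraMap R B
  let y : ι → B := fun i => mk (MvPolynomial.X i)
  have hy : ∀ p, MvPolynomial.eval y (MvPolynomial.map φ p) = mk p := by
    intro p
    rw [MvPolynomial.eval_map]
    have : MvPolynomial.aeval y = mk := by ext i; simp [y]
    rw [← this]; rfl
  let z : ι → MvPolynomial ι B :=
    fun j => MvPolynomial.X j - MvPolynomial.C (y j)
  have hM : ∀ i, ∃ c : ι → MvPolynomial ι R, ∑ j, c j • f j = aeval (MvPolynomial.X i) (g i) :=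
    fun i => (Submodule.mem_span_range_iff_exists_fun _).1 (hker' _ (hgf i))
  choose M hM using hM
  have hP : ∀ i, ∃ c : ι → MvPolynomial ι B,
      ∑ j, c j • z j = MvPolynomial.map φ (f i) := by
    intro i
    refine (Submodule.mem_span_range_iff_exists_fun _).1 ?_
    have := sub_C_eval_mem y (MvPolynomial.map φ (f i))
    rwa [hy, hker _ (Ideal.subset_span ⟨i, rfl⟩), map_zero, sub_zero] at this
  choose P hP using hP
  have hh : ∀ i, ∃ h, (g i).map φ = (X - C (y i)) * h := by
    intro i
    refine dvd_iff_isRoot.2 ?_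
    rw [IsRoot.def, eval_map]
    have : aeval (y i) (g i) = mk (aeval (MvPolynomial.X i) (g i)) := by
      rw [← aeval_algHom_apply]
    rw [hgf i] at this
    exact this
  choose h hh using hh
  have hhm : ∀ i, (h i).Monic := fun i =>
    (monic_X_sub_C (y i)).of_mul_monic_left (hh i ▸ (hg i).map φ)
  let G : ι → MvPolynomial ι B := fun i =>
    aeval (MvPolynomial.X i) ((g i).map φ)
  have hG : ∀ i, MvPolynomial.map φ (aeval (MvPolynomial.X i) (g i)) = G i := by
    intro i
    simp only [G, aeval_def, hom_eval₂, eval₂_map, MvPolynomial.map_X]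
    congr 1
    ext r
    simp [MvPolynomial.algebraMap_eq]
  set MB : Matrix ι ι (MvPolynomial ι B) :=
    (MvPolynomial.map φ).mapMatrix (Matrix.of M) with hMB
  have hdet : MB.det = MvPolynomial.map φ (Matrix.of M).det := (RingHom.map_det _ _).symm
  have hPz : (Matrix.of P).mulVec z = fun i => MvPolynomial.map φ (f i) := by
    ext1 i; rw [← hP]; rfl
  have hMf : (Matrix.of M).mulVec f = fun i => aeval (MvPolynomial.X i) (g i) := by
    ext1 i; rw [← hM]; rfl
  have hMBz : (MB * Matrix.of P).mulVec z = G := by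
    rw [← Matrix.mulVec_mulVec, hPz]
    ext1 i
    rw [← hG, ← congrFun hMf i, RingHom.map_mulVec]
    rfl
  have hDz : (Matrix.diagonal fun i => aeval (MvPolynomial.X i) (h i)).mulVec z = G := by
    ext1 i
    rw [Matrix.mulVec_diagonal]
    simp only [G, hh, map_mul, z, map_sub, aeval_X, aeval_C, MvPolynomial.algebraMap_eq]
    rw [mul_comm]
  set T := residue fun i => (g i).map φ with hT
  have hgm : ∀ i, ((g i).map φ).Monic := fun i => (hg i).map φ
  -- Both `diag(h)` and `M P` send `z` to `G`, so their determinants agree modulo `G`, where the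
  -- residue vanishes.
  have hT1 : T (MB.det * (Matrix.of P).det) = 1 := by
    have h1 := det_sub_det_mem_of_mulVec_eq y _ _ (hDz.trans hMBz.symm)
    rw [Matrix.det_mul, Matrix.det_diagonal] at h1
    have h2 := residue_eq_zero_of_mem _ hgm _ (hDz ▸ h1)
    rw [map_sub, sub_eq_zero] at h2
    rw [h2]
    refine residue_prod_eq_one _ hgm h hhm fun i => ?_
    rw [hh, (monic_X_sub_C (y i)).natDegree_mul (hhm i), natDegree_X_sub_C, add_comm]
  have hdMf : ∀ i, (Matrix.of M).det * f i ∈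
      Ideal.span (Set.range fun i => aeval (MvPolynomial.X i : MvPolynomial ι R) (g i)) := by
    intro i
    have : ((Matrix.of M).adjugate.mulVec ((Matrix.of M).mulVec f)) i =
        (Matrix.of M).det * f i := by
      rw [Matrix.mulVec_mulVec, Matrix.adjugate_mul, Matrix.smul_mulVec, Matrix.one_mulVec]
      simp
    rw [← this, hMf]
    exact Ideal.sum_mem _ fun l _ => Ideal.mul_mem_left _ _ (Ideal.subset_span ⟨l, rfl⟩)
  have hPzj : ∀ j, z j * (Matrix.of P).det ∈
      Ideal.span (Set.range fun i => MvPolynomial.map φ (f i)) := by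
    intro j
    have : ((Matrix.of P).adjugate.mulVec ((Matrix.of P).mulVec z)) j =
        z j * (Matrix.of P).det := by
      rw [Matrix.mulVec_mulVec, Matrix.adjugate_mul, Matrix.smul_mulVec, Matrix.one_mulVec]
      simp [mul_comm]
    rw [← this, hPz]
    exact Ideal.sum_mem _ fun l _ => Ideal.mul_mem_left _ _ (Ideal.subset_span ⟨l, rfl⟩)
  -- By Cramer's rule `det M` carries the ideal of the `f i` into that of the `G i`.
  have hkill : ∀ q ∈ Ideal.span (Set.range fun i => MvPolynomial.map φ (f i)),
      T (MB.det * q) = 0 := by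
    intro q hq
    obtain ⟨c, rfl⟩ := Submodule.mem_span_range_iff_exists_fun _ |>.1 hq
    refine residue_eq_zero_of_mem _ hgm _ ?_
    rw [Finset.mul_sum]
    refine Ideal.sum_mem _ fun i _ => ?_
    rw [smul_eq_mul, mul_left_comm, hdet, ← map_mul]
    refine Ideal.mul_mem_left _ _ ?_
    have := Ideal.mem_map_of_mem (MvPolynomial.map φ) (hdMf i)
    rw [Ideal.map_span, ← Set.range_comp] at this
    have e : (MvPolynomial.map φ ∘ fun i => aeval (MvPolynomial.X i : MvPolynomial ι R) (g i)) =
        G := funext hG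
    rwa [e] at this
  -- Modulo the `z j` the polynomial `s` is the scalar `mk s`, and `det P` carries `z j` into the
  -- ideal of the `f i`, which `hkill` handles.
  have hrep : ∀ s : MvPolynomial ι R,
      T (MvPolynomial.map φ s * (MB.det * (Matrix.of P).det)) = mk s := by
    intro s
    have h1 := sub_C_eval_mem y (MvPolynomial.map φ s)
    rw [hy] at h1
    obtain ⟨c, hc⟩ := Submodule.mem_span_range_iff_exists_fun _ |>.1 h1
    have h2 : T ((MvPolynomial.map φ s - MvPolynomial.C (mk s)) *
        (MB.det * (Matrix.of P).det)) = 0 := by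
      rw [mul_left_comm]
      refine hkill _ ?_
      rw [← hc, Finset.sum_mul]
      refine Ideal.sum_mem _ fun i _ => ?_
      rw [smul_eq_mul, mul_assoc]
      exact Ideal.mul_mem_left _ _ (hPzj i)
    rw [sub_mul, map_sub, sub_eq_zero, MvPolynomial.C_mul', map_smul, hT1] at h2
    rw [h2, smul_eq_mul, mul_one]
  set d := (Matrix.of P).det with hd
  have hrep2 : ∀ s : MvPolynomial ι R, mk s = ∑ k ∈ d.support,
      residue g (s * (Matrix.of M).det * MvPolynomial.monomial k 1) • d.coeff k := by
    intro s
    rw [← hrep, hdet]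
    conv_lhs => rw [d.as_sum, Finset.mul_sum, Finset.mul_sum, map_sum]
    refine Finset.sum_congr rfl fun k _ => ?_
    have e : MvPolynomial.monomial k (d.coeff k) =
        d.coeff k • MvPolynomial.map φ (MvPolynomial.monomial k 1) := by
      rw [MvPolynomial.map_monomial, MvPolynomial.smul_monomial, map_one, smul_eq_mul, mul_one]
    rw [e, mul_smul_comm, mul_smul_comm, map_smul, ← mul_assoc, ← map_mul, ← map_mul, hT,
      residue_map g φ hg, smul_eq_mul, mul_comm, Algebra.smul_def]
  -- The coordinate functionals of the dual basis; they vanish on the kernel of `mk` and so descend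
  -- to `B`.
  let α : MvPolynomial ι R →ₗ[R] (d.support → R) :=
    LinearMap.pi fun k => (residue g) ∘ₗ
      (LinearMap.mulRight R ((Matrix.of M).det * MvPolynomial.monomial k.1 1))
  have hα : LinearMap.ker mk.toLinearMap ≤ LinearMap.ker α := by
    intro q hq
    rw [LinearMap.mem_ker]
    ext1 k
    refine residue_eq_zero_of_mem _ hg _ ?_
    obtain ⟨c, rfl⟩ := Submodule.mem_span_range_iff_exists_fun _ |>.1 (hker' _ hq)
    rw [LinearMap.mulRight_apply, Finset.sum_mul]
    refine Ideal.sum_mem _ fun i _ => ?_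
    rw [smul_eq_mul, show c i * f i * ((Matrix.of M).det * MvPolynomial.monomial k.1 1) =
      c i * MvPolynomial.monomial k.1 1 * ((Matrix.of M).det * f i) by ring]
    exact Ideal.mul_mem_left _ _ (hdMf i)
  let eq := mk.toLinearMap.quotKerEquivOfSurjective hmk
  let β : B →ₗ[R] (d.support → R) := (Submodule.liftQ _ α hα) ∘ₗ eq.symm.toLinearMap
  let γ : (d.support → R) →ₗ[R] B := Fintype.linearCombination R fun k => d.coeff k.1
  refine Module.Projective.of_split β γ (LinearMap.ext fun b => ?_)
  obtain ⟨s, rfl⟩ := hmk b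
  have h1 : β (mk s) = α s := by
    have : eq.symm (mk s) = Submodule.Quotient.mk s := by
      rw [LinearEquiv.symm_apply_eq]; rfl
    simp only [β, LinearMap.comp_apply, LinearEquiv.coe_coe, this, Submodule.liftQ_apply]
  rw [LinearMap.comp_apply, h1, LinearMap.id_apply]
  refine Eq.trans ?_ (hrep2 s).symm
  rw [Fintype.linearCombination_apply, ← Finset.sum_coe_sort d.support fun k =>
    residue g (s * (Matrix.of M).det * MvPolynomial.monomial k 1) • d.coeff k]
  refine Finset.sum_congr rfl fun k _ => ?_
  simp only [α, LinearMap.pi_apply, LinearMap.comp_apply, LinearMap.mulRight_apply, mul_assoc]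

end Bezoutian

/-! ### The filtration of ℂ[c] by weight -/

section LowerWeight

variable {σ : Type*} (w : σ → ℕ)

/-- The polynomials all of whose monomials have weight less than `n`. -/
def lowerWeight (n : ℕ) : Submodule ℂ (MvPolynomial σ ℂ) where
  carrier := {p | ∀ m, p.coeff m ≠ 0 → Finsupp.weight w m < n}
  zero_mem' := by intro m hm; simp at hm
  add_mem' := by
    intro p q hp hq m hm
    rw [MvPolynomial.coeff_add] at hm
    by_cases h : p.coeff m = 0
    · exact hq m (by simpa [h] using hm)
    · exact hp m h
  smul_mem' := by
    intro c p hp m hm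
    rw [MvPolynomial.coeff_smul] at hm
    exact hp m fun h => hm (by rw [h, smul_zero])

variable {w}

theorem lowerWeight_mono {a b : ℕ} (h : a ≤ b) : lowerWeight w a ≤ lowerWeight w b :=
  fun _ hp m hm => (hp m hm).trans_le h

theorem lowerWeight_of_isWeightedHomogeneous {p : MvPolynomial σ ℂ} {a b : ℕ}
    (hp : p.IsWeightedHomogeneous w a) (h : a < b) : p ∈ lowerWeight w b :=
  fun _ hm => (hp hm).trans_lt h

theorem eq_zero_of_mem_lowerWeight {p : MvPolynomial σ ℂ} {a : ℕ}
    (hp : p.IsWeightedHomogeneous w a) (h : p ∈ lowerWeight w a) : p = 0 := by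
  ext m
  by_contra hm
  exact absurd (hp hm) (h m hm).ne

/-- The bound `a + 1` is strict, so the first factor has weight at most `a` and only the second one
supplies the strict inequality. -/
theorem lowerWeight_mul {p q : MvPolynomial σ ℂ} {a b : ℕ}
    (hp : p ∈ lowerWeight w (a + 1)) (hq : q ∈ lowerWeight w b) : p * q ∈ lowerWeight w (a + b) := by
  classical
  intro m hm
  rw [MvPolynomial.coeff_mul] at hm
  obtain ⟨⟨x, y⟩, hxy, hne⟩ := Finset.exists_ne_zero_of_sum_ne_zero hm
  have e : x + y = m := Finset.HasAntidiagonal.mem_antidiagonal.1 hxy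
  have h1 := hp x (left_ne_zero_of_mul hne)
  have h2 := hq y (right_ne_zero_of_mul hne)
  rw [← e, map_add]
  omega

theorem weightedHomogeneousComponent_mul {p q : MvPolynomial σ ℂ} {d : ℕ}
    (hq : q.IsWeightedHomogeneous w d) (n : ℕ) :
    MvPolynomial.weightedHomogeneousComponent w n (p * q) =
      if d ≤ n then MvPolynomial.weightedHomogeneousComponent w (n - d) p * q else 0 := by
  classical
  induction p using MvPolynomial.induction_on' with
  | monomial u a =>
    have h1 : (MvPolynomial.monomial u a).IsWeightedHomogeneous w (Finsupp.weight w u) :=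
      MvPolynomial.isWeightedHomogeneous_monomial _ _ _ rfl
    rw [MvPolynomial.weightedHomogeneousComponent_of_mem (h1.mul hq),
      MvPolynomial.weightedHomogeneousComponent_of_mem h1]
    by_cases h : d ≤ n
    · rw [if_pos h]
      by_cases h2 : n = Finsupp.weight w u + d
      · rw [if_pos h2, if_pos (by omega)]
      · rw [if_neg h2, if_neg (by omega), zero_mul]
    · rw [if_neg h, if_neg (by omega)]
  | add p p' hp hp' =>
    rw [add_mul, map_add, hp, hp', map_add]
    split_ifs
    · rw [add_mul]
    · rw [add_zero]

theorem sub_weightedHomogeneousComponent_mem {p : MvPolynomial σ ℂ} {n : ℕ}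
    (hp : p ∈ lowerWeight w (n + 1)) :
    p - MvPolynomial.weightedHomogeneousComponent w n p ∈ lowerWeight w n := by
  classical
  intro m hm
  rw [MvPolynomial.coeff_sub, MvPolynomial.coeff_weightedHomogeneousComponent] at hm
  by_cases h : Finsupp.weight w m = n
  · simp [h] at hm
  · rw [if_neg h, sub_zero] at hm
    have := hp m hm
    omega

theorem exists_mem_lowerWeight (p : MvPolynomial σ ℂ) : ∃ n, p ∈ lowerWeight w n :=
  ⟨MvPolynomial.weightedTotalDegree w p + 1, fun _ hm => Nat.lt_succ_of_le
    (MvPolynomial.le_weightedTotalDegree w (MvPolynomial.mem_support_iff.2 hm))⟩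

end LowerWeight

/-! ### Generation and independence pass from leading forms to their deformations -/

section Deformation

variable {σ κ τ : Type*} [Fintype κ] [Fintype τ] {w : σ → ℕ} {d : τ → ℕ} {e : κ → ℕ}
  {f g : τ → MvPolynomial σ ℂ} {b : κ → MvPolynomial σ ℂ}

/-- A homogeneous generating set modulo the leading forms generates over the deformed algebra. -/
theorem exists_eq_sum_aeval_mul (hd : ∀ l, 0 < d l)
    (hf : ∀ l, (f l).IsWeightedHomogeneous w (d l)) (hg : ∀ l, g l - f l ∈ lowerWeight w (d l))
    (hbw : ∀ j, (b j).IsWeightedHomogeneous w (e j))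
    (hb : ∀ s, ∃ c : κ → ℂ, ∃ h : τ → MvPolynomial σ ℂ, s = ∑ j, c j • b j + ∑ l, h l * f l)
    (s : MvPolynomial σ ℂ) :
    ∃ a : κ → MvPolynomial τ ℂ, s = ∑ j, MvPolynomial.aeval g (a j) * b j := by
  classical
  let N : Submodule ℂ (MvPolynomial σ ℂ) :=
    { carrier := {s | ∃ a : κ → MvPolynomial τ ℂ, s = ∑ j, MvPolynomial.aeval g (a j) * b j}
      zero_mem' := ⟨0, by simp⟩
      add_mem' := by
        rintro _ _ ⟨a, rfl⟩ ⟨a', rfl⟩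
        exact ⟨a + a', by simp [add_mul, Finset.sum_add_distrib]⟩
      smul_mem' := by
        rintro c _ ⟨a, rfl⟩
        exact ⟨c • a, by simp [Finset.smul_sum]⟩ }
  have hNg : ∀ l, ∀ s ∈ N, s * g l ∈ N := by
    rintro l _ ⟨a, rfl⟩
    refine ⟨fun j => a j * MvPolynomial.X l, ?_⟩
    rw [Finset.sum_mul]
    refine Finset.sum_congr rfl fun j _ => ?_
    rw [map_mul, MvPolynomial.aeval_X]; ring
  have hNb : ∀ j, b j ∈ N := by
    intro j
    refine ⟨Pi.single j 1, ?_⟩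
    rw [Finset.sum_eq_single j]
    · simp
    · intro i _ hi; simp [hi]
    · simp
  suffices H : ∀ n, lowerWeight w n ≤ N by
    obtain ⟨n, hn⟩ := exists_mem_lowerWeight (w := w) s
    exact H n hn
  intro n
  induction n using Nat.strong_induction_on with
  | _ n ih =>
    rcases n with _ | n
    · intro s hs
      have : s = 0 := by
        ext m; by_contra h; exact absurd (hs m h) (Nat.not_lt_zero _)
      rw [this]; exact N.zero_mem
    intro s hs
    rw [← sub_add_cancel s (MvPolynomial.weightedHomogeneousComponent w n s)]
    refine add_mem (ih n (Nat.lt_succ_self n) (sub_weightedHomogeneousComponent_mem hs)) ?_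
    obtain ⟨c, h, hch⟩ := hb s
    rw [hch, map_add, map_sum, map_sum]
    refine add_mem (sum_mem fun j _ => ?_) (sum_mem fun l _ => ?_)
    · rw [map_smul, MvPolynomial.weightedHomogeneousComponent_of_mem (hbw j)]
      refine N.smul_mem _ ?_
      split_ifs
      · exact hNb j
      · exact N.zero_mem
    · rw [weightedHomogeneousComponent_mul (hf l)]
      split_ifs with hle
      swap
      · exact N.zero_mem
      have h1 := MvPolynomial.weightedHomogeneousComponent_isWeightedHomogeneous (w := w)
        (n - d l) (h l)
      set h' := MvPolynomial.weightedHomogeneousComponent w (n - d l) (h l)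
      -- Trade the leading form for its deformation. The coefficient `h'` has smaller weight because
      -- `0 < d l`, and so has the error term because `g l - f l` is of lower weight; the induction
      -- hypothesis covers both.
      have h2 : h' * f l = h' * g l - h' * (g l - f l) := by ring
      have h3 := hd l
      rw [h2]
      refine sub_mem (hNg l _ (ih n (by omega) (lowerWeight_of_isWeightedHomogeneous h1
        (by omega)))) (ih n (by omega) ?_)
      have := lowerWeight_mul (lowerWeight_of_isWeightedHomogeneous h1 (Nat.lt_succ_self _)) (hg l)
      rwa [Nat.sub_add_cancel hle] at this

theorem isWeightedHomogeneous_aeval (hf : ∀ l, (f l).IsWeightedHomogeneous w (d l))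
    {p : MvPolynomial τ ℂ} {n : ℕ} (hp : p.IsWeightedHomogeneous d n) :
    (MvPolynomial.aeval f p).IsWeightedHomogeneous w n := by
  rw [MvPolynomial.aeval_def, MvPolynomial.eval₂_eq']
  refine MvPolynomial.IsWeightedHomogeneous.sum _ _ _ fun m hm => ?_
  refine MvPolynomial.IsWeightedHomogeneous.C_mul ?_ _
  have := MvPolynomial.IsWeightedHomogeneous.prod Finset.univ (fun l => f l ^ m l)
    (fun l => m l • d l) fun l _ => (hf l).pow (m l)
  have e : ∑ l, m l • d l = n := by
    rw [← hp (MvPolynomial.mem_support_iff.1 hm), Finsupp.weight_apply,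
      Finsupp.sum_fintype _ _ (by simp)]
  rwa [e] at this

/-- Telescoping u u' − v v' = u (u' − v') + v' (u − v) reduces monomials to single generators, which
change only in lower weight. -/
theorem aeval_sub_aeval_mem (hf : ∀ l, (f l).IsWeightedHomogeneous w (d l))
    (hg : ∀ l, g l - f l ∈ lowerWeight w (d l)) {p : MvPolynomial τ ℂ} {n : ℕ}
    (hp : p ∈ lowerWeight d (n + 1)) :
    MvPolynomial.aeval g p - MvPolynomial.aeval f p ∈ lowerWeight w n := by
  have hmon : ∀ m : τ →₀ ℕ, MvPolynomial.aeval g (MvPolynomial.monomial m (1 : ℂ)) -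
      MvPolynomial.aeval f (MvPolynomial.monomial m (1 : ℂ)) ∈
        lowerWeight w (Finsupp.weight d m) := by
    intro m
    induction m using Finsupp.induction_linear with
    | zero => simp
    | add m m' hm hm' =>
      have e1 : MvPolynomial.monomial (m + m') (1 : ℂ) =
          MvPolynomial.monomial m 1 * MvPolynomial.monomial m' 1 := by
        rw [MvPolynomial.monomial_mul, one_mul]
      have hh : ∀ m, MvPolynomial.aeval f (MvPolynomial.monomial m (1 : ℂ)) ∈
          lowerWeight w (Finsupp.weight d m + 1) := fun m =>
        lowerWeight_of_isWeightedHomogeneous (isWeightedHomogeneous_aeval hf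
          (MvPolynomial.isWeightedHomogeneous_monomial _ _ _ rfl)) (Nat.lt_succ_self _)
      rw [e1, map_mul, map_mul, map_add]
      set u := MvPolynomial.aeval g (MvPolynomial.monomial m (1 : ℂ))
      set u' := MvPolynomial.aeval g (MvPolynomial.monomial m' (1 : ℂ))
      have hu : u ∈ lowerWeight w (Finsupp.weight d m + 1) := by
        have := add_mem (lowerWeight_mono (Nat.le_succ _) hm) (hh m)
        rwa [sub_add_cancel] at this
      have e2 : ∀ v v' : MvPolynomial σ ℂ, u * u' - v * v' = u * (u' - v') + v' * (u - v) := by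
        intros; ring
      rw [e2]
      refine add_mem (lowerWeight_mul hu hm') ?_
      rw [add_comm]
      exact lowerWeight_mul (hh m') hm
    | single l k =>
      induction k with
      | zero => simp
      | succ k ih =>
        have e1 : MvPolynomial.monomial (Finsupp.single l (k + 1)) (1 : ℂ) =
            MvPolynomial.monomial (Finsupp.single l k) 1 * MvPolynomial.X l := by
          rw [MvPolynomial.X, MvPolynomial.monomial_mul, one_mul, Finsupp.single_add]
        have hh : MvPolynomial.aeval f (MvPolynomial.monomial (Finsupp.single l k) (1 : ℂ)) ∈
            lowerWeight w (Finsupp.weight d (Finsupp.single l k) + 1) :=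
          lowerWeight_of_isWeightedHomogeneous (isWeightedHomogeneous_aeval hf
            (MvPolynomial.isWeightedHomogeneous_monomial _ _ _ rfl)) (Nat.lt_succ_self _)
        have e3 : Finsupp.weight d (Finsupp.single l (k + 1)) =
            Finsupp.weight d (Finsupp.single l k) + d l := by
          simp [Finsupp.weight_single]
        rw [e1, map_mul, map_mul, e3, MvPolynomial.aeval_X, MvPolynomial.aeval_X]
        set u := MvPolynomial.aeval g (MvPolynomial.monomial (Finsupp.single l k) (1 : ℂ))
        have hgl : g l ∈ lowerWeight w (d l + 1) := by
          have := add_mem (lowerWeight_mono (Nat.le_succ _) (hg l))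
            (lowerWeight_of_isWeightedHomogeneous (hf l) (Nat.lt_succ_self _))
          rwa [sub_add_cancel] at this
        have e2 : ∀ v, u * g l - v * f l = g l * (u - v) + v * (g l - f l) := by
          intros; ring
        rw [e2]
        refine add_mem ?_ (lowerWeight_mul hh (hg l))
        rw [add_comm]
        exact lowerWeight_mul hgl ih
  rw [p.as_sum, map_sum, map_sum, ← Finset.sum_sub_distrib]
  refine sum_mem fun m hm => ?_
  have e : MvPolynomial.monomial m (p.coeff m) = p.coeff m • MvPolynomial.monomial m (1 : ℂ) := by
    rw [MvPolynomial.smul_monomial, smul_eq_mul, mul_one]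
  rw [e, map_smul, map_smul, ← smul_sub]
  refine Submodule.smul_mem _ _ (lowerWeight_mono ?_ (hmon m))
  exact Nat.lt_succ_iff.1 (hp m (MvPolynomial.mem_support_iff.1 hm))

/-- Independence over the algebra of leading forms implies independence over the deformed
algebra. -/
theorem eq_zero_of_sum_aeval_mul_eq_zero
    (hf : ∀ l, (f l).IsWeightedHomogeneous w (d l)) (hg : ∀ l, g l - f l ∈ lowerWeight w (d l))
    (hbw : ∀ j, (b j).IsWeightedHomogeneous w (e j))
    (hb : ∀ a : κ → MvPolynomial τ ℂ, ∑ j, MvPolynomial.aeval f (a j) * b j = 0 → a = 0)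
    (a : κ → MvPolynomial τ ℂ) (ha : ∑ j, MvPolynomial.aeval g (a j) * b j = 0) : a = 0 := by
  classical
  suffices H : ∀ n, ∀ a : κ → MvPolynomial τ ℂ,
      (∀ j m, (a j).coeff m ≠ 0 → Finsupp.weight d m + e j < n) →
      ∑ j, MvPolynomial.aeval g (a j) * b j = 0 → a = 0 by
    choose n hn using fun j => exists_mem_lowerWeight (w := d) (a j)
    refine H (∑ j, (n j + e j)) a (fun j m hm => ?_) ha
    have h1 := hn j m hm
    have h2 := Finset.single_le_sum (f := fun j => n j + e j) (fun _ _ => Nat.zero_le _)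
      (Finset.mem_univ j)
    omega
  intro n
  induction n with
  | zero =>
    intro a ha _
    ext j m
    by_contra h
    exact absurd (ha j m h) (Nat.not_lt_zero _)
  | succ n ih =>
    intro a ha h0
    -- The part of the relation of top weight `n`; the generator `b j` already carries weight `e j`.
    let t : κ → MvPolynomial τ ℂ := fun j =>
      if e j ≤ n then MvPolynomial.weightedHomogeneousComponent d (n - e j) (a j) else 0
    -- With `f` in place of `g` the top part gives a sum homogeneous of weight `n`. As the whole
    -- relation vanishes, that sum also has weight below `n`, so it is zero and independence over
    -- the leading forms applies.
    have ht : t = 0 := by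
      refine hb t (eq_zero_of_mem_lowerWeight (w := w) (a := n) ?_ ?_)
      · refine MvPolynomial.IsWeightedHomogeneous.sum _ _ _ fun j _ => ?_
        simp only [t]
        split_ifs with h
        · have := (isWeightedHomogeneous_aeval hf
            (MvPolynomial.weightedHomogeneousComponent_isWeightedHomogeneous (w := d)
              (n - e j) (a j))).mul (hbw j)
          rwa [Nat.sub_add_cancel h] at this
        · rw [map_zero, zero_mul]
          exact MvPolynomial.isWeightedHomogeneous_zero _ _ _
      · rw [← neg_mem_iff, ← zero_sub, ← h0, ← Finset.sum_sub_distrib]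
        refine sum_mem fun j _ => ?_
        by_cases h : e j ≤ n
        · simp only [t, if_pos h]
          have hlow : a j ∈ lowerWeight d (n - e j + 1) := by
            intro m hm
            have := ha j m hm
            omega
          have h1 := aeval_sub_aeval_mem hf hg hlow
          have h2 := sub_weightedHomogeneousComponent_mem hlow
          have h3 : MvPolynomial.aeval f (a j - MvPolynomial.weightedHomogeneousComponent d
              (n - e j) (a j)) ∈ lowerWeight w (n - e j) := by
            generalize a j - MvPolynomial.weightedHomogeneousComponent d (n - e j) (a j) = q at h2
            rcases Nat.eq_zero_or_pos (n - e j) with h4 | h4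
            · rw [h4] at h2 ⊢
              have : q = 0 := by
                ext m; by_contra h; exact absurd (h2 m h) (Nat.not_lt_zero _)
              rw [this, map_zero]; exact zero_mem _
            · rw [q.as_sum, map_sum]
              refine sum_mem fun m hm => ?_
              exact lowerWeight_of_isWeightedHomogeneous (isWeightedHomogeneous_aeval hf
                (MvPolynomial.isWeightedHomogeneous_monomial _ _ _ rfl))
                (h2 m (MvPolynomial.mem_support_iff.1 hm))
          rw [← sub_mul]
          have h5 := add_mem h1 h3
          rw [map_sub, sub_add_sub_cancel] at h5
          have := lowerWeight_mul (lowerWeight_of_isWeightedHomogeneous (hbw j)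
            (Nat.lt_succ_self _)) h5
          rw [mul_comm]
          rwa [Nat.add_sub_cancel' h] at this
        · have : a j = 0 := by
            ext m
            by_contra hm
            have := ha j m hm
            omega
          simp only [t, if_neg h, this, map_zero, sub_self]
          exact zero_mem _
    refine ih a (fun j m hm => ?_) h0
    have h1 := ha j m hm
    by_contra h2
    have h3 := congrArg (MvPolynomial.coeff m) (congrFun ht j)
    simp only [t, if_pos (show e j ≤ n by omega), Pi.zero_apply, MvPolynomial.coeff_zero,
      MvPolynomial.coeff_weightedHomogeneousComponent,
      if_pos (show Finsupp.weight d m = n - e j by omega)] at h3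
    exact hm h3

end Deformation

/-! ### The Wronskian algebra as ℂ[c], and bases of its specialisations -/

section Algebra

variable {σ : Type*} {L : ℕ}

/-- The map `ℂ[χ][c] → ℂ[c]` sending `χ_l` to `SW_l(c)`. -/
def wronskianEval (SW : Fin L → MvPolynomial σ ℂ) :
    MvPolynomial σ (MvPolynomial (Fin L) ℂ) →+* MvPolynomial σ ℂ :=
  MvPolynomial.eval₂Hom (MvPolynomial.aeval SW : MvPolynomial (Fin L) ℂ →ₐ[ℂ] _).toRingHom
    MvPolynomial.X

variable (SW : Fin L → MvPolynomial σ ℂ)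

theorem wronskianEval_map (p : MvPolynomial σ ℂ) :
    wronskianEval SW (MvPolynomial.map MvPolynomial.C p) = p := by
  rw [wronskianEval, MvPolynomial.coe_eval₂Hom, MvPolynomial.eval₂_map]
  have : (MvPolynomial.aeval SW : MvPolynomial (Fin L) ℂ →ₐ[ℂ] _).toRingHom.comp
      MvPolynomial.C = (MvPolynomial.C : ℂ →+* MvPolynomial σ ℂ) := by
    ext; simp [MvPolynomial.algebraMap_eq]
  rw [this, MvPolynomial.eval₂_eta]

theorem wronskianEval_C (a : MvPolynomial (Fin L) ℂ) :
    wronskianEval SW (MvPolynomial.C a) = MvPolynomial.aeval SW a := by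
  simp [wronskianEval]

theorem wronskianEval_eq_zero_of_mem {p : MvPolynomial σ (MvPolynomial (Fin L) ℂ)}
    (hp : p ∈ wronskianIdeal SW) : wronskianEval SW p = 0 := by
  have : wronskianIdeal SW ≤ RingHom.ker (wronskianEval SW) := by
    rw [wronskianIdeal, Ideal.span_le]
    rintro _ ⟨l, rfl⟩
    rw [SetLike.mem_coe, RingHom.mem_ker, map_sub, wronskianEval_map, wronskianEval_C,
      MvPolynomial.aeval_X, sub_self]
  exact this hp

/-- Modulo the ideal, `χ_l` may be replaced by `SW l`, so every element is congruent to a polynomial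
in `c` alone. This makes the ideal the whole kernel of `wronskianEval`. -/
theorem sub_map_wronskianEval_mem (p : MvPolynomial σ (MvPolynomial (Fin L) ℂ)) :
    p - MvPolynomial.map MvPolynomial.C (wronskianEval SW p) ∈ wronskianIdeal SW := by
  rw [← Ideal.Quotient.mk_eq_mk_iff_sub_mem]
  suffices H : (Ideal.Quotient.mk (wronskianIdeal SW)) =
      ((Ideal.Quotient.mk (wronskianIdeal SW)).comp (MvPolynomial.map MvPolynomial.C)).comp
        (wronskianEval SW) from DFunLike.congr_fun H p
  refine MvPolynomial.ringHom_ext (fun a => ?_) (fun i => ?_)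
  · have : (Ideal.Quotient.mk (wronskianIdeal SW)).comp MvPolynomial.C =
        ((Ideal.Quotient.mk (wronskianIdeal SW)).comp (MvPolynomial.map MvPolynomial.C)).comp
          (MvPolynomial.aeval SW : MvPolynomial (Fin L) ℂ →ₐ[ℂ] _).toRingHom := by
      refine MvPolynomial.ringHom_ext (fun r => ?_) (fun l => ?_)
      · simp [MvPolynomial.algebraMap_eq]
      · simp only [RingHom.comp_apply, AlgHom.toRingHom_eq_coe, RingHom.coe_coe,
          MvPolynomial.aeval_X]
        rw [Ideal.Quotient.mk_eq_mk_iff_sub_mem]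
        exact Ideal.subset_span ⟨l, rfl⟩
    rw [RingHom.comp_apply, wronskianEval_C]
    exact DFunLike.congr_fun this a
  · simp [wronskianEval]

theorem mem_wronskianIdeal_iff {p : MvPolynomial σ (MvPolynomial (Fin L) ℂ)} :
    p ∈ wronskianIdeal SW ↔ wronskianEval SW p = 0 := by
  refine ⟨wronskianEval_eq_zero_of_mem SW, fun h => ?_⟩
  have := sub_map_wronskianEval_mem SW p
  rwa [h, map_zero, sub_zero] at this

/-- The isomorphism `W ≃ ℂ[c]`. -/
def wronskianEquiv : WronskianAlgebra SW ≃ₐ[ℂ] MvPolynomial σ ℂ :=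
  AlgEquiv.ofRingEquiv
    (f := (Ideal.quotEquivOfEq (by
      ext p; rw [mem_wronskianIdeal_iff, RingHom.mem_ker])).trans
      (RingHom.quotientKerEquivOfSurjective (f := wronskianEval SW)
        (show Function.Surjective _ from fun p => ⟨_, wronskianEval_map SW p⟩)))
    (fun r => by
      have : algebraMap ℂ (WronskianAlgebra SW) r =
        Ideal.Quotient.mk _ (MvPolynomial.C (MvPolynomial.C r)) := rfl
      rw [this]
      change wronskianEval SW (MvPolynomial.C (MvPolynomial.C r)) = _
      rw [wronskianEval_C]
      simp)

theorem wronskianEquiv_mk (p : MvPolynomial σ (MvPolynomial (Fin L) ℂ)) :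
    wronskianEquiv SW (Ideal.Quotient.mk _ p) = wronskianEval SW p := rfl

/-- Turns module statements over ℂ[χ] into identities in ℂ[c] with coefficients `aeval SW a`. -/
theorem wronskianEquiv_smul (a : MvPolynomial (Fin L) ℂ) (x : WronskianAlgebra SW) :
    wronskianEquiv SW (a • x) = MvPolynomial.aeval SW a * wronskianEquiv SW x := by
  obtain ⟨p, rfl⟩ := Ideal.Quotient.mk_surjective x
  have : a • (Ideal.Quotient.mk (wronskianIdeal SW) p) =
      Ideal.Quotient.mk (wronskianIdeal SW) (MvPolynomial.C a * p) := by
    rw [← MvPolynomial.smul_eq_C_mul]; rfl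
  rw [this, wronskianEquiv_mk, wronskianEquiv_mk, map_mul, wronskianEval_C]

variable {κ : Type*} [Fintype κ] {b : κ → MvPolynomial σ ℂ}

theorem finite_wronskianAlgebra
    (hspan : ∀ s, ∃ a : κ → MvPolynomial (Fin L) ℂ, s = ∑ j, MvPolynomial.aeval SW (a j) * b j) :
    Module.Finite (MvPolynomial (Fin L) ℂ) (WronskianAlgebra SW) := by
  classical
  refine Module.Finite.of_surjective (Fintype.linearCombination (MvPolynomial (Fin L) ℂ)
    fun j => (wronskianEquiv SW).symm (b j)) fun x => ?_
  obtain ⟨a, ha⟩ := hspan (wronskianEquiv SW x)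
  refine ⟨a, (wronskianEquiv SW).injective ?_⟩
  rw [ha, Fintype.linearCombination_apply, map_sum]
  simp only [wronskianEquiv_smul, AlgEquiv.apply_symm_apply]

/-- The basis of the Wronskian algebra given by a family of polynomials. -/
def wronskianBasis
    (hspan : ∀ s, ∃ a : κ → MvPolynomial (Fin L) ℂ, s = ∑ j, MvPolynomial.aeval SW (a j) * b j)
    (hind : ∀ a : κ → MvPolynomial (Fin L) ℂ, ∑ j, MvPolynomial.aeval SW (a j) * b j = 0 → a = 0) :
    Module.Basis κ (MvPolynomial (Fin L) ℂ) (WronskianAlgebra SW) :=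
  Module.Basis.mk (v := fun j => (wronskianEquiv SW).symm (b j))
    (by
      rw [Fintype.linearIndependent_iff]
      intro a ha
      refine congrFun (hind a ?_)
      have := congrArg (wronskianEquiv SW) ha
      simpa only [map_sum, wronskianEquiv_smul, AlgEquiv.apply_symm_apply, map_zero] using this)
    (by
      intro x _
      obtain ⟨a, ha⟩ := hspan (wronskianEquiv SW x)
      rw [Submodule.mem_span_range_iff_exists_fun]
      refine ⟨a, (wronskianEquiv SW).injective ?_⟩
      rw [ha, map_sum]
      simp only [wronskianEquiv_smul, AlgEquiv.apply_symm_apply])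

theorem aeval_sub_C_mem (chi : Fin L → ℂ) (a : MvPolynomial (Fin L) ℂ) :
    MvPolynomial.aeval SW a - MvPolynomial.C (MvPolynomial.eval chi a) ∈
      Ideal.span (Set.range fun l => SW l - MvPolynomial.C (chi l)) := by
  have := Ideal.mem_map_of_mem (MvPolynomial.aeval SW : _ →ₐ[ℂ] MvPolynomial σ ℂ)
    (sub_C_eval_mem chi a)
  rw [Ideal.map_span, ← Set.range_comp] at this
  simpa [Function.comp_def, MvPolynomial.algebraMap_eq] using this

/-- The basis of the specialised Wronskian algebra given by a family of polynomials. -/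
def specialisedBasis
    (hspan : ∀ s, ∃ a : κ → MvPolynomial (Fin L) ℂ, s = ∑ j, MvPolynomial.aeval SW (a j) * b j)
    (hind : ∀ a : κ → MvPolynomial (Fin L) ℂ, ∑ j, MvPolynomial.aeval SW (a j) * b j = 0 → a = 0)
    (chi : Fin L → ℂ) : Module.Basis κ ℂ (SpecialisedAlgebra SW chi) :=
  Module.Basis.mk (v := fun j => Ideal.Quotient.mk _ (b j))
    (by
      rw [Fintype.linearIndependent_iff]
      intro c hc
      have h1 : ∑ j, c j • b j ∈
          Ideal.span (Set.range fun l => SW l - MvPolynomial.C (chi l)) := by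
        rw [← Ideal.Quotient.eq_zero_iff_mem, map_sum, ← hc]
        rfl
      obtain ⟨h, hh⟩ := (Submodule.mem_span_range_iff_exists_fun _).1 h1
      -- Expand the cofactors `h l` over the generators. The result is a relation over ℂ[χ] whose
      -- coefficients, evaluated at `chi`, are just the `c j`.
      choose a ha using fun l => hspan (h l)
      have h2 := hind (fun j => MvPolynomial.C (c j) -
        ∑ l, a l j * (MvPolynomial.X l - MvPolynomial.C (chi l))) (by
          simp only [map_sub, map_sum, map_mul, MvPolynomial.aeval_X, MvPolynomial.aeval_C,
            sub_mul, Finset.sum_sub_distrib, MvPolynomial.algebraMap_eq, MvPolynomial.C_mul']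
          rw [sub_eq_zero, ← hh]
          simp only [Finset.sum_mul]
          rw [Finset.sum_comm]
          refine Finset.sum_congr rfl fun l _ => ?_
          rw [smul_eq_mul]
          nth_rw 1 [ha l]
          rw [Finset.sum_mul]
          refine Finset.sum_congr rfl fun j _ => ?_
          ring)
      intro j
      have h3 := congrArg (MvPolynomial.eval chi) (congrFun h2 j)
      simpa [sub_eq_zero] using h3)
    (by
      intro x _
      obtain ⟨s, rfl⟩ := Ideal.Quotient.mk_surjective x
      obtain ⟨a, rfl⟩ := hspan s
      rw [Submodule.mem_span_range_iff_exists_fun]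
      refine ⟨fun j => MvPolynomial.eval chi (a j), ?_⟩
      rw [map_sum]
      refine Finset.sum_congr rfl fun j _ => ?_
      have h1 := (Ideal.Quotient.mk_eq_mk_iff_sub_mem _ _).2 (aeval_sub_C_mem SW chi (a j))
      rw [map_mul, h1, ← map_mul, MvPolynomial.C_mul']
      rfl)

/-- The Wronskian algebra is `ℂ[c]`, free of finite rank over `ℂ[χ]`, and all its specialisations
have dimension equal to this rank. -/
def IsFreeOfConstantRank : Prop :=
    Module.Free (MvPolynomial (Fin L) ℂ) (WronskianAlgebra SW) ∧
      Module.Finite (MvPolynomial (Fin L) ℂ) (WronskianAlgebra SW) ∧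
      (∃ e : WronskianAlgebra SW ≃ₐ[ℂ] MvPolynomial σ ℂ,
        (∀ v, e (Ideal.Quotient.mk _ (MvPolynomial.X v)) = MvPolynomial.X v) ∧
        ∀ l, e (algebraMap (MvPolynomial (Fin L) ℂ) (WronskianAlgebra SW) (MvPolynomial.X l)) =
          SW l) ∧
      ∀ chi : Fin L → ℂ, Module.Finite ℂ (SpecialisedAlgebra SW chi) ∧
        algebraicNumberOfSolutions SW chi =
          Module.finrank (MvPolynomial (Fin L) ℂ) (WronskianAlgebra SW)

theorem isFreeOfConstantRank_of_basis
    (hspan : ∀ s, ∃ a : κ → MvPolynomial (Fin L) ℂ, s = ∑ j, MvPolynomial.aeval SW (a j) * b j)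
    (hind : ∀ a : κ → MvPolynomial (Fin L) ℂ, ∑ j, MvPolynomial.aeval SW (a j) * b j = 0 → a = 0) :
    IsFreeOfConstantRank SW := by
  refine ⟨.of_basis (wronskianBasis SW hspan hind), finite_wronskianAlgebra SW hspan,
    ⟨wronskianEquiv SW, fun v => ?_, fun l => ?_⟩, fun chi => ⟨?_, ?_⟩⟩
  · rw [wronskianEquiv_mk]; simp [wronskianEval]
  · have : algebraMap (MvPolynomial (Fin L) ℂ) (WronskianAlgebra SW) (MvPolynomial.X l) =
      Ideal.Quotient.mk (wronskianIdeal SW) (MvPolynomial.C (MvPolynomial.X l)) := rfl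
    rw [this, wronskianEquiv_mk, wronskianEval_C, MvPolynomial.aeval_X]
  · exact .of_basis (specialisedBasis SW hspan hind chi)
  · rw [algebraicNumberOfSolutions, Module.finrank_eq_card_basis (specialisedBasis SW hspan hind chi),
      Module.finrank_eq_card_basis (wronskianBasis SW hspan hind)]

end Algebra

/-! ### Freeness from leading forms whose only common zero is the origin -/

section Graded

universe u

variable {σ : Type u} [Fintype σ] {L : ℕ} {w : σ → ℕ} {d : Fin L → ℕ} {f : Fin L → MvPolynomial σ ℂ}

/-- By the Nullstellensatz each variable is nilpotent in the quotient, which is therefore an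
integral algebra of finite type. -/
theorem finite_quotient_of_zeros (h0 : ∀ c : σ → ℂ, (∀ l, MvPolynomial.eval c (f l) = 0) → c = 0) :
    Module.Finite ℂ (MvPolynomial σ ℂ ⧸ Ideal.span (Set.range f)) := by
  set I := Ideal.span (Set.range f)
  have hX : ∀ i, ∃ n : ℕ, MvPolynomial.X i ^ n ∈ I := by
    intro i
    change MvPolynomial.X i ∈ I.radical
    rw [← MvPolynomial.vanishingIdeal_zeroLocus_eq_radical (K := ℂ)]
    intro c hc
    rw [MvPolynomial.mem_zeroLocus_iff] at hc
    have := h0 c fun l => hc (f l) (Ideal.subset_span ⟨l, rfl⟩)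
    simp [this]
  have : Algebra.IsIntegral ℂ (MvPolynomial σ ℂ ⧸ I) := by
    refine ⟨fun x => ?_⟩
    obtain ⟨p, rfl⟩ := Ideal.Quotient.mk_surjective x
    induction p using MvPolynomial.induction_on with
    | C a => exact isIntegral_algebraMap
    | add p q hp hq => rw [map_add]; exact hp.add hq
    | mul_X p i hp =>
      rw [map_mul]
      refine hp.mul ?_
      obtain ⟨n, hn⟩ := hX i
      refine ⟨X ^ n, monic_X_pow n, ?_⟩
      rw [eval₂_pow, eval₂_X, ← map_pow]
      exact Ideal.Quotient.eq_zero_iff_mem.2 hn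
  exact Algebra.IsIntegral.finite

/-- Monomials are chosen because they are homogeneous for every weight, as the filtration arguments
require. -/
theorem exists_monomial_basis
    (h0 : ∀ c : σ → ℂ, (∀ l, MvPolynomial.eval c (f l) = 0) → c = 0) :
    ∃ (κ : Type u) (_ : Fintype κ) (u : κ → (σ →₀ ℕ)),
      (∀ s, ∃ c : κ → ℂ, ∃ h : Fin L → MvPolynomial σ ℂ,
        s = ∑ j, c j • MvPolynomial.monomial (u j) 1 + ∑ l, h l * f l) ∧
      ∀ c : κ → ℂ, ∑ j, c j • MvPolynomial.monomial (u j) 1 ∈ Ideal.span (Set.range f) → c = 0 := by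
  have := finite_quotient_of_zeros h0
  let v : (σ →₀ ℕ) → MvPolynomial σ ℂ ⧸ Ideal.span (Set.range f) :=
    fun m => Ideal.Quotient.mk _ (MvPolynomial.monomial m 1)
  obtain ⟨κ, u, -, hspan, hli⟩ := exists_linearIndependent' ℂ v
  have hκ : Finite κ := hli.finite
  have := Fintype.ofFinite κ
  refine ⟨κ, this, u, fun s => ?_, fun c hc => ?_⟩
  · have h1 : Ideal.Quotient.mk (Ideal.span (Set.range f)) s ∈ Submodule.span ℂ (Set.range v) := by
      rw [s.as_sum, map_sum]
      refine sum_mem fun m _ => ?_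
      have e : MvPolynomial.monomial m (s.coeff m) =
          s.coeff m • MvPolynomial.monomial m (1 : ℂ) := by
        rw [MvPolynomial.smul_monomial, smul_eq_mul, mul_one]
      rw [e]
      have hv : Ideal.Quotient.mk (Ideal.span (Set.range f)) (MvPolynomial.monomial m (1 : ℂ)) ∈
          Submodule.span ℂ (Set.range v) := Submodule.subset_span ⟨m, rfl⟩
      exact Submodule.smul_mem _ (s.coeff m) hv
    rw [← hspan] at h1
    obtain ⟨c, hc⟩ := (Submodule.mem_span_range_iff_exists_fun _).1 h1
    have h2 : s - ∑ j, c j • MvPolynomial.monomial (u j) 1 ∈ Ideal.span (Set.range f) := by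
      rw [← Ideal.Quotient.mk_eq_mk_iff_sub_mem, ← hc, map_sum]
      rfl
    obtain ⟨h, hh⟩ := (Submodule.mem_span_range_iff_exists_fun _).1 h2
    refine ⟨c, h, ?_⟩
    simp only [smul_eq_mul] at hh
    rw [hh]; ring
  · rw [Fintype.linearIndependent_iff] at hli
    refine funext (hli c ?_)
    rw [← Ideal.Quotient.eq_zero_iff_mem, map_sum] at hc
    exact hc

/-- Finite generation makes each variable integral, which supplies the monic polynomials needed in
`projective_of_monic`; `hcard` matches equations with variables. -/
theorem projective_of_span (hcard : Fintype.card σ = L) {κ : Type*} [Fintype κ]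
    {b : κ → MvPolynomial σ ℂ}
    (hspan : ∀ s, ∃ a : κ → MvPolynomial (Fin L) ℂ, s = ∑ j, MvPolynomial.aeval f (a j) * b j) :
    Module.Projective (MvPolynomial (Fin L) ℂ) (WronskianAlgebra f) := by
  classical
  have := finite_wronskianAlgebra f hspan
  let ε : σ ≃ Fin L := Fintype.equivFinOfCardEq hcard
  have hint : ∀ i : σ, ∃ p : (MvPolynomial (Fin L) ℂ)[X], p.Monic ∧
      aeval (Ideal.Quotient.mkₐ (MvPolynomial (Fin L) ℂ) (wronskianIdeal f) (MvPolynomial.X i)) p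
        = 0 := fun i => Algebra.IsIntegral.isIntegral (R := MvPolynomial (Fin L) ℂ) _
  choose p hp hp2 using hint
  let F : Fin L → MvPolynomial σ (MvPolynomial (Fin L) ℂ) := fun l =>
    MvPolynomial.C (MvPolynomial.X l) - MvPolynomial.map MvPolynomial.C (f l)
  have hF : Ideal.span (Set.range (F ∘ ε)) = wronskianIdeal f := by
    rw [EquivLike.range_comp]; rfl
  have hmk : Function.Surjective
      (Ideal.Quotient.mkₐ (MvPolynomial (Fin L) ℂ) (wronskianIdeal f)) :=
    fun x => Ideal.Quotient.mk_surjective x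
  refine projective_of_monic (B := WronskianAlgebra f) (R := MvPolynomial (Fin L) ℂ)
    (Ideal.Quotient.mkₐ (MvPolynomial (Fin L) ℂ) (wronskianIdeal f)) hmk (F ∘ ε) (fun q hq => ?_) (fun q hq => ?_) p hp (fun i => ?_)
  · rw [hF] at hq
    exact Ideal.Quotient.eq_zero_iff_mem.2 hq
  · rw [hF]
    exact Ideal.Quotient.eq_zero_iff_mem.1 hq
  · rw [← aeval_algHom_apply, hp2]

/-- The presentation of the algebra by the `b j` splits by projectivity. Its kernel lies in `m`
times the free module, as the `b j` are independent in the fibre over 0, so the splitting gives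
kernel = `m` · kernel. Nakayama's lemma provides an element congruent to 1 modulo `m` killing the
kernel, and a free module over a domain has no torsion. -/
theorem eq_zero_of_graded (hcard : Fintype.card σ = L) {κ : Type*} [Fintype κ]
    {b : κ → MvPolynomial σ ℂ}
    (hspan : ∀ s, ∃ a : κ → MvPolynomial (Fin L) ℂ, s = ∑ j, MvPolynomial.aeval f (a j) * b j)
    (hb : ∀ c : κ → ℂ, ∑ j, c j • b j ∈ Ideal.span (Set.range f) → c = 0)
    (a : κ → MvPolynomial (Fin L) ℂ) (ha : ∑ j, MvPolynomial.aeval f (a j) * b j = 0) : a = 0 := by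
  classical
  have := projective_of_span hcard hspan
  let Φ : (κ → MvPolynomial (Fin L) ℂ) →ₗ[MvPolynomial (Fin L) ℂ] WronskianAlgebra f :=
    Fintype.linearCombination (MvPolynomial (Fin L) ℂ) fun j => (wronskianEquiv f).symm (b j)
  have hΦ : ∀ a, wronskianEquiv f (Φ a) = ∑ j, MvPolynomial.aeval f (a j) * b j := by
    intro a
    rw [Fintype.linearCombination_apply, map_sum]
    simp only [wronskianEquiv_smul, AlgEquiv.apply_symm_apply]
  have hsurj : Function.Surjective Φ := by
    intro x
    obtain ⟨a, ha⟩ := hspan (wronskianEquiv f x)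
    exact ⟨a, (wronskianEquiv f).injective (by rw [hΦ, ha])⟩
  obtain ⟨ψ, hψ⟩ := Module.projective_lifting_property Φ LinearMap.id hsurj
  let m : Ideal (MvPolynomial (Fin L) ℂ) := Ideal.span (Set.range MvPolynomial.X)
  have hm : ∀ q : MvPolynomial (Fin L) ℂ, MvPolynomial.constantCoeff q = 0 → q ∈ m := by
    intro q hq
    have := sub_C_eval_mem (0 : Fin L → ℂ) q
    rw [MvPolynomial.eval_zero, hq] at this
    simpa using this
  -- All coefficients of `x` have zero constant term, so `x = ∑ X_l • v_l`. Subtracting `ψ (Φ x) =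
  -- 0` replaces each `v_l` by `v_l - ψ (Φ v_l)`, which lies in the kernel.
  have hle : LinearMap.ker Φ ≤ m • LinearMap.ker Φ := by
    intro x hx
    have h1 : ∀ j, MvPolynomial.constantCoeff (x j) = 0 := by
      refine congrFun (hb (fun j => MvPolynomial.constantCoeff (x j)) ?_)
      have h2 : ∑ j, MvPolynomial.aeval f (x j) * b j = 0 := by
        rw [← hΦ, LinearMap.mem_ker.1 hx, map_zero]
      have h3 : ∑ j, MvPolynomial.constantCoeff (x j) • b j = - ∑ j, (MvPolynomial.aeval f (x j) -
          MvPolynomial.C (MvPolynomial.constantCoeff (x j))) * b j := by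
        simp only [sub_mul, Finset.sum_sub_distrib, h2, MvPolynomial.C_mul', zero_sub, neg_neg]
      rw [h3]
      refine neg_mem (Ideal.sum_mem _ fun j _ => Ideal.mul_mem_right _ _ ?_)
      have := aeval_sub_C_mem f 0 (x j)
      simpa [MvPolynomial.eval_zero] using this
    choose c hc using fun j => (Submodule.mem_span_range_iff_exists_fun _).1 (hm _ (h1 j))
    have h4 : x = ∑ l, (MvPolynomial.X l : MvPolynomial (Fin L) ℂ) • fun j => c j l := by
      ext1 j
      rw [Finset.sum_apply, ← hc]
      exact Finset.sum_congr rfl fun l _ => mul_comm _ _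
    have h5 : x = x - ψ (Φ x) := by rw [LinearMap.mem_ker.1 hx, map_zero, sub_zero]
    rw [h5]
    nth_rw 1 2 [h4]
    simp only [map_sum, map_smul, ← Finset.sum_sub_distrib, ← smul_sub]
    refine sum_mem fun l _ => Submodule.smul_mem_smul (Ideal.subset_span ⟨l, rfl⟩) ?_
    rw [LinearMap.mem_ker, map_sub, ← LinearMap.comp_apply Φ ψ, hψ, LinearMap.id_apply, sub_self]
  obtain ⟨r, hr, hr2⟩ := Submodule.exists_sub_one_mem_and_smul_eq_zero_of_fg_of_le_smul m _
    (IsNoetherian.noetherian (LinearMap.ker Φ)) hle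
  have hr0 : r ≠ 0 := by
    rintro rfl
    have : m ≤ RingHom.ker (MvPolynomial.constantCoeff (R := ℂ)) := by
      rw [Ideal.span_le]
      rintro _ ⟨l, rfl⟩
      simp [RingHom.mem_ker]
    have := this hr
    simp [RingHom.mem_ker] at this
  have h6 := hr2 a (by
    rw [LinearMap.mem_ker]
    exact (wronskianEquiv f).injective (by rw [hΦ, ha, map_zero]))
  exact (smul_eq_zero.1 h6).resolve_left hr0

/-- Spanning deforms directly. Independence is settled first for the forms `f` themselves, using the
spanning result with zero deformation, and then deformed. -/
theorem isFreeOfConstantRank_of_leading_forms (hcard : Fintype.card σ = L) (hd : ∀ l, 0 < d l)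
    (hf : ∀ l, (f l).IsWeightedHomogeneous w (d l))
    (h0 : ∀ c : σ → ℂ, (∀ l, MvPolynomial.eval c (f l) = 0) → c = 0)
    (SW : Fin L → MvPolynomial σ ℂ) (hSW : ∀ l, SW l - f l ∈ lowerWeight w (d l)) :
    IsFreeOfConstantRank SW := by
  obtain ⟨κ, _, u, hs, hi⟩ := exists_monomial_basis h0
  have hbw : ∀ j, (MvPolynomial.monomial (u j) (1 : ℂ)).IsWeightedHomogeneous w
      (Finsupp.weight w (u j)) :=
    fun j => MvPolynomial.isWeightedHomogeneous_monomial _ _ _ rfl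
  refine isFreeOfConstantRank_of_basis SW (exists_eq_sum_aeval_mul hd hf hSW hbw hs)
    (eq_zero_of_sum_aeval_mul_eq_zero hf hSW hbw
      (eq_zero_of_graded hcard (exists_eq_sum_aeval_mul hd hf (fun l => ?_) hbw hs) hi))
  rw [sub_self]; exact zero_mem _

end Graded

/-! ### Weights of polynomials in c and u -/

section Weights

variable {σ : Type*} (w : σ → ℕ)

/-- The polynomials in `c` and `u` all of whose monomials `c ^ m * u ^ k` have weight in `U`,
where `u` has weight `1`. -/
def weightIn (U : Set ℤ) : Submodule ℂ (MvPolynomial σ ℂ)[X] where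
  carrier := {D | ∀ k m, (D.coeff k).coeff m ≠ 0 → (Finsupp.weight w m : ℤ) + k ∈ U}
  zero_mem' := by intro k m hm; simp at hm
  add_mem' := by
    intro p q hp hq k m hm
    rw [Polynomial.coeff_add, MvPolynomial.coeff_add] at hm
    by_cases h : (p.coeff k).coeff m = 0
    · exact hq k m (by simpa [h] using hm)
    · exact hp k m h
  smul_mem' := by
    intro c p hp k m hm
    rw [Polynomial.coeff_smul, MvPolynomial.coeff_smul] at hm
    exact hp k m fun h => hm (by rw [h, smul_zero])

variable {w}

theorem weightIn_mono {U V : Set ℤ} (h : U ⊆ V) : weightIn w U ≤ weightIn w V :=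
  fun _ hp k m hm => h (hp k m hm)

/-- A general set of weights treats upper bounds and exact weights at once; integer weights allow
bounds such as `N - k` to become negative. -/
theorem weightIn_mul {U V W : Set ℤ} (h : ∀ a ∈ U, ∀ b ∈ V, a + b ∈ W)
    {p q : (MvPolynomial σ ℂ)[X]} (hp : p ∈ weightIn w U) (hq : q ∈ weightIn w V) :
    p * q ∈ weightIn w W := by
  classical
  intro k m hm
  rw [Polynomial.coeff_mul, MvPolynomial.coeff_sum] at hm
  obtain ⟨⟨i, j⟩, hij, hne⟩ := Finset.exists_ne_zero_of_sum_ne_zero hm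
  rw [MvPolynomial.coeff_mul] at hne
  obtain ⟨⟨x, y⟩, hxy, hne⟩ := Finset.exists_ne_zero_of_sum_ne_zero hne
  have e1 : i + j = k := Finset.HasAntidiagonal.mem_antidiagonal.1 hij
  have e2 : x + y = m := Finset.HasAntidiagonal.mem_antidiagonal.1 hxy
  have := h _ (hp i x (left_ne_zero_of_mul hne)) _ (hq j y (right_ne_zero_of_mul hne))
  convert this using 1
  rw [← e1, ← e2, map_add]
  push_cast
  ring

variable (w) in
/-- The polynomials of weight at most `N`. -/
abbrev weightLE (N : ℤ) : Submodule ℂ (MvPolynomial σ ℂ)[X] := weightIn w (Set.Iic N)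

variable (w) in
/-- The homogeneous polynomials of weight `N`. -/
abbrev weightEq (N : ℤ) : Submodule ℂ (MvPolynomial σ ℂ)[X] := weightIn w {N}

theorem weightEq_le_weightLE {M N : ℤ} (h : M ≤ N) : weightEq w M ≤ weightLE w N :=
  weightIn_mono (by simpa using h)

theorem weightLE_mono {M N : ℤ} (h : M ≤ N) : weightLE w M ≤ weightLE w N :=
  weightIn_mono (Set.Iic_subset_Iic.2 h)

theorem weightLE_mul {M N : ℤ} {p q : (MvPolynomial σ ℂ)[X]} (hp : p ∈ weightLE w M)
    (hq : q ∈ weightLE w N) : p * q ∈ weightLE w (M + N) :=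
  weightIn_mul (W := Set.Iic (M + N))
    (fun _ ha _ hb => Set.mem_Iic.2 (add_le_add (Set.mem_Iic.1 ha) (Set.mem_Iic.1 hb))) hp hq

theorem weightEq_mul {M N : ℤ} {p q : (MvPolynomial σ ℂ)[X]} (hp : p ∈ weightEq w M)
    (hq : q ∈ weightEq w N) : p * q ∈ weightEq w (M + N) :=
  weightIn_mul (W := {M + N})
    (fun _ ha _ hb => by rw [Set.mem_singleton_iff.1 ha, Set.mem_singleton_iff.1 hb]; rfl) hp hq

theorem C_mem_weightIn {U : Set ℤ} {p : MvPolynomial σ ℂ}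
    (h : ∀ m, p.coeff m ≠ 0 → (Finsupp.weight w m : ℤ) ∈ U) : C p ∈ weightIn w U := by
  intro k m hm
  rw [coeff_C] at hm
  split_ifs at hm with hk
  · simpa [hk] using h m hm
  · simp at hm

theorem C_coeff_mem_weightLE {N : ℤ} {D : (MvPolynomial σ ℂ)[X]} (hD : D ∈ weightLE w N) (k : ℕ) :
    C (D.coeff k) ∈ weightLE w (N - k) :=
  C_mem_weightIn fun m hm => by
    have := hD k m hm
    rw [Set.mem_Iic] at this ⊢
    omega

theorem C_coeff_mem_weightEq {N : ℤ} {D : (MvPolynomial σ ℂ)[X]} (hD : D ∈ weightEq w N) (k : ℕ) :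
    C (D.coeff k) ∈ weightEq w (N - k) :=
  C_mem_weightIn fun m hm => by
    have := hD k m hm
    rw [Set.mem_singleton_iff] at this ⊢
    omega

theorem C_C_mem_weightEq (a : ℂ) : C (MvPolynomial.C a) ∈ weightEq w 0 := by
  classical
  refine C_mem_weightIn fun m hm => ?_
  rw [MvPolynomial.coeff_C] at hm
  split_ifs at hm with h
  · simp [← h]
  · exact absurd rfl hm

theorem C_X_mem_weightEq (v : σ) : C (MvPolynomial.X v) ∈ weightEq w (w v) := by
  classical
  refine C_mem_weightIn fun m hm => ?_
  rw [MvPolynomial.coeff_X] at hm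
  split_ifs at hm with h
  · simp [← h, Finsupp.weight_single]
  · exact absurd rfl hm

theorem X_pow_mem_weightEq (n : ℕ) : (X ^ n : (MvPolynomial σ ℂ)[X]) ∈ weightEq w n := by
  classical
  intro k m hm
  rw [coeff_X_pow] at hm
  split_ifs at hm with h
  · rw [MvPolynomial.coeff_one] at hm
    split_ifs at hm with h2
    · simp [← h2, h]
    · exact absurd rfl hm
  · simp at hm

theorem linearMap_eq_sum (A : (MvPolynomial σ ℂ)[X] →ₗ[MvPolynomial σ ℂ] (MvPolynomial σ ℂ)[X])
    (D : (MvPolynomial σ ℂ)[X]) : A D = ∑ k ∈ D.support, C (D.coeff k) * A (X ^ k) := by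
  conv_lhs => rw [D.as_sum_support_C_mul_X_pow]
  rw [map_sum]
  refine Finset.sum_congr rfl fun k _ => ?_
  rw [← smul_eq_C_mul, map_smul, smul_eq_C_mul]

/-- Linearity over ℂ[c] reduces the weight of an operator to its action on powers of `X`. -/
theorem linearMap_mem_weightLE
    {A : (MvPolynomial σ ℂ)[X] →ₗ[MvPolynomial σ ℂ] (MvPolynomial σ ℂ)[X]} {δ : ℤ}
    (hA : ∀ k : ℕ, A (X ^ k) ∈ weightLE w (k + δ)) {N : ℤ} {D : (MvPolynomial σ ℂ)[X]}
    (hD : D ∈ weightLE w N) : A D ∈ weightLE w (N + δ) := by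
  rw [linearMap_eq_sum]
  refine sum_mem fun k _ => ?_
  have := weightLE_mul (C_coeff_mem_weightLE hD k) (hA k)
  rwa [show N - (k : ℤ) + (k + δ) = N + δ by ring] at this

theorem linearMap_mem_weightEq
    {A : (MvPolynomial σ ℂ)[X] →ₗ[MvPolynomial σ ℂ] (MvPolynomial σ ℂ)[X]} {δ : ℤ}
    (hA : ∀ k : ℕ, A (X ^ k) ∈ weightEq w (k + δ)) {N : ℤ} {D : (MvPolynomial σ ℂ)[X]}
    (hD : D ∈ weightEq w N) : A D ∈ weightEq w (N + δ) := by
  rw [linearMap_eq_sum]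
  refine sum_mem fun k _ => ?_
  have := weightEq_mul (C_coeff_mem_weightEq hD k) (hA k)
  rwa [show N - (k : ℤ) + (k + δ) = N + δ by ring] at this

theorem prod_sub_prod_mem {ι : Type*} (s : Finset ι) {E T : ι → (MvPolynomial σ ℂ)[X]} {r : ι → ℤ}
    (hT : ∀ i, T i ∈ weightEq w (r i)) (hE : ∀ i, E i - T i ∈ weightLE w (r i - 1)) :
    ∏ i ∈ s, T i ∈ weightEq w (∑ i ∈ s, r i) ∧
      ∏ i ∈ s, E i - ∏ i ∈ s, T i ∈ weightLE w (∑ i ∈ s, r i - 1) := by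
  classical
  induction s using Finset.induction_on with
  | empty => simpa using X_pow_mem_weightEq (w := w) 0
  | insert i s hi ih =>
    simp only [Finset.prod_insert hi, Finset.sum_insert hi]
    refine ⟨weightEq_mul (hT i) ih.1, ?_⟩
    have e : E i * ∏ j ∈ s, E j - T i * ∏ j ∈ s, T j = E i * (∏ j ∈ s, E j - ∏ j ∈ s, T j) +
        (E i - T i) * ∏ j ∈ s, T j := by ring
    have hEi : E i ∈ weightLE w (r i) := by
      have := add_mem (weightLE_mono (by omega) (hE i)) (weightEq_le_weightLE le_rfl (hT i))
      rwa [sub_add_cancel] at this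
    rw [e]
    refine add_mem ?_ ?_
    · have := weightLE_mul hEi ih.2
      rwa [← add_sub_assoc] at this
    · have := weightLE_mul (hE i) (weightEq_le_weightLE le_rfl ih.1)
      rwa [sub_add_eq_add_sub] at this

/-- Because entry weights have the form `r i + s j`, all terms of the permutation expansion have the
same weight. Hence the determinant of the leading parts is the leading part of the determinant. -/
theorem det_sub_det_mem {ι : Type*} [Fintype ι] [DecidableEq ι]
    {E T : Matrix ι ι (MvPolynomial σ ℂ)[X]} {r s : ι → ℤ}
    (hT : ∀ i j, T i j ∈ weightEq w (r i + s j))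
    (hE : ∀ i j, E i j - T i j ∈ weightLE w (r i + s j - 1)) :
    T.det ∈ weightEq w (∑ i, r i + ∑ i, s i) ∧
      E.det - T.det ∈ weightLE w (∑ i, r i + ∑ i, s i - 1) := by
  have e : ∀ g : Equiv.Perm ι, ∑ i, (r (g i) + s i) = ∑ i, r i + ∑ i, s i := by
    intro g
    rw [Finset.sum_add_distrib, Equiv.sum_comp g r]
  have hsign : ∀ (g : Equiv.Perm ι) (U : Set ℤ) (p : (MvPolynomial σ ℂ)[X]),
      p ∈ weightIn w U → Equiv.Perm.sign g • p ∈ weightIn w U := by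
    intro g U p hp
    rcases Int.units_eq_one_or (Equiv.Perm.sign g) with h | h <;> rw [h]
    · rwa [one_smul]
    · rw [Units.neg_smul, one_smul]; exact neg_mem hp
  have key := fun g : Equiv.Perm ι => prod_sub_prod_mem (w := w) Finset.univ
    (E := fun i => E (g i) i) (T := fun i => T (g i) i) (r := fun i => r (g i) + s i)
    (fun i => hT _ _) (fun i => hE _ _)
  rw [Matrix.det_apply, Matrix.det_apply, ← Finset.sum_sub_distrib]
  refine ⟨sum_mem fun g _ => ?_, sum_mem fun g _ => ?_⟩
  · rw [← e g]
    exact hsign _ _ _ (key g).1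
  · have h := hsign g _ _ (key g).2
    rw [e g, smul_sub] at h
    exact h

end Weights

/-! ### Reduction to the zero fibre of the leading part T(u) -/

section Reduction

variable {σ : Type*} [Fintype σ] {w : σ → ℕ} {L : ℕ}

theorem signedCoeffs_mem (S : (MvPolynomial σ ℂ)[X]) (l : Fin L) (n : ℕ) (U : Set ℤ)
    (hU : ∀ a : ℕ, (a : ℤ) + (L - (l + 1)) ∈ U → a < n) (hS : S ∈ weightIn w U) :
    signedCoeffs L S l ∈ lowerWeight w n := by
  have h1 : S.coeff (L - ((l : ℕ) + 1)) ∈ lowerWeight w n := by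
    intro m hm
    refine hU _ ?_
    have := hS _ m hm
    rwa [Nat.cast_sub l.2, Nat.cast_succ] at this
  rw [signedCoeffs]
  rcases neg_one_pow_eq_or (MvPolynomial σ ℂ) ((l : ℕ) + 1) with h | h <;> rw [h]
  · rwa [one_mul]
  · rw [neg_one_mul]; exact neg_mem h1

/-- The coefficient of u^(L−ℓ) in `T` is homogeneous of weight ℓ and, after normalisation, is the
leading form of SW_ℓ up to sign. Its common zeros with the others are the `c` at which `T` is a
multiple of u^L. -/
theorem isFreeOfConstantRank_of_leading_part (hw : ∀ v, 0 < w v) (hcard : Fintype.card σ = L)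
    {D T : (MvPolynomial σ ℂ)[X]} (hT : T ∈ weightEq w L) (hD : D - T ∈ weightLE w (L - 1))
    (h0 : MvPolynomial.constantCoeff (T.coeff L) ≠ 0)
    (hz : ∀ c : σ → ℂ, T.map (MvPolynomial.eval c) =
      C (MvPolynomial.constantCoeff (T.coeff L)) * X ^ L → c = 0) :
    IsFreeOfConstantRank (signedCoeffs L (normalise L D)) := by
  classical
  set a := MvPolynomial.constantCoeff (T.coeff L) with ha
  -- In `D - T` the coefficient of u^L would have negative weight, so it vanishes and both
  -- polynomials are normalised by the same scalar.
  have haD : MvPolynomial.constantCoeff (D.coeff L) = a := by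
    rw [ha, ← sub_eq_zero, ← map_sub, ← coeff_sub, MvPolynomial.constantCoeff_eq]
    by_contra h
    have := hD L 0 h
    simp at this
  have hTn : normalise L T ∈ weightEq w L := by
    have := weightEq_mul (C_C_mem_weightEq (w := w) a⁻¹) hT
    rwa [zero_add] at this
  have hDn : normalise L D - normalise L T ∈ weightLE w (L - 1) := by
    have := weightLE_mul (weightEq_le_weightLE le_rfl (C_C_mem_weightEq (w := w) a⁻¹)) hD
    rw [zero_add] at this
    rw [normalise, normalise, haD, ← ha, ← mul_sub]
    exact this
  have hwt : ∀ m : σ →₀ ℕ, Finsupp.weight w m = 0 → m = 0 := by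
    intro m hm
    rw [Finsupp.weight_apply, Finsupp.sum_fintype _ _ (by simp)] at hm
    ext v
    have := Finset.sum_eq_zero_iff.1 hm v (Finset.mem_univ v)
    simpa [(hw v).ne'] using this
  refine isFreeOfConstantRank_of_leading_forms (f := signedCoeffs L (normalise L T))
    (d := fun l => l + 1) (w := w) hcard (fun l => Nat.succ_pos _) (fun l => ?_) (fun c hc => ?_)
    _ (fun l => ?_)
  · have h1 : ((normalise L T).coeff (L - ((l : ℕ) + 1))).IsWeightedHomogeneous w (l + 1) := by
      intro m hm
      have := hTn _ m hm
      rw [Set.mem_singleton_iff, Nat.cast_sub l.2] at this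
      push_cast at this
      omega
    rw [signedCoeffs]
    rcases neg_one_pow_eq_or (MvPolynomial σ ℂ) ((l : ℕ) + 1) with h | h <;> rw [h]
    · rwa [one_mul]
    · rw [neg_one_mul]; exact h1.neg
  · refine hz c ?_
    have h1 : ∀ k < L, MvPolynomial.eval c (T.coeff k) = 0 := by
      intro k hk
      have := hc ⟨L - (k + 1), by omega⟩
      rw [signedCoeffs, map_mul] at this
      have h2 := (mul_eq_zero.1 this).resolve_left (by
        rw [map_pow, map_neg, map_one]; exact pow_ne_zero _ (neg_ne_zero.2 one_ne_zero))
      have h3 : L - (L - (k + 1) + 1) = k := by omega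
      simp only [h3] at h2
      rw [normalise, coeff_C_mul, map_mul, MvPolynomial.eval_C, ← ha] at h2
      exact (mul_eq_zero.1 h2).resolve_left (inv_ne_zero h0)
    ext k
    rw [coeff_map, coeff_C_mul, coeff_X_pow]
    rcases lt_trichotomy k L with hk | rfl | hk
    · rw [h1 k hk, if_neg hk.ne, mul_zero]
    · rw [if_pos rfl, mul_one]
      have : T.coeff k = MvPolynomial.C a := by
        ext m
        rw [MvPolynomial.coeff_C]
        split_ifs with hm
        · rw [← hm, ha, MvPolynomial.constantCoeff_eq]
        · by_contra h
          have := hT k m h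
          rw [Set.mem_singleton_iff] at this
          exact hm (hwt m (by omega)).symm
      rw [this, MvPolynomial.eval_C]
    · rw [if_neg hk.ne', mul_zero]
      have : T.coeff k = 0 := by
        ext m
        by_contra h
        have := hT k m h
        rw [Set.mem_singleton_iff] at this
        omega
      rw [this, map_zero]
  · have h1 : signedCoeffs L (normalise L D) l - signedCoeffs L (normalise L T) l =
        signedCoeffs L (normalise L D - normalise L T) l := by
      rw [signedCoeffs, signedCoeffs, signedCoeffs, coeff_sub, mul_sub]
    rw [h1]
    refine signedCoeffs_mem _ l _ _ (fun b hb => ?_) hDn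
    rw [Set.mem_Iic] at hb
    omega

end Reduction

/-! ### Leading terms of shifts and of solutions of the difference equation -/

section Operators

variable {σ : Type*} {w : σ → ℕ}

theorem X_add_C_mem_weightLE (h : ℂ) :
    (X + C (algebraMap ℂ (MvPolynomial σ ℂ) h)) ∈ weightLE w 1 := by
  refine add_mem (weightEq_le_weightLE le_rfl ?_) (weightEq_le_weightLE zero_le_one
    (C_C_mem_weightEq h))
  simpa using X_pow_mem_weightEq (w := w) 1

theorem X_pow_mem_weightLE (k : ℕ) : (X ^ k : (MvPolynomial σ ℂ)[X]) ∈ weightLE w k :=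
  weightEq_le_weightLE le_rfl (X_pow_mem_weightEq k)

theorem taylor_X_pow_sub_mem_weightLE (h : ℂ) (k : ℕ) :
    taylor (algebraMap ℂ (MvPolynomial σ ℂ) h) (X ^ k) - X ^ k ∈ weightLE w (k - 1) := by
  rw [taylor_X_pow]
  induction k with
  | zero => simp
  | succ k ih =>
    set r := algebraMap ℂ (MvPolynomial σ ℂ) h with hr
    have e : (X + C r) ^ (k + 1) - X ^ (k + 1) = (X + C r) * ((X + C r) ^ k - X ^ k) +
        C r * X ^ k := by ring
    rw [e]
    refine add_mem ?_ ?_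
    · have := weightLE_mul (X_add_C_mem_weightLE h) ih
      convert this using 2
      push_cast; ring
    · have := weightLE_mul (weightEq_le_weightLE le_rfl (C_C_mem_weightEq h))
        (X_pow_mem_weightLE (w := w) k)
      rw [zero_add] at this
      rwa [Nat.cast_succ, add_sub_cancel_right]

theorem taylor_X_pow_succ_sub_mem_weightLE (h : ℂ) (k : ℕ) :
    taylor (algebraMap ℂ (MvPolynomial σ ℂ) h) (X ^ (k + 1)) - X ^ (k + 1) -
      (((k : ℂ) + 1) * h) • X ^ k ∈ weightLE w (k - 1) := by
  rw [taylor_X_pow]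
  set r := algebraMap ℂ (MvPolynomial σ ℂ) h with hr
  have hs : ∀ (a : ℂ) (p : (MvPolynomial σ ℂ)[X]),
      a • p = C (algebraMap ℂ (MvPolynomial σ ℂ) a) * p := by
    intro a p
    rw [← smul_eq_C_mul, algebraMap_smul]
  induction k with
  | zero => simp [hs, hr]
  | succ k ih =>
    have e : (X + C r) ^ (k + 1 + 1) - X ^ (k + 1 + 1) -
        ((((k + 1 : ℕ) : ℂ) + 1) * h) • X ^ (k + 1) = (X + C r) *
          ((X + C r) ^ (k + 1) - X ^ (k + 1) - (((k : ℂ) + 1) * h) • X ^ k) +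
          (((k : ℂ) + 1) * h * h) • X ^ k := by
      simp only [hs, hr]
      push_cast
      simp only [map_mul, map_add, map_one, map_natCast]
      ring
    rw [e, Nat.cast_succ, add_sub_cancel_right]
    refine add_mem ?_ (Submodule.smul_mem _ _ (X_pow_mem_weightLE k))
    have := weightLE_mul (X_add_C_mem_weightLE h) ih
    rwa [add_sub_cancel] at this

/-- Since `ħ` has weight 0, a Taylor shift changes a polynomial only in lower weight; the
exponential prefactor alone remains. -/
theorem qshift_sub_mem (ħ κ : ℂ) (k : ℤ) {N : ℤ} {D : (MvPolynomial σ ℂ)[X]}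
    (hD : D ∈ weightLE w N) :
    qshift ħ κ k D - Complex.exp (κ * k / 2) • D ∈ weightLE w (N - 1) := by
  have h1 : taylor (algebraMap ℂ (MvPolynomial σ ℂ) (ħ * k / 2)) D - D ∈ weightLE w (N - 1) :=
    linearMap_mem_weightLE (A := taylor (algebraMap ℂ (MvPolynomial σ ℂ) (ħ * k / 2)) -
      LinearMap.id) (δ := -1) (fun k => taylor_X_pow_sub_mem_weightLE _ k) hD
  have h2 := Submodule.smul_mem _ (Complex.exp (κ * k / 2)) h1
  rw [smul_sub] at h2
  rwa [qshift, LinearMap.smul_apply, algebraMap_smul]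

/-- Every application of `1 - A` lowers the weight, so only the zeroth term of the series reaches
weight `N`. -/
theorem neumannInv_sub_mem
    {A : (MvPolynomial σ ℂ)[X] →ₗ[MvPolynomial σ ℂ] (MvPolynomial σ ℂ)[X]}
    (hA : ∀ k : ℕ, X ^ k - A (X ^ k) ∈ weightLE w (k - 1)) {N : ℤ} {g : (MvPolynomial σ ℂ)[X]}
    (hg : g ∈ weightLE w N) : neumannInv A g - g ∈ weightLE w (N - 1) := by
  have h1 : ∀ k : ℕ, ((1 - A) ^ k) g ∈ weightLE w (N - k) := by
    intro k
    induction k with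
    | zero => simpa using hg
    | succ k ih =>
      rw [pow_succ']
      have := linearMap_mem_weightLE (A := 1 - A) (δ := -1) hA ih
      rw [show N - (k : ℤ) + -1 = N - (k + 1 : ℕ) by push_cast; ring] at this
      exact this
  rw [neumannInv, Finset.sum_range_succ']
  simp only [pow_zero, Module.End.one_apply, add_sub_cancel_right]
  refine sum_mem fun k _ => weightLE_mono ?_ (h1 (k + 1))
  push_cast; omega

/-- To leading order `qdiff` is multiplication by `exp (κ / 2) - exp (-κ / 2)`. -/
theorem twistedSolution_sub_mem (ħ κ : ℂ) (hκ : Complex.exp (κ / 2) - Complex.exp (-κ / 2) ≠ 0)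
    {N : ℤ} {g : (MvPolynomial σ ℂ)[X]} (hg : g ∈ weightLE w N) :
    twistedSolution ħ κ g - (Complex.exp (κ / 2) - Complex.exp (-κ / 2))⁻¹ • g ∈
      weightLE w (N - 1) := by
  set t := Complex.exp (κ / 2) - Complex.exp (-κ / 2) with ht
  suffices H : ∀ k : ℕ, X ^ k - (algebraMap ℂ (MvPolynomial σ ℂ) t⁻¹ • qdiff ħ κ) (X ^ k) ∈
      weightLE w (k - 1) by
    have := (weightLE w (N - 1)).smul_mem t⁻¹ (neumannInv_sub_mem H hg)
    rwa [smul_sub, ← algebraMap_smul (MvPolynomial σ ℂ) t⁻¹ (neumannInv _ g)] at this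
  intro k
  rw [LinearMap.smul_apply, algebraMap_smul]
  have h1 := qshift_sub_mem ħ κ 1 (X_pow_mem_weightLE (w := w) k)
  have h2 := qshift_sub_mem ħ κ (-1) (X_pow_mem_weightLE (w := w) k)
  have h3 : (X ^ k : (MvPolynomial σ ℂ)[X]) - t⁻¹ • qdiff ħ κ (X ^ k) =
      t⁻¹ • ((qshift ħ κ (-1) (X ^ k) - Complex.exp (κ * (-1 : ℤ) / 2) • X ^ k) -
        (qshift ħ κ 1 (X ^ k) - Complex.exp (κ * (1 : ℤ) / 2) • X ^ k)) := by
    have h4 : (X ^ k : (MvPolynomial σ ℂ)[X]) = t⁻¹ • (Complex.exp (κ * (1 : ℤ) / 2) • X ^ k -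
        Complex.exp (κ * (-1 : ℤ) / 2) • X ^ k) := by
      rw [← sub_smul, smul_smul]
      have : Complex.exp (κ * (1 : ℤ) / 2) - Complex.exp (κ * (-1 : ℤ) / 2) = t := by
        rw [ht]; push_cast; ring_nf
      rw [this, inv_mul_cancel₀ hκ, one_smul]
    nth_rw 1 [h4]
    rw [qdiff, LinearMap.sub_apply]
    module
  rw [h3]
  exact Submodule.smul_mem _ _ (sub_mem h2 h1)

theorem antideriv_X_pow (k : ℕ) :
    antideriv (X ^ k : (MvPolynomial σ ℂ)[X]) = ((k : ℂ) + 1)⁻¹ • X ^ (k + 1) := by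
  rw [antideriv, lsum_apply, X_pow_eq_monomial, sum_monomial_index _ _ (by simp)]
  simp only [LinearMap.smul_apply, algebraMap_smul, X_pow_eq_monomial]

theorem antideriv_mem_weightEq {N : ℤ} {g : (MvPolynomial σ ℂ)[X]} (hg : g ∈ weightEq w N) :
    antideriv g ∈ weightEq w (N + 1) := by
  refine linearMap_mem_weightEq (A := antideriv) (δ := 1) (fun k => ?_) hg
  rw [antideriv_X_pow]
  exact Submodule.smul_mem _ _ (X_pow_mem_weightEq (k + 1))

theorem antideriv_mem_weightLE {N : ℤ} {g : (MvPolynomial σ ℂ)[X]} (hg : g ∈ weightLE w N) :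
    antideriv g ∈ weightLE w (N + 1) := by
  refine linearMap_mem_weightLE (A := antideriv) (δ := 1) (fun k => ?_) hg
  rw [antideriv_X_pow]
  exact Submodule.smul_mem _ _ (X_pow_mem_weightLE (k + 1))

/-- For κ = 0 the scalar terms cancel and the leading term of `qdiff` is `ħ` d/du. Its inverse
raises the weight by one, so the error bound is `N` while the leading term has weight `N + 1`. -/
theorem twistlessSolution_sub_mem (ħ : ℂ) (hħ : ħ ≠ 0) {N : ℤ} {g : (MvPolynomial σ ℂ)[X]}
    (hg : g ∈ weightLE w N) : twistlessSolution ħ g - ħ⁻¹ • antideriv g ∈ weightLE w N := by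
  suffices H : ∀ k : ℕ, X ^ k - (algebraMap ℂ (MvPolynomial σ ℂ) ħ⁻¹ • (qdiff ħ 0 ∘ₗ antideriv))
      (X ^ k) ∈ weightLE w (k - 1) by
    have h1 := antideriv_mem_weightLE (neumannInv_sub_mem H hg)
    rw [sub_add_cancel, map_sub] at h1
    have h2 := (weightLE w N).smul_mem ħ⁻¹ h1
    rwa [smul_sub, ← algebraMap_smul (MvPolynomial σ ℂ) ħ⁻¹ (antideriv (neumannInv _ g))] at h2
  intro k
  have hk : (k : ℂ) + 1 ≠ 0 := by exact_mod_cast Nat.succ_ne_zero k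
  have h1 := taylor_X_pow_succ_sub_mem_weightLE (w := w) (ħ / 2) k
  have h2 := taylor_X_pow_succ_sub_mem_weightLE (w := w) (-(ħ / 2)) k
  rw [LinearMap.smul_apply, algebraMap_smul, LinearMap.comp_apply, antideriv_X_pow]
  have h3 : ∀ c : ℂ, qdiff ħ 0 (c • X ^ (k + 1) : (MvPolynomial σ ℂ)[X]) = c •
      (taylor (algebraMap ℂ (MvPolynomial σ ℂ) (ħ / 2)) (X ^ (k + 1)) -
        taylor (algebraMap ℂ (MvPolynomial σ ℂ) (-(ħ / 2))) (X ^ (k + 1))) := by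
    intro c
    rw [← algebraMap_smul (MvPolynomial σ ℂ) c, map_smul, algebraMap_smul]
    simp only [qdiff, qshift, LinearMap.sub_apply, zero_div, neg_zero,
      Complex.exp_zero, map_one, one_smul, Int.cast_one, mul_one, Int.cast_neg, mul_neg, neg_div]
  rw [h3]
  have h4 : (X ^ k : (MvPolynomial σ ℂ)[X]) - ħ⁻¹ • ((k : ℂ) + 1)⁻¹ •
      (taylor (algebraMap ℂ (MvPolynomial σ ℂ) (ħ / 2)) (X ^ (k + 1)) -
        taylor (algebraMap ℂ (MvPolynomial σ ℂ) (-(ħ / 2))) (X ^ (k + 1))) =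
      (ħ⁻¹ * ((k : ℂ) + 1)⁻¹) •
        ((taylor (algebraMap ℂ (MvPolynomial σ ℂ) (-(ħ / 2))) (X ^ (k + 1)) - X ^ (k + 1) -
          (((k : ℂ) + 1) * (-(ħ / 2))) • X ^ k) -
        (taylor (algebraMap ℂ (MvPolynomial σ ℂ) (ħ / 2)) (X ^ (k + 1)) - X ^ (k + 1) -
          (((k : ℂ) + 1) * (ħ / 2)) • X ^ k)) := by
    have h5 : (X ^ k : (MvPolynomial σ ℂ)[X]) = (ħ⁻¹ * ((k : ℂ) + 1)⁻¹) •
        ((((k : ℂ) + 1) * (ħ / 2)) • X ^ k - (((k : ℂ) + 1) * (-(ħ / 2))) • X ^ k) := by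
      rw [← sub_smul, smul_smul]
      have : ħ⁻¹ * ((k : ℂ) + 1)⁻¹ * (((k : ℂ) + 1) * (ħ / 2) - ((k : ℂ) + 1) * (-(ħ / 2))) = 1 := by
        field_simp; ring
      rw [this, one_smul]
    nth_rw 1 [h5]
    module
  rw [h4]
  exact Submodule.smul_mem _ _ (sub_mem h2 h1)

end Operators

/-! ### Cauchy–Vandermonde systems -/

section CauchyVandermonde

/-- Clear denominators: the numerator has degree below `card α + K` and vanishes at all `x a`, so it
is zero. Its values at the poles `y j` give `v = 0`, and then `P = 0`. -/
theorem cauchyVandermonde_injective {ι α : Type*} [Fintype ι] [Fintype α] {K : ℕ}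
    {x : ι → ℂ} {y : α → ℂ} (hx : Function.Injective x) (hy : Function.Injective y)
    (hxy : ∀ a j, x a ≠ y j) (hcard : Fintype.card α + K ≤ Fintype.card ι) (v : α → ℂ) (P : ℂ[X])
    (hP : P.degree < K) (h : ∀ a, ∑ j, v j / (x a - y j) + P.eval (x a) = 0) : v = 0 ∧ P = 0 := by
  classical
  set Q : ℂ[X] := ∑ j, C (v j) * ∏ i ∈ Finset.univ.erase j, (X - C (y i)) +
    P * ∏ i, (X - C (y i)) with hQ
  have hQ0 : Q = 0 := by
    refine Polynomial.eq_zero_of_degree_lt_of_eval_index_eq_zero Finset.univ (v := x)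
      hx.injOn ?_ fun a _ => ?_
    · rw [Finset.card_univ]
      rcases isEmpty_or_nonempty α with hα | hα
      · simp only [hQ, Finset.univ_eq_empty, Finset.sum_empty, Finset.prod_empty, zero_add, mul_one]
        refine hP.trans_le ?_
        exact_mod_cast (Nat.le_add_left _ _).trans hcard
      refine lt_of_lt_of_le (b := ((Fintype.card α + K : ℕ) : WithBot ℕ)) ?_ (by exact_mod_cast hcard)
      refine lt_of_le_of_lt (degree_add_le _ _) (max_lt ?_ ?_)
      · refine lt_of_le_of_lt (degree_sum_le _ _) ((Finset.sup_lt_iff ?_).2 fun j _ => ?_)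
        · exact WithBot.bot_lt_coe _
        · rw [← smul_eq_C_mul]
          refine lt_of_le_of_lt (degree_smul_le _ _) ?_
          rw [degree_prod]
          simp only [degree_X_sub_C, Finset.sum_const, Finset.card_erase_of_mem (Finset.mem_univ j),
            Finset.card_univ, nsmul_eq_mul, mul_one]
          have : 0 < Fintype.card α := Fintype.card_pos
          exact_mod_cast (by omega : Fintype.card α - 1 < Fintype.card α + K)
      · rw [degree_mul, degree_prod]
        simp only [degree_X_sub_C, Finset.sum_const, Finset.card_univ, nsmul_eq_mul, mul_one]
        rw [Nat.cast_add, add_comm (Fintype.card α : WithBot ℕ)]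
        exact WithBot.add_lt_add_right (by simp) hP
    · have h1 : Q.eval (x a) = (∑ j, v j / (x a - y j) + P.eval (x a)) * ∏ i, (x a - y i) := by
        rw [hQ, eval_add, eval_mul, eval_finsetSum, add_mul, Finset.sum_mul]
        congr 1
        · refine Finset.sum_congr rfl fun j _ => ?_
          rw [eval_mul, eval_C, eval_prod, ← Finset.mul_prod_erase _ _ (Finset.mem_univ j)]
          have := sub_ne_zero.2 (hxy a j)
          simp only [eval_sub, eval_X, eval_C]
          field_simp
        · rw [eval_prod]; simp
      rw [h1, h a, zero_mul]
  have hv : v = 0 := by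
    ext j
    have h1 := congrArg (eval (y j)) hQ0
    rw [hQ, eval_add, eval_mul, eval_finsetSum, eval_zero, eval_prod,
      Finset.prod_eq_zero (Finset.mem_univ j) (by simp), mul_zero, add_zero,
      Finset.sum_eq_single j] at h1
    · rw [eval_mul, eval_C, eval_prod] at h1
      refine (mul_eq_zero.1 h1).resolve_right (Finset.prod_ne_zero_iff.2 fun i hi => ?_)
      rw [eval_sub, eval_X, eval_C]
      exact sub_ne_zero.2 fun e => Finset.ne_of_mem_erase hi (hy e).symm
    · intro i _ hi
      rw [eval_mul, eval_prod, Finset.prod_eq_zero (Finset.mem_erase.2 ⟨hi.symm, Finset.mem_univ j⟩)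
        (by simp), mul_zero]
    · simp
  refine ⟨hv, ?_⟩
  simp only [hv, Pi.zero_apply, C_0, zero_mul, Finset.sum_const_zero, zero_add] at hQ
  rw [hQ] at hQ0
  exact (mul_eq_zero.1 hQ0).resolve_right (monic_prod_of_monic _ _ fun i _ => monic_X_sub_C _).ne_zero

end CauchyVandermonde

/-! ### The twisted case -/

section Twisted

/-- The matrix of leading constants of the supersymmetric Wronskian in the twisted case. -/
def twistedConst {n K : ℕ} (κ : Fin (n + K) → ℂ) (ρ : Fin n → ℂ) :
    Matrix (Fin (n + K)) (Fin (n + K)) ℂ :=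
  Matrix.of fun a => Fin.addCases
    (fun i => Complex.exp ((κ a + ρ i) * K / 2) *
      (Complex.exp ((κ a + ρ i) / 2) - Complex.exp (-(κ a + ρ i) / 2))⁻¹)
    (fun k : Fin K => Complex.exp (κ a * ((K : ℂ) - 1 - 2 * (k : ℕ)) / 2))

theorem exp_sub_exp_eq (κ ρ : ℂ) : Complex.exp ((κ + ρ) / 2) - Complex.exp (-(κ + ρ) / 2) =
    Complex.exp ((κ - ρ) / 2) * (Complex.exp ρ - Complex.exp (-κ)) := by
  rw [mul_sub, ← Complex.exp_add, ← Complex.exp_add]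
  ring_nf

/-- Divide row `a` by `exp (κ a * (K - 1) / 2)`. The last `K` columns become powers of `exp (-κ a)`
and column `i` becomes a multiple of `1 / (exp (-κ a) - exp (ρ i))`. -/
theorem det_twistedConst_ne_zero {n K : ℕ} {κ : Fin (n + K) → ℂ} {ρ : Fin n → ℂ}
    (hκ : Function.Injective fun a => Complex.exp (-κ a))
    (hρ : Function.Injective fun i => Complex.exp (ρ i))
    (hκρ : ∀ a i, Complex.exp (-κ a) ≠ Complex.exp (ρ i)) : (twistedConst κ ρ).det ≠ 0 := by
  intro h0
  obtain ⟨v, hv, h⟩ := Matrix.exists_mulVec_eq_zero_iff.2 h0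
  apply hv
  have hP : (∑ k : Fin K, C (v (Fin.natAdd n k)) * X ^ (k : ℕ) : ℂ[X]).degree < K :=
    mem_degreeLT.1 (sum_mem fun k _ => mem_degreeLT.2
      (lt_of_le_of_lt (degree_C_mul_X_pow_le _ _) (by exact_mod_cast k.2)))
  obtain ⟨h1, h2⟩ := cauchyVandermonde_injective (K := K) hκ hρ hκρ (by simp)
    -- The part of column `i` depending on `ρ i` alone after this division; the sign turns `exp (ρ
    -- i) - exp (-κ a)` around.
    (fun i => -(Complex.exp (ρ i * (K + 1) / 2) * v (Fin.castAdd K i)))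
    (∑ k : Fin K, C (v (Fin.natAdd n k)) * X ^ (k : ℕ)) hP (fun a => by
      have h3 := congrFun h a
      rw [Matrix.mulVec, dotProduct, Fin.sum_univ_add] at h3
      simp only [twistedConst, Matrix.of_apply, Fin.addCases_left, Fin.addCases_right,
        Pi.zero_apply] at h3
      refine mul_left_cancel₀ (Complex.exp_ne_zero (κ a * (K - 1) / 2)) ?_
      rw [mul_zero, ← h3, mul_add, Finset.mul_sum, eval_finsetSum, Finset.mul_sum]
      congr 1
      · refine Finset.sum_congr rfl fun i _ => ?_
        have h4 : Complex.exp (ρ i) - Complex.exp (-κ a) ≠ 0 := sub_ne_zero.2 (hκρ a i).symm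
        have h5 : Complex.exp (-κ a) - Complex.exp (ρ i) ≠ 0 := sub_ne_zero.2 (hκρ a i)
        have h6 := Complex.exp_ne_zero ((κ a - ρ i) / 2)
        rw [exp_sub_exp_eq]
        have h7 : Complex.exp (κ a * (K - 1) / 2) * Complex.exp (ρ i * (K + 1) / 2) *
            Complex.exp ((κ a - ρ i) / 2) = Complex.exp ((κ a + ρ i) * K / 2) := by
          rw [← Complex.exp_add, ← Complex.exp_add]; ring_nf
        rw [← h7, ← neg_sub (Complex.exp (ρ i)), div_neg, neg_div, neg_neg]
        field_simp
      · refine Finset.sum_congr rfl fun k _ => ?_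
        rw [eval_mul, eval_C, eval_pow, eval_X, mul_left_comm, mul_comm (v _), ← Complex.exp_nat_mul,
          ← Complex.exp_add]
        ring_nf)
  ext j
  induction j using Fin.addCases with
  | left i =>
    have := congrFun h1 i
    simpa using this
  | right k =>
    have := congrArg (fun P : ℂ[X] => P.coeff k) h2
    simp only [finsetSum_coeff, coeff_C_mul, coeff_X_pow, coeff_zero] at this
    rw [Finset.sum_eq_single k] at this
    · simpa using this
    · intro b _ hb
      rw [if_neg (fun e => hb (Fin.ext e.symm)), mul_zero]
    · simp

variable {σ : Type*} {w : σ → ℕ}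

/-- To leading order column `i` is a constant times `q a * p i`, and a shifted column is a constant
times `q a`. The polynomials factor out of rows and columns and leave `det (twistedConst κ ρ)`. -/
theorem wronskianDet_twisted (ħ : ℂ) {n K : ℕ} {κ : Fin (n + K) → ℂ} {ρ : Fin n → ℂ}
    (hκ : Function.Injective fun a => Complex.exp (-κ a))
    (hρ : Function.Injective fun i => Complex.exp (ρ i))
    (hκρ : ∀ a i, Complex.exp (-κ a) ≠ Complex.exp (ρ i))
    {q : Fin (n + K) → (MvPolynomial σ ℂ)[X]} {p : Fin n → (MvPolynomial σ ℂ)[X]}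
    {lam : Fin (n + K) → ℕ} {nu : Fin n → ℕ} (hq : ∀ a, q a ∈ weightEq w (lam a))
    (hp : ∀ i, p i ∈ weightEq w (nu i)) :
    ∃ μ : ℂ, μ ≠ 0 ∧ μ • ((∏ a, q a) * ∏ i, p i) ∈
        weightEq w ((∑ a, lam a + ∑ i, nu i : ℕ) : ℤ) ∧
      wronskianDet ħ (n + K) n κ ρ q (fun a i => twistedSolution ħ (κ a + ρ i) (q a * p i)) -
        μ • ((∏ a, q a) * ∏ i, p i) ∈ weightLE w ((∑ a, lam a + ∑ i, nu i : ℕ) - 1) := by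
  refine ⟨(twistedConst κ ρ).det, det_twistedConst_ne_zero hκ hρ hκρ, ?_⟩
  set t : Fin (n + K) → (MvPolynomial σ ℂ)[X] := Fin.addCases p (fun _ => 1) with ht
  set s : Fin (n + K) → ℤ := Fin.addCases (fun i => (nu i : ℤ)) (fun _ => ((0 : ℕ) : ℤ)) with hs
  set T : Matrix (Fin (n + K)) (Fin (n + K)) (MvPolynomial σ ℂ)[X] :=
    Matrix.of fun a j => twistedConst κ ρ a j • (q a * t j) with hT
  have hdet : T.det = (twistedConst κ ρ).det • ((∏ a, q a) * ∏ i, p i) := by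
    have h1 : T = Matrix.of fun a j => t j * (Matrix.of fun a j => q a *
        (algebraMap ℂ (MvPolynomial σ ℂ)[X]).mapMatrix (twistedConst κ ρ) a j) a j := by
      ext1 a j
      simp only [hT, Matrix.of_apply, Algebra.smul_def, RingHom.mapMatrix_apply, Matrix.map_apply]
      ring
    rw [h1, Matrix.det_mul_row, Matrix.det_mul_column, ← RingHom.map_det, Fin.prod_univ_add t,
      Algebra.smul_def]
    simp only [ht, Fin.addCases_left, Fin.addCases_right, Finset.prod_const_one]
    ring
  have hsum : ∑ a, (lam a : ℤ) + ∑ j, s j = ((∑ a, lam a + ∑ i, nu i : ℕ) : ℤ) := by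
    rw [Fin.sum_univ_add s]
    simp [hs]
  rw [← hdet, ← hsum]
  refine det_sub_det_mem (fun a j => ?_) (fun a j => ?_)
  · refine Submodule.smul_mem _ _ (weightEq_mul (hq a) ?_)
    induction j using Fin.addCases with
    | left i => simpa only [ht, hs, Fin.addCases_left] using hp i
    | right k => 
      have := X_pow_mem_weightEq (w := w) 0
      rw [pow_zero] at this
      simpa only [ht, hs, Fin.addCases_right] using this
  · induction j using Fin.addCases with
    | left i =>
      have hne : Complex.exp ((κ a + ρ i) / 2) - Complex.exp (-(κ a + ρ i) / 2) ≠ 0 := by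
        rw [exp_sub_exp_eq]
        exact mul_ne_zero (Complex.exp_ne_zero _) (sub_ne_zero.2 (hκρ a i).symm)
      have h1 := weightEq_le_weightLE le_rfl (weightEq_mul (hq a) (hp i))
      have h2 := twistedSolution_sub_mem ħ _ hne h1
      have h3 := qshift_sub_mem ħ (κ a + ρ i) K (by
        have := add_mem (weightLE_mono (sub_le_self _ zero_le_one) h2) (Submodule.smul_mem _
          (Complex.exp ((κ a + ρ i) / 2) - Complex.exp (-(κ a + ρ i) / 2))⁻¹ h1)
        rwa [sub_add_cancel] at this)
      have h4 := add_mem h3 (Submodule.smul_mem _ (Complex.exp ((κ a + ρ i) * K / 2)) h2)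
      simp only [hT, ht, hs, Matrix.of_apply, Fin.addCases_left, twistedConst, Fin.val_castAdd,
        Fin.is_lt, dif_pos, Fin.eta, mul_smul]
      convert h4 using 1
      push_cast
      rw [add_sub_cancel_left]
      module
    | right k =>
      have h1 := qshift_sub_mem ħ (κ a) ((K : ℤ) - 1 - 2 * (k : ℕ))
        (weightEq_le_weightLE le_rfl (hq a))
      simp only [hT, ht, hs, Matrix.of_apply, Fin.addCases_right, twistedConst, Fin.val_natAdd,
        mul_one, Nat.cast_zero, add_zero]
      rw [dif_neg (by omega)]
      convert h1 using 1
      push_cast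
      rw [add_sub_cancel_left, add_sub_cancel_left]

variable {m n : ℕ} (lam : Fin m → ℕ) (nu : Fin n → ℕ)

/-- The weights for which the Q-functions of the twisted case are homogeneous. -/
def twistedWeight : TwistedVar lam nu → ℕ :=
  Sum.elim (fun v => lam v.1 - v.2) (fun v => nu v.1 - v.2)

theorem twistedWeight_pos (v) : 0 < twistedWeight lam nu v := by
  rcases v with ⟨a, k⟩ | ⟨i, k⟩ <;> simp [twistedWeight]

theorem C_X_mul_X_pow_mem_weightEq {v : σ} {k N : ℕ} (h : w v + k = N) :
    (C (MvPolynomial.X v) * X ^ k : (MvPolynomial σ ℂ)[X]) ∈ weightEq w N := by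
  have := weightEq_mul (C_X_mem_weightEq (w := w) v) (X_pow_mem_weightEq k)
  rwa [← h, Nat.cast_add]

theorem twistedBoson_mem (a) :
    twistedBoson lam nu a ∈ weightEq (twistedWeight lam nu) (lam a) := by
  refine add_mem (X_pow_mem_weightEq _) (sum_mem fun k _ => C_X_mul_X_pow_mem_weightEq ?_)
  have := k.2
  simp only [twistedWeight, Sum.elim_inl]
  omega

theorem twistedFermion_mem (i) :
    twistedFermion lam nu i ∈ weightEq (twistedWeight lam nu) (nu i) := by
  refine add_mem (X_pow_mem_weightEq _) (sum_mem fun k _ => C_X_mul_X_pow_mem_weightEq ?_)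
  have := k.2
  simp only [twistedWeight, Sum.elim_inr]
  omega

theorem monic_X_pow_add_sum {d : ℕ} (c : Fin d → ℂ) :
    (X ^ d + ∑ k : Fin d, C (c k) * X ^ (k : ℕ)).Monic := by
  exact monic_X_pow_add (mem_degreeLT.1 (sum_mem fun k _ => mem_degreeLT.2
    (lt_of_le_of_lt (degree_C_mul_X_pow_le _ _) (by exact_mod_cast k.2))))

/-- Monic divisors of a power of the prime `X` are powers of `X`. -/
theorem eq_zero_of_X_pow_add_sum_dvd {d L : ℕ} (c : Fin d → ℂ)
    (h : X ^ d + ∑ k : Fin d, C (c k) * X ^ (k : ℕ) ∣ (X ^ L : ℂ[X])) : c = 0 := by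
  obtain ⟨e, -, he⟩ := (dvd_prime_pow prime_X L).1 h
  have h1 := eq_of_monic_of_associated (monic_X_pow_add_sum c) (monic_X_pow e) he
  have h2 : d = e := by
    have hd : (∑ k : Fin d, C (c k) * X ^ (k : ℕ)).degree < (d : WithBot ℕ) :=
      mem_degreeLT.1 (sum_mem fun k _ => mem_degreeLT.2
        (lt_of_le_of_lt (degree_C_mul_X_pow_le _ _) (by exact_mod_cast k.2)))
    have h3 := congrArg natDegree h1
    rw [natDegree_X_pow] at h3
    rw [← h3, natDegree_add_eq_left_of_degree_lt (by rwa [degree_X_pow]), natDegree_X_pow]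
  subst h2
  rw [add_eq_left] at h1
  ext k
  have := congrArg (fun P : ℂ[X] => P.coeff k) h1
  simp only [finsetSum_coeff, coeff_C_mul, coeff_X_pow, coeff_zero] at this
  rw [Finset.sum_eq_single k] at this
  · simpa using this
  · intro b _ hb
    rw [if_neg (fun e => hb (Fin.ext e.symm)), mul_zero]
  · simp

theorem twisted_isFreeOfConstantRank (ħ : ℂ) {x : Fin m → ℂ} {y : Fin n → ℂ} (hx : ∀ a, x a ≠ 0)
    (hy : ∀ i, y i ≠ 0) (hxy : Function.Injective (Sum.elim x y)) :
    IsFreeOfConstantRank (twistedSW ħ x y lam nu) := by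
  obtain ⟨μ, hμ, hT, hD⟩ : ∃ μ : ℂ, μ ≠ 0 ∧
      μ • ((∏ a, twistedBoson lam nu a) * ∏ i, twistedFermion lam nu i) ∈
        weightEq (twistedWeight lam nu) (twistedLength lam nu : ℤ) ∧
      superWronskian ħ m n (fun a => Complex.log (x a)) (fun i => -Complex.log (y i))
      (twistedBoson lam nu) (twistedFermion lam nu)
      (fun a i => twistedSolution ħ (Complex.log (x a) + -Complex.log (y i))
        (twistedBoson lam nu a * twistedFermion lam nu i)) -
        μ • ((∏ a, twistedBoson lam nu a) * ∏ i, twistedFermion lam nu i) ∈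
        weightLE (twistedWeight lam nu) (twistedLength lam nu - 1) := by
    have hb := twistedBoson_mem lam nu
    have hf := twistedFermion_mem lam nu
    have e1 : ∀ a, Complex.exp (Complex.log (x a)) = x a := fun a => Complex.exp_log (hx a)
    have e2 : ∀ i, Complex.exp (Complex.log (y i)) = y i := fun i => Complex.exp_log (hy i)
    have i1 : Function.Injective x := fun a b h => Sum.inl_injective (hxy h)
    have i2 : Function.Injective y := fun a b h => Sum.inr_injective (hxy h)
    have i3 : ∀ a i, x a ≠ y i := fun a i h => Sum.inl_ne_inr (hxy (a₁ := .inl a) (a₂ := .inr i) h)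
    by_cases hmn : n ≤ m
    · simp only [superWronskian, if_pos hmn]
      generalize twistedBoson lam nu = q at hb ⊢
      generalize twistedFermion lam nu = p at hf ⊢
      generalize twistedWeight lam nu = w at hb hf ⊢
      rw [twistedLength]
      obtain ⟨K, rfl⟩ := Nat.exists_eq_add_of_le hmn
      refine wronskianDet_twisted ħ ?_ ?_ ?_ hb hf
      · intro a b h
        simp only [Complex.exp_neg, e1, inv_inj] at h
        exact i1 h
      · intro a b h
        simp only [Complex.exp_neg, e2, inv_inj] at h
        exact i2 h
      · intro a i h
        simp only [Complex.exp_neg, e1, e2, inv_inj] at h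
        exact i3 a i h
    -- With the roles exchanged, the Cauchy–Vandermonde points are the `y i` and the nodes the `x
    -- a`; in the other case they are the inverses of the `x a` and `y i`.
    · simp only [superWronskian, if_neg hmn]
      generalize twistedBoson lam nu = q at hb ⊢
      generalize twistedFermion lam nu = p at hf ⊢
      generalize twistedWeight lam nu = w at hb hf ⊢
      rw [twistedLength, add_comm, mul_comm (∏ a, q a)]
      obtain ⟨K, rfl⟩ := Nat.exists_eq_add_of_le (le_of_not_ge hmn)
      simp only [add_comm (Complex.log _), mul_comm (q _)]
      refine wronskianDet_twisted ħ ?_ ?_ ?_ hf hb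
      · intro a b h
        simp only [neg_neg, e2] at h
        exact i2 h
      · intro a b h
        simp only [e1] at h
        exact i1 h
      · intro a i h
        simp only [neg_neg, e1, e2] at h
        exact i3 i a h.symm
  have hmap : ∀ c : TwistedVar lam nu → ℂ,
      (μ • ((∏ a, twistedBoson lam nu a) * ∏ i, twistedFermion lam nu i)).map
        (MvPolynomial.eval c) = C μ *
        ((∏ a, (X ^ lam a + ∑ k : Fin (lam a), C (c (Sum.inl ⟨a, k⟩)) * X ^ (k : ℕ))) *
          ∏ i, (X ^ nu i + ∑ k : Fin (nu i), C (c (Sum.inr ⟨i, k⟩)) * X ^ (k : ℕ))) := by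
    intro c
    rw [Algebra.smul_def, Polynomial.map_mul, Polynomial.map_mul, Polynomial.map_prod,
      Polynomial.map_prod]
    congr 1
    · rw [IsScalarTower.algebraMap_apply ℂ (MvPolynomial (TwistedVar lam nu) ℂ), algebraMap_eq,
        map_C, MvPolynomial.algebraMap_eq, MvPolynomial.eval_C]
    · simp [twistedBoson, twistedFermion, Polynomial.map_sum]
  have hcc : MvPolynomial.constantCoeff ((μ • ((∏ a, twistedBoson lam nu a) *
      ∏ i, twistedFermion lam nu i)).coeff (twistedLength lam nu)) = μ := by
    rw [← MvPolynomial.eval_zero, ← coeff_map, hmap]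
    simp [Finset.prod_pow_eq_pow_sum, ← pow_add, twistedLength]
  refine isFreeOfConstantRank_of_leading_part (twistedWeight_pos lam nu) ?_ hT hD ?_ ?_
  · simp [twistedLength]
  · rwa [hcc]
  · intro c hc
    rw [hcc, hmap] at hc
    have hc' := mul_left_cancel₀ (C_ne_zero.2 hμ) hc
    ext v
    rcases v with ⟨a, k⟩ | ⟨i, k⟩
    · refine congrFun (eq_zero_of_X_pow_add_sum_dvd (L := twistedLength lam nu)
        (fun k => c (Sum.inl ⟨a, k⟩)) ?_) k
      rw [← hc']
      exact dvd_mul_of_dvd_left (Finset.dvd_prod_of_mem (fun a => X ^ lam a +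
        ∑ k : Fin (lam a), C (c (Sum.inl ⟨a, k⟩)) * X ^ (k : ℕ)) (Finset.mem_univ a)) _
    · refine congrFun (eq_zero_of_X_pow_add_sum_dvd (L := twistedLength lam nu)
        (fun k => c (Sum.inr ⟨i, k⟩)) ?_) k
      rw [← hc']
      exact dvd_mul_of_dvd_right (Finset.dvd_prod_of_mem (fun i => X ^ nu i +
        ∑ k : Fin (nu i), C (c (Sum.inr ⟨i, k⟩)) * X ^ (k : ℕ)) (Finset.mem_univ i)) _

end Twisted

/-! ### Coefficients of antiderivatives and divided derivatives -/

section Coefficients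

variable {R : Type*} [CommRing R] [Algebra ℂ R]

theorem antideriv_monomial (k : ℕ) (a : R) :
    antideriv (monomial k a) = monomial (k + 1) (algebraMap ℂ R ((k : ℂ) + 1)⁻¹ * a) := by
  rw [antideriv, lsum_apply, sum_monomial_index _ _ (by simp), LinearMap.smul_apply,
    smul_monomial, smul_eq_mul]

theorem antideriv_coeff_zero (f : R[X]) : (antideriv f).coeff 0 = 0 := by
  induction f using Polynomial.induction_on' with
  | add f g hf hg => rw [map_add, coeff_add, hf, hg, add_zero]
  | monomial k a => rw [antideriv_monomial, coeff_monomial, if_neg (Nat.succ_ne_zero k)]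

theorem antideriv_coeff_succ (f : R[X]) (t : ℕ) :
    (antideriv f).coeff (t + 1) = algebraMap ℂ R ((t : ℂ) + 1)⁻¹ * f.coeff t := by
  induction f using Polynomial.induction_on' with
  | add f g hf hg => rw [map_add, coeff_add, hf, hg, coeff_add, mul_add]
  | monomial k a =>
    rw [antideriv_monomial, coeff_monomial, coeff_monomial]
    by_cases h : k = t
    · subst h; simp
    · rw [if_neg (by omega), if_neg h, mul_zero]

/-- The operator u^k D_k, with D_k the divided derivative, is diagonal on powers of u, so it does
not lower orders at 0. -/
theorem hasseDeriv_mul_X_pow_coeff (k : ℕ) (f : R[X]) (t : ℕ) :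
    (hasseDeriv k f * X ^ k).coeff t = (t.choose k : R) * f.coeff t := by
  rw [coeff_mul_X_pow']
  split_ifs with h
  · rw [hasseDeriv_coeff, Nat.sub_add_cancel h]
  · rw [Nat.choose_eq_zero_of_lt (by omega), Nat.cast_zero, zero_mul]

end Coefficients

/-! ### Orders of vanishing at u = 0 -/

section Order

/-- The polynomial `f` vanishes at the origin exactly to order `k`. -/
def HasOrder (f : ℂ[X]) (k : ℕ) : Prop := X ^ k ∣ f ∧ f.coeff k ≠ 0

theorem hasOrder_natTrailingDegree {f : ℂ[X]} (h : f ≠ 0) : HasOrder f f.natTrailingDegree :=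
  ⟨X_pow_dvd_iff.2 fun _ hd => coeff_eq_zero_of_lt_natTrailingDegree hd,
    trailingCoeff_nonzero_iff_nonzero.2 h⟩

theorem HasOrder.le_of_coeff_ne_zero {f : ℂ[X]} {k l : ℕ} (h : HasOrder f k)
    (hl : f.coeff l ≠ 0) : k ≤ l :=
  not_lt.1 fun hlt => hl (X_pow_dvd_iff.1 h.1 l hlt)

/-- The moves admitted in the later elimination: only polynomials of strictly higher order are
subtracted. -/
theorem HasOrder.sub_smul {f g : ℂ[X]} {k l : ℕ} (hf : HasOrder f k) (hg : HasOrder g l) (c : ℂ)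
    (h : c ≠ 0 → k < l) : HasOrder (f - c • g) k := by
  rcases eq_or_ne c 0 with rfl | hc
  · simpa using hf
  · have hkl := h hc
    refine ⟨dvd_sub hf.1 ?_, ?_⟩
    · rw [smul_eq_C_mul]
      exact dvd_mul_of_dvd_right ((pow_dvd_pow X hkl.le).trans hg.1) _
    · rw [coeff_sub, coeff_smul, X_pow_dvd_iff.1 hg.1 k hkl, smul_zero, sub_zero]
      exact hf.2

theorem exists_eq_X_pow_mul {f : ℂ[X]} {k : ℕ} (h : X ^ k ∣ f) :
    ∃ g : ℂ[X], f = X ^ k * g ∧ g.coeff 0 = f.coeff k := by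
  obtain ⟨g, rfl⟩ := h
  exact ⟨g, rfl, by simpa using (coeff_X_pow_mul g k 0).symm⟩

theorem X_pow_dvd_antideriv {f : ℂ[X]} {k : ℕ} (h : X ^ k ∣ f) : X ^ (k + 1) ∣ antideriv f := by
  refine X_pow_dvd_iff.2 fun t ht => ?_
  rcases t with _ | t
  · exact antideriv_coeff_zero f
  · rw [antideriv_coeff_succ, X_pow_dvd_iff.1 h t (by omega), mul_zero]

theorem X_pow_dvd_hasseDeriv_mul {f : ℂ[X]} {k : ℕ} (h : X ^ k ∣ f) (l : ℕ) :
    X ^ k ∣ hasseDeriv l f * X ^ l := by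
  refine X_pow_dvd_iff.2 fun t ht => ?_
  rw [hasseDeriv_mul_X_pow_coeff, X_pow_dvd_iff.1 h t ht, mul_zero]

end Order

/-! ### Elimination compatible with orders of vanishing -/

section Elimination

variable {ι κ : Type*} [Fintype ι] [DecidableEq ι] [Fintype κ] [DecidableEq κ]

/-- The family of linear combinations of `q` with coefficient matrix `A`. -/
def combine (A : Matrix ι ι ℂ) (q : ι → ℂ[X]) (a : ι) : ℂ[X] := ∑ b, A a b • q b

theorem combine_one (q : ι → ℂ[X]) : combine 1 q = q := by
  ext1 a
  simp [combine, Matrix.one_apply]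

theorem combine_mul (A B : Matrix ι ι ℂ) (q : ι → ℂ[X]) :
    combine (A * B) q = combine A (combine B q) := by
  ext1 a
  simp only [combine, Matrix.mul_apply, Finset.sum_smul, Finset.smul_sum, mul_smul]
  exact Finset.sum_comm

/-- The elementary matrix which subtracts `v b` times row `a` from each row `b`. -/
def subRows (v : ι → ℂ) (a : ι) : Matrix ι ι ℂ := 1 - Matrix.vecMulVec v (Pi.single a 1)

theorem combine_subRows (v : ι → ℂ) (a : ι) (q : ι → ℂ[X]) (b : ι) :
    combine (subRows v a) q b = q b - v b • q a := by
  simp [subRows, combine, Matrix.one_apply, Matrix.vecMulVec_apply, sub_smul, Pi.single_apply]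

theorem isUnit_subRows {v : ι → ℂ} {a : ι} (h : v a = 0) :
    IsUnit (subRows v a) := by
  have hN : Matrix.vecMulVec v (Pi.single a 1) * Matrix.vecMulVec v (Pi.single a 1) = 0 := by
    ext b c
    simp [Matrix.mul_apply, Matrix.vecMulVec_apply, Pi.single_apply, h]
  have : subRows v a * (1 + Matrix.vecMulVec v (Pi.single a 1)) =
      1 := by
    rw [subRows, sub_mul, mul_add, mul_add, hN]
    simp
  exact (Matrix.isUnit_iff_isUnit_det _).2 (Matrix.isUnit_det_of_right_inverse this)

theorem combine_ne_zero {A : Matrix ι ι ℂ} (hA : IsUnit A) {q : ι → ℂ[X]}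
    (hq : LinearIndependent ℂ q) (a : ι) : combine A q a ≠ 0 := by
  intro h
  have h1 := Fintype.linearIndependent_iff.1 hq (A a) h
  have h2 := (Matrix.isUnit_iff_isUnit_det _).1 hA
  rw [Matrix.det_eq_zero_of_row_eq_zero a h1] at h2
  exact not_isUnit_zero h2

/-- Take an invertible combination of maximal total order; the total is bounded by the degrees. If
two orders coincided, cancelling one lowest term against the other would increase it. -/
theorem exists_injective_orders {q : ι → ℂ[X]} (hq : LinearIndependent ℂ q) :
    ∃ (A : Matrix ι ι ℂ) (al : ι → ℕ), IsUnit A ∧ Function.Injective al ∧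
      ∀ a, HasOrder (combine A q a) (al a) := by
  set S : Set ℕ := {s | ∃ A : Matrix ι ι ℂ, IsUnit A ∧
    s = ∑ a, (combine A q a).natTrailingDegree} with hS
  have hne : S.Nonempty := ⟨_, 1, isUnit_one, rfl⟩
  have hbdd : BddAbove S := by
    refine ⟨∑ _a : ι, Finset.univ.sup fun b => (q b).natDegree, ?_⟩
    rintro s ⟨A, -, rfl⟩
    refine Finset.sum_le_sum fun a _ => (natTrailingDegree_le_natDegree _).trans ?_
    refine natDegree_sum_le_of_forall_le _ _ fun b _ => (natDegree_smul_le _ _).trans ?_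
    exact Finset.le_sup (f := fun b => (q b).natDegree) (Finset.mem_univ b)
  obtain ⟨A, hA, hAS⟩ := Nat.sSup_mem hne hbdd
  have hord := fun a => hasOrder_natTrailingDegree (combine_ne_zero hA hq a)
  refine ⟨A, _, hA, fun a b hab => ?_, hord⟩
  by_contra hne
  set f := combine A q with hf
  set c : ℂ := (f a).coeff (f a).natTrailingDegree / (f b).coeff (f a).natTrailingDegree with hc
  have hb0 : (f b).coeff (f a).natTrailingDegree ≠ 0 := by rw [hab]; exact (hord b).2
  set N := subRows (Pi.single a c : ι → ℂ) b with hN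
  have hNA : IsUnit (N * A) :=
    (isUnit_subRows (by rw [Pi.single_eq_of_ne (Ne.symm hne)])).mul hA
  have hval : ∀ x, combine (N * A) q x = f x - (Pi.single a c : ι → ℂ) x • f b := fun x => by
    rw [combine_mul, hN, combine_subRows]
  have hlt : ∑ x, (f x).natTrailingDegree < ∑ x, (combine (N * A) q x).natTrailingDegree := by
    have ha : (f a).natTrailingDegree < (combine (N * A) q a).natTrailingDegree := by
      refine le_natTrailingDegree (combine_ne_zero hNA hq a) fun t ht => ?_
      rw [hval, Pi.single_eq_same, coeff_sub, coeff_smul, smul_eq_mul]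
      rcases (Nat.lt_succ_iff.1 ht).lt_or_eq with h | h
      · rw [coeff_eq_zero_of_lt_natTrailingDegree h,
          coeff_eq_zero_of_lt_natTrailingDegree (hab ▸ h), mul_zero, sub_zero]
      · rw [h, hc, div_mul_cancel₀ _ hb0, sub_self]
    refine Finset.sum_lt_sum (fun x _ => ?_) ⟨a, Finset.mem_univ a, ha⟩
    rcases eq_or_ne x a with rfl | hx
    · exact ha.le
    · rw [hval, Pi.single_eq_of_ne hx, zero_smul, sub_zero]
  have hle := le_csSup hbdd (show _ ∈ S from ⟨N * A, hNA, rfl⟩)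
  rw [hAS] at hle
  exact absurd hlt (not_lt.2 hle)

theorem subRows_mul (v : ι → ℂ) (a : ι) (M : Matrix ι κ ℂ) (b : ι) (i : κ) :
    (subRows v a * M) b i = M b i - v b * M a i := by
  rw [subRows, Matrix.sub_mul, Matrix.one_mul, Matrix.sub_apply, Matrix.mul_apply]
  simp [Matrix.vecMulVec_apply, Pi.single_apply]

theorem mul_subRows_transpose (v : κ → ℂ) (j : κ) (M : Matrix ι κ ℂ) (b : ι) (i : κ) :
    (M * (subRows v j).transpose) b i = M b i - v i * M b j := by
  rw [subRows, Matrix.transpose_sub, Matrix.mul_sub, Matrix.transpose_one, Matrix.mul_one,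
    Matrix.sub_apply,
    Matrix.mul_apply]
  simp [Matrix.vecMulVec_apply, Pi.single_apply, mul_comm]

/-- The nonzero entries of row `a` are alone in their row and their column. -/
def IsolatedRow (M : Matrix ι κ ℂ) (a : ι) : Prop :=
  ∀ i, M a i ≠ 0 → (∀ j, j ≠ i → M a j = 0) ∧ ∀ b, b ≠ a → M b i = 0

/-- Gaussian elimination, treating rows by decreasing `al` and taking as pivot in each row the
nonzero entry with largest `be`. The pivot row is then subtracted only from rows of smaller `al`,
and the pivot column only from columns of smaller `be`, so all exact orders survive. Rows with `al a
≥ t` are those already treated. -/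
theorem exists_isolatedRow {al : ι → ℕ} {be : κ → ℕ} (hal : Function.Injective al)
    (hbe : Function.Injective be) (t : ℕ) :
    ∀ (q : ι → ℂ[X]) (p : κ → ℂ[X]) (M : Matrix ι κ ℂ), (∀ a, HasOrder (q a) (al a)) →
      (∀ i, HasOrder (p i) (be i)) → (∀ a, t ≤ al a → IsolatedRow M a) →
    ∃ (A : Matrix ι ι ℂ) (B : Matrix κ κ ℂ), IsUnit A ∧ IsUnit B ∧
      (∀ a, HasOrder (combine A q a) (al a)) ∧ (∀ i, HasOrder (combine B p i) (be i)) ∧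
      ∀ a, IsolatedRow (A * M * B.transpose) a := by
  induction t with
  | zero =>
    intro q p M hq hp hM
    exact ⟨1, 1, isUnit_one, isUnit_one, by rwa [combine_one], by rwa [combine_one],
      by simpa using hM⟩
  | succ t ih =>
    intro q p M hq hp hM
    by_cases h : ∃ a, al a = t ∧ ∃ i, M a i ≠ 0
    swap
    · refine ih q p M hq hp fun a ha i hi => ?_
      rcases ha.lt_or_eq with h1 | h1
      · exact hM a h1 i hi
      · exact absurd ⟨a, h1.symm, i, hi⟩ h
    obtain ⟨a, rfl, i₀, hi₀⟩ := h
    obtain ⟨j, hj, hmax⟩ := Finset.exists_max_image (Finset.univ.filter fun i => M a i ≠ 0) be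
      ⟨i₀, by simpa using hi₀⟩
    simp only [Finset.mem_filter, Finset.mem_univ, true_and] at hj hmax
    set w : κ → ℂ := fun i => if i = j then 0 else M a i / M a j with hw
    set v : ι → ℂ := fun b => if b = a then 0 else M b j / M a j with hv
    have hwj : w j = 0 := by simp [hw]
    have hva : v a = 0 := by simp [hv]
    set P := subRows v a with hP
    set Q := subRows w j with hQ
    -- A row treated earlier vanishes in the pivot column, since a nonzero isolated entry there
    -- would force `M a j = 0`.
    have hxj : ∀ x, al a + 1 ≤ al x → M x j = 0 := by
      intro x hx
      by_contra hne
      exact hj ((hM x hx j hne).2 a (by rintro rfl; omega))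
    have hM' : ∀ b i, (P * M * Q.transpose) b i =
        M b i - v b * M a i - w i * (M b j - v b * M a j) := by
      intro b i
      rw [hQ, mul_subRows_transpose, hP, subRows_mul, subRows_mul]
    have hMa : ∀ i, i ≠ j → (P * M * Q.transpose) a i = 0 := by
      intro i hi
      rw [hM', hva]
      simp only [hw, if_neg hi]
      field_simp
      ring
    have hMj : ∀ b, b ≠ a → (P * M * Q.transpose) b j = 0 := by
      intro b hb
      rw [hM', hwj]
      simp only [hv, if_neg hb]
      field_simp
      ring
    have hMij : ∀ b i, i ≠ j → (P * M * Q.transpose) b i = M b i - w i * M b j := by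
      intro b i hi
      rw [hM']
      simp only [hw, if_neg hi]
      field_simp
      ring
    obtain ⟨A, B, hA, hB, hAq, hBp, hAB⟩ := ih (combine P q) (combine Q p) (P * M * Q.transpose)
      (fun b => by
        rw [hP, combine_subRows]
        refine (hq b).sub_smul (hq a) _ fun hvb => ?_
        have hba : b ≠ a := fun e => hvb (by rw [e, hva])
        have h1 : M b j ≠ 0 := fun e => hvb (by simp [hv, e])
        have h2 : ¬ al a + 1 ≤ al b := fun e => h1 (hxj b e)
        have h3 : al b ≠ al a := fun e => hba (hal e)
        omega)
      (fun i => by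
        rw [hQ, combine_subRows]
        refine (hp i).sub_smul (hp j) _ fun hwi => ?_
        have hij : i ≠ j := fun e => hwi (by rw [e, hwj])
        have h1 : M a i ≠ 0 := fun e => hwi (by simp [hw, e])
        exact (hmax i h1).lt_of_ne fun e => hij (hbe e))
      (fun x hx i hi => by
        rcases hx.lt_or_eq with h1 | h1
        -- A row treated earlier stays isolated: it vanishes in the pivot column, and its nonzero
        -- column meets row `a` in zero, so neither operation affects it.
        · have hij : i ≠ j := by
            rintro rfl
            exact hi (hMj x (by rintro rfl; omega))
          rw [hMij x i hij, hxj x h1, mul_zero, sub_zero] at hi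
          obtain ⟨h2, h3⟩ := hM x h1 i hi
          refine ⟨fun k hk => ?_, fun b hb => ?_⟩
          · rcases eq_or_ne k j with rfl | hkj
            · exact hMj x (by rintro rfl; omega)
            · rw [hMij x k hkj, hxj x h1, h2 k hk, mul_zero, sub_zero]
          · have hwi : w i = 0 := by
              simp only [hw, if_neg hij, h3 a (by rintro rfl; omega), zero_div]
            rw [hMij b i hij, hwi, h3 b hb, zero_mul, sub_zero]
        · obtain rfl := hal h1
          have hij : i = j := by
            by_contra hij
            exact hi (hMa i hij)
          subst hij
          exact ⟨hMa, hMj⟩)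
    refine ⟨A * P, B * Q, hA.mul (isUnit_subRows hva),
      hB.mul (isUnit_subRows hwj), fun b => ?_, fun i => ?_, ?_⟩
    · rw [combine_mul]; exact hAq b
    · rw [combine_mul]; exact hBp i
    · rw [Matrix.transpose_mul]
      simpa only [Matrix.mul_assoc] using hAB

end Elimination

/-! ### The leading determinant of the twist-less case and its order at u = 0 -/

section GramWronskian

variable {R κ : Type*} [CommRing R] [Algebra ℂ R] {K : ℕ}

/-- The matrix with a block of antiderivatives of products `q a * p i`, with integration constants
`c a i`, and a block of divided derivatives of the `q a`. -/
def gramWronskian (q : κ ⊕ Fin K → R[X]) (p : κ → R[X]) (c : κ ⊕ Fin K → κ → R) :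
    Matrix (κ ⊕ Fin K) (κ ⊕ Fin K) R[X] :=
  Matrix.of fun a => Sum.elim (fun i => antideriv (q a * p i) + C (c a i))
    (fun k => hasseDeriv k (q a))

variable [Fintype κ] [DecidableEq κ]

/-- Antiderivatives are bilinear in the two families and derivatives linear in the first, so a
change of families multiplies the matrix by constant matrices on both sides, provided the constants
transform to `A c Bᵀ`. -/
theorem det_gramWronskian_combine (A : Matrix (κ ⊕ Fin K) (κ ⊕ Fin K) ℂ) (B : Matrix κ κ ℂ)
    (q : κ ⊕ Fin K → ℂ[X]) (p : κ → ℂ[X]) (c : Matrix (κ ⊕ Fin K) κ ℂ) :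
    (gramWronskian (combine A q) (combine B p) (A * c * B.transpose)).det =
      C (A.det * B.det) * (gramWronskian q p c).det := by
  have h : gramWronskian (combine A q) (combine B p) (A * c * B.transpose) =
      C.mapMatrix A * gramWronskian q p c *
        (Matrix.fromBlocks (C.mapMatrix B) 0 0 1).transpose := by
    ext1 a j
    rw [Matrix.mul_apply]
    rcases j with i | k
    · simp only [Fintype.sum_sum_type, Matrix.transpose_apply, Matrix.fromBlocks_apply₁₁,
        Matrix.fromBlocks_apply₁₂, Matrix.zero_apply, mul_zero, Finset.sum_const_zero, add_zero]
      have h1 : antideriv (combine A q a * combine B p i) =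
          ∑ y, ∑ x, C (A a x) * antideriv (q x * p y) * C (B i y) := by
        rw [combine, combine, Finset.sum_mul_sum, Finset.sum_comm]
        simp only [map_sum]
        refine Finset.sum_congr rfl fun y _ => Finset.sum_congr rfl fun x _ => ?_
        have : (A a x • q x) * (B i y • p y) = (A a x * B i y) • (q x * p y) := by
          rw [smul_mul_smul_comm]
        rw [this, map_smul, smul_eq_C_mul, map_mul]
        ring
      have h2 : C ((A * c * B.transpose) a i) =
          ∑ y, ∑ x, C (A a x) * C (c x y) * C (B i y) := by
        simp only [Matrix.mul_apply, Matrix.transpose_apply, map_sum, map_mul, Finset.sum_mul]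
      have h3 : gramWronskian (combine A q) (combine B p) (A * c * B.transpose) a (Sum.inl i) =
          antideriv (combine A q a * combine B p i) + C ((A * c * B.transpose) a i) := rfl
      rw [h3, h1, h2, ← Finset.sum_add_distrib]
      refine Finset.sum_congr rfl fun y _ => ?_
      rw [Matrix.mul_apply, Finset.sum_mul, ← Finset.sum_add_distrib]
      refine Finset.sum_congr rfl fun x _ => ?_
      simp only [gramWronskian, Matrix.of_apply, Sum.elim_inl, RingHom.mapMatrix_apply,
        Matrix.map_apply]
      ring
    · simp only [Fintype.sum_sum_type, Matrix.transpose_apply, Matrix.fromBlocks_apply₂₁,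
        Matrix.fromBlocks_apply₂₂, Matrix.zero_apply, mul_zero, Finset.sum_const_zero, zero_add,
        Matrix.one_apply, mul_ite, mul_one, Finset.sum_ite_eq, Finset.mem_univ, if_true]
      simp only [gramWronskian, Matrix.of_apply, Sum.elim_inr, combine, Matrix.mul_apply,
        RingHom.mapMatrix_apply, Matrix.map_apply, map_sum, map_smul]
      simp [Fintype.sum_sum_type, smul_eq_C_mul]
  rw [h, Matrix.det_mul, Matrix.det_mul, Matrix.det_transpose, Matrix.det_fromBlocks_zero₂₁,
    Matrix.det_one, mul_one, ← RingHom.map_det, ← RingHom.map_det, map_mul]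
  ring

variable {al : κ ⊕ Fin K → ℕ} {be : κ → ℕ}

/-- Factoring out powers of the variable from the rows and columns of a square matrix. -/
theorem det_mul_X_pow_eq {ι : Type*} [Fintype ι] [DecidableEq ι] {E : Matrix ι ι ℂ[X]}
    {N : Matrix ι ι ℂ} {r s t : ι → ℕ}
    (h : ∀ a j, ∃ g : ℂ[X], E a j * X ^ s j = X ^ (r a + t j) * g ∧ g.coeff 0 = N a j) :
    ∃ g : ℂ[X], E.det * X ^ (∑ j, s j) = X ^ (∑ a, r a + ∑ j, t j) * g ∧ g.coeff 0 = N.det := by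
  choose G hG hN using h
  refine ⟨(Matrix.of G).det, ?_, ?_⟩
  · have h1 : (Matrix.of fun a j => X ^ s j * E a j) =
        Matrix.of fun a j => X ^ t j * (Matrix.of fun a j => X ^ r a * Matrix.of G a j) a j := by
      ext1 a j
      simp only [Matrix.of_apply]
      rw [mul_comm, hG, pow_add]
      ring
    have h2 := congrArg Matrix.det h1
    rw [Matrix.det_mul_row, Matrix.det_mul_row, Matrix.det_mul_column,
      Finset.prod_pow_eq_pow_sum, Finset.prod_pow_eq_pow_sum, Finset.prod_pow_eq_pow_sum] at h2
    rw [mul_comm, h2, pow_add]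
    ring
  · have := RingHom.map_det constantCoeff (Matrix.of G)
    rw [constantCoeff_apply] at this
    rw [this]
    congr 1
    ext a j
    exact hN a j

/-- Evaluation at t = 0, 1, 2, … gives a triangular system of binomial coefficients. -/
theorem eq_zero_of_sum_mul_choose (v : Fin K → ℂ)
    (h : ∑ k, C (v k * ((k : ℕ).factorial : ℂ)⁻¹) * descPochhammer ℂ k = 0) : v = 0 := by
  have h1 : ∀ t : ℕ, ∑ k : Fin K, v k * (t.choose k : ℂ) = 0 := by
    intro t
    have := congrArg (eval (t : ℂ)) h
    rw [eval_finsetSum, eval_zero] at this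
    rw [← this]
    refine Finset.sum_congr rfl fun k _ => ?_
    rw [eval_mul, eval_C, descPochhammer_eval_eq_descFactorial, Nat.descFactorial_eq_factorial_mul_choose]
    have : ((k : ℕ).factorial : ℂ) ≠ 0 := by exact_mod_cast Nat.factorial_ne_zero _
    push_cast
    field_simp
  have h2 : ∀ t : ℕ, ∀ ht : t < K, v ⟨t, ht⟩ = 0 := by
    intro t
    induction t using Nat.strong_induction_on with
    | _ t ih =>
      intro ht
      have := h1 t
      rw [Finset.sum_eq_single ⟨t, ht⟩] at this
      · simpa using this
      · intro k _ hk
        rcases lt_trichotomy (k : ℕ) t with h3 | h3 | h3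
        · rw [ih k h3 k.2, zero_mul]
        · exact absurd (Fin.ext h3) hk
        · rw [Nat.choose_eq_zero_of_lt h3, Nat.cast_zero, mul_zero]
      · simp
  ext k
  exact h2 k k.2

/-- Powers of u are drawn out until only constant terms `N` matter: `al a` from row `a`, `be i + 1`
from a column without constants, and a negative power, booked on the left side, from the other
columns (`al` of the pivot row for a column with a constant, `k` for the k-th derivative). The
matrix `N` is invertible: rows without constants form a Cauchy–Vandermonde system with points `al b`
and nodes `-(be i + 1)`, and each pivot row determines one remaining unknown. -/
theorem det_gramWronskian_order {q : κ ⊕ Fin K → ℂ[X]} {p : κ → ℂ[X]}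
    {c : Matrix (κ ⊕ Fin K) κ ℂ} (hal : Function.Injective al) (hbe : Function.Injective be)
    (hq : ∀ a, HasOrder (q a) (al a)) (hp : ∀ i, HasOrder (p i) (be i))
    (hc : ∀ a, IsolatedRow c a) :
    ∃ (g : ℂ[X]) (s : ℕ), g.coeff 0 ≠ 0 ∧ (c = 0 → s = 0) ∧
      (gramWronskian q p c).det * X ^ (s + ∑ k : Fin K, (k : ℕ)) =
        X ^ (∑ a, al a + ∑ i with (∀ a, c a i = 0), (be i + 1)) * g := by
  classical
  -- The pivot row of a column; its value is arbitrary for columns without constants.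
  have hf : ∀ i, ∃ a, (∃ b, c b i ≠ 0) → c a i ≠ 0 := by
    intro i
    by_cases h : ∃ b, c b i ≠ 0
    · exact ⟨h.choose, fun _ => h.choose_spec⟩
    · rcases isEmpty_or_nonempty (κ ⊕ Fin K) with he | ⟨⟨a⟩⟩
      · exact (IsEmpty.false (Sum.inl i : κ ⊕ Fin K)).elim
      · exact ⟨a, fun h' => absurd h' h⟩
  choose f hf using hf
  set N : Matrix (κ ⊕ Fin K) (κ ⊕ Fin K) ℂ := Matrix.of fun b => Sum.elim
    (fun i => if ∀ a, c a i = 0 then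
      (q b).coeff (al b) * (p i).coeff (be i) * ((al b + be i : ℕ) + 1 : ℂ)⁻¹ else c b i)
    (fun k => ((al b).choose k : ℂ) * (q b).coeff (al b)) with hN
  set s : κ ⊕ Fin K → ℕ := Sum.elim (fun i => if ∀ a, c a i = 0 then 0 else al (f i))
    (fun k => k) with hs
  set t : κ ⊕ Fin K → ℕ := Sum.elim (fun i => if ∀ a, c a i = 0 then be i + 1 else 0)
    (fun _ => 0) with ht
  have hI : ∀ a i, ∃ g : ℂ[X], antideriv (q a * p i) = X ^ (al a + be i + 1) * g ∧
      g.coeff 0 = (q a).coeff (al a) * (p i).coeff (be i) * ((al a + be i : ℕ) + 1 : ℂ)⁻¹ := by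
    intro a i
    obtain ⟨g, hg, hg0⟩ := exists_eq_X_pow_mul (X_pow_dvd_antideriv (k := al a + be i)
      (pow_add (X : ℂ[X]) _ _ ▸ mul_dvd_mul (hq a).1 (hp i).1))
    refine ⟨g, hg, ?_⟩
    obtain ⟨g₁, h1, h1'⟩ := exists_eq_X_pow_mul (hq a).1
    obtain ⟨g₂, h2, h2'⟩ := exists_eq_X_pow_mul (hp i).1
    rw [hg0, antideriv_coeff_succ, ← h1', ← h2']
    nth_rw 1 [h1, h2]
    rw [show X ^ al a * g₁ * (X ^ be i * g₂) = X ^ (al a + be i) * (g₁ * g₂) by ring]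
    have := coeff_X_pow_mul (g₁ * g₂) (al a + be i) 0
    rw [zero_add] at this
    rw [this, mul_coeff_zero]
    simp [mul_comm]
  obtain ⟨g, hg, hg0⟩ := det_mul_X_pow_eq (E := gramWronskian q p c) (N := N) (r := al) (s := s)
    (t := t) (fun a j => by
      rcases j with i | k
      · obtain ⟨g, hg, hg0⟩ := hI a i
        by_cases h : ∀ a, c a i = 0
        · refine ⟨g, ?_, ?_⟩
          · simp only [gramWronskian, Matrix.of_apply, Sum.elim_inl, hs, ht, if_pos h, h a, hg]
            simp [add_assoc]
          · simp only [hN, Matrix.of_apply, Sum.elim_inl, if_pos h, hg0]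
        · have hfi : c (f i) i ≠ 0 := hf i (not_forall.1 h)
          by_cases hfa : f i = a
          · refine ⟨X ^ (al a + be i + 1) * g + C (c a i), ?_, ?_⟩
            · simp only [gramWronskian, Matrix.of_apply, Sum.elim_inl, hs, ht, if_neg h, hfa, hg]
              ring
            · simp only [hN, Matrix.of_apply, Sum.elim_inl, if_neg h]
              rw [coeff_add, mul_coeff_zero, coeff_X_pow, if_neg (by omega), zero_mul, zero_add,
                coeff_C_zero]
          · have hca : c a i = 0 := (hc (f i) i hfi).2 a (Ne.symm hfa)
            refine ⟨X ^ (be i + 1 + al (f i)) * g, ?_, ?_⟩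
            · simp only [gramWronskian, Matrix.of_apply, Sum.elim_inl, hs, ht, if_neg h, hca, hg,
                map_zero]
              ring
            · simp only [hN, Matrix.of_apply, Sum.elim_inl, if_neg h, hca]
              rw [mul_coeff_zero, coeff_X_pow, if_neg (by omega), zero_mul]
      · obtain ⟨g, hg, hg0⟩ := exists_eq_X_pow_mul (X_pow_dvd_hasseDeriv_mul (hq a).1 k)
        refine ⟨g, ?_, ?_⟩
        · simpa only [gramWronskian, Matrix.of_apply, Sum.elim_inr, hs, ht, add_zero] using hg
        · simp only [hN, Matrix.of_apply, Sum.elim_inr, hg0]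
          exact hasseDeriv_mul_X_pow_coeff _ _ _)
  refine ⟨g, ∑ i, s (Sum.inl i), ?_, fun h0 => ?_, ?_⟩
  · rw [hg0]
    intro hdet
    obtain ⟨v, hv, hNv⟩ := Matrix.exists_mulVec_eq_zero_iff.2 hdet
    apply hv
    have hrow : ∀ b, ∑ i, N b (Sum.inl i) * v (Sum.inl i) +
        ∑ k, N b (Sum.inr k) * v (Sum.inr k) = 0 := fun b => by
      have h1 := congrFun hNv b
      rwa [Matrix.mulVec, dotProduct, Fintype.sum_sum_type] at h1
    -- Isolation injects the rows carrying a constant into the columns carrying one; the bound is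
    -- obtained by passing to complements.
    have hcard : Fintype.card {i : κ // ∀ a, c a i = 0} + K ≤
        Fintype.card {b : κ ⊕ Fin K // ∀ i, c b i = 0} := by
      have h1 : Fintype.card {b : κ ⊕ Fin K // ¬ ∀ i, c b i = 0} ≤
          Fintype.card {i : κ // ¬ ∀ a, c a i = 0} := by
        have h2 : ∀ b : {b : κ ⊕ Fin K // ¬ ∀ i, c b i = 0}, ∃ i, c b i ≠ 0 :=
          fun b => not_forall.1 b.2
        choose φ hφ using h2
        refine Fintype.card_le_of_injective (fun b => ⟨φ b, fun h => hφ b (h b)⟩) ?_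
        intro b b' hbb
        have hbb' : φ b = φ b' := congrArg Subtype.val hbb
        by_contra hne
        refine hφ b' ((hc b (φ b') ?_).2 b' fun h => hne (Subtype.ext h.symm))
        rw [← hbb']
        exact hφ b
      have h3 := Fintype.card_subtype_compl (fun b : κ ⊕ Fin K => ∀ i, c b i = 0)
      have h4 := Fintype.card_subtype_compl (fun i : κ => ∀ a, c a i = 0)
      have h5 := Fintype.card_subtype_le (fun b : κ ⊕ Fin K => ∀ i, c b i = 0)
      have h6 := Fintype.card_subtype_le (fun i : κ => ∀ a, c a i = 0)
      rw [Fintype.card_sum, Fintype.card_fin] at h3 h5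
      omega
    -- The binomials `(al b).choose k` are values at `al b` of a polynomial of degree `k`, namely
    -- `descPochhammer ℂ k` divided by `k!`.
    have hP : (∑ k : Fin K, C (v (Sum.inr k) * ((k : ℕ).factorial : ℂ)⁻¹) *
        descPochhammer ℂ k).degree < (K : WithBot ℕ) := by
      refine mem_degreeLT.1 (sum_mem fun k _ => mem_degreeLT.2 ?_)
      rw [← smul_eq_C_mul]
      refine (degree_smul_le _ _).trans_lt ?_
      refine degree_le_natDegree.trans_lt ?_
      rw [descPochhammer_natDegree]
      exact_mod_cast k.2
    obtain ⟨h1, h2⟩ := cauchyVandermonde_injective (K := K) (ι := {b : κ ⊕ Fin K // ∀ i, c b i = 0})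
      (α := {i : κ // ∀ a, c a i = 0})
      (x := fun b => (al b : ℂ)) (y := fun i => -((be i : ℂ) + 1))
      (fun b b' h => Subtype.ext (hal (Nat.cast_injective h)))
      (fun i i' h => Subtype.ext (hbe (by simpa using h)))
      (fun b i h => by
        have : ((al b + be i + 1 : ℕ) : ℂ) = 0 := by push_cast; linear_combination h
        exact Nat.succ_ne_zero _ (Nat.cast_eq_zero.1 this))
      hcard (fun i => (p i).coeff (be i) * v (Sum.inl i)) _ hP (fun b => by
        have h1 := hrow b
        refine mul_left_cancel₀ (hq b).2 ?_
        refine (?_ : _ = _).trans (h1.trans (mul_zero _).symm)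
        rw [mul_add]
        congr 1
        · rw [← Fintype.sum_subtype_add_sum_subtype (fun i => ∀ a, c a i = 0)
            (fun i => N b (Sum.inl i) * v (Sum.inl i)),
            Finset.sum_eq_zero (s := Finset.univ (α := {i // ¬ ∀ a, c a i = 0})), add_zero,
            Finset.mul_sum]
          · refine Finset.sum_congr rfl fun i _ => ?_
            simp only [hN, Matrix.of_apply, Sum.elim_inl, if_pos i.2]
            push_cast
            rw [sub_neg_eq_add, ← add_assoc]
            ring
          · intro i _
            simp only [hN, Matrix.of_apply, Sum.elim_inl, if_neg i.2, b.2, zero_mul]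
        · rw [eval_finsetSum, Finset.mul_sum]
          refine Finset.sum_congr rfl fun k _ => ?_
          simp only [hN, Matrix.of_apply, Sum.elim_inr]
          rw [eval_mul, eval_C, descPochhammer_eval_eq_descFactorial,
            Nat.descFactorial_eq_factorial_mul_choose]
          have : ((k : ℕ).factorial : ℂ) ≠ 0 := by exact_mod_cast Nat.factorial_ne_zero _
          push_cast
          field_simp)
    have hvr := eq_zero_of_sum_mul_choose _ h2
    have hvl : ∀ i, (∀ a, c a i = 0) → v (Sum.inl i) = 0 := fun i hi =>
      (mul_eq_zero.1 (congrFun h1 ⟨i, hi⟩)).resolve_left (hp i).2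
    ext j
    rcases j with i | k
    · by_cases hi : ∀ a, c a i = 0
      · exact hvl i hi
      · have h3 := hrow (f i)
        have hfi : c (f i) i ≠ 0 := hf i (not_forall.1 hi)
        rw [Finset.sum_eq_single i, Finset.sum_eq_zero, add_zero] at h3
        · simp only [hN, Matrix.of_apply, Sum.elim_inl, if_neg hi] at h3
          exact (mul_eq_zero.1 h3).resolve_left hfi
        · intro k _
          rw [show v (Sum.inr k) = 0 from congrFun hvr k, mul_zero]
        · intro i' _ hi'
          by_cases hi2 : ∀ a, c a i' = 0
          · rw [hvl i' hi2, mul_zero]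
          · simp only [hN, Matrix.of_apply, Sum.elim_inl, if_neg hi2]
            rw [(hc (f i) i hfi).1 i' hi', zero_mul]
        · simp
    · exact congrFun hvr k
  · refine Finset.sum_eq_zero fun i _ => ?_
    simp [hs, h0]
  · rw [Fintype.sum_sum_type s, Fintype.sum_sum_type t] at hg
    simpa only [hs, ht, Sum.elim_inl, Sum.elim_inr, Finset.sum_const_zero, add_zero,
      Finset.sum_filter] using hg

end GramWronskian

/-! ### The zero fibre of the twist-less leading determinant -/

section ZeroFibre

variable {ι κ : Type*} [Fintype ι] [DecidableEq ι] [Fintype κ] [DecidableEq κ] {K : ℕ}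

theorem linearIndependent_of_dual_coeff {q : ι → ℂ[X]} {d : ι → ℕ}
    (hq : ∀ a b, (q a).coeff (d b) = if a = b then 1 else 0) : LinearIndependent ℂ q := by
  refine Fintype.linearIndependent_iff.2 fun g hg b => ?_
  have := congrArg (fun f : ℂ[X] => f.coeff (d b)) hg
  simpa [finsetSum_coeff, hq] using this

theorem injective_of_dual_coeff {q : ι → ℂ[X]} {d : ι → ℕ}
    (hq : ∀ a b, (q a).coeff (d b) = if a = b then 1 else 0) : Function.Injective d := by
  intro a b hab
  by_contra hne
  have h1 := hq a a
  rw [hab, hq, if_neg hne, if_pos rfl] at h1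
  exact zero_ne_one h1

/-- A nonzero term of the expansion of `det A` supplies `π`: by the gauge condition, `A (π a) a` is
the coefficient of u^(d a) in the combination with index `π a`. -/
theorem exists_perm_order_le {q : ι → ℂ[X]} {d al : ι → ℕ}
    (hq : ∀ a b, (q a).coeff (d b) = if a = b then 1 else 0) {A : Matrix ι ι ℂ} (hA : IsUnit A)
    (hal : ∀ a, HasOrder (combine A q a) (al a)) : ∃ π : Equiv.Perm ι, ∀ a, al (π a) ≤ d a := by
  have h1 : A.det ≠ 0 := ((Matrix.isUnit_iff_isUnit_det _).1 hA).ne_zero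
  rw [Matrix.det_apply'] at h1
  obtain ⟨π, -, hπ⟩ := Finset.exists_ne_zero_of_sum_ne_zero h1
  refine ⟨π, fun a => (hal (π a)).le_of_coeff_ne_zero ?_⟩
  have h2 := Finset.prod_ne_zero_iff.1 (right_ne_zero_of_mul hπ) a (Finset.mem_univ a)
  simpa [combine, finsetSum_coeff, hq] using h2

/-- As the `al b` are distinct, the order of `q a` is the least `al b` occurring in its expansion,
hence equals some `d c`. The gauge condition leaves only `c = a`. -/
theorem hasOrder_of_perm_order_eq {q : ι → ℂ[X]} {d al : ι → ℕ}
    (hq : ∀ a b, (q a).coeff (d b) = if a = b then 1 else 0) {A : Matrix ι ι ℂ} (hA : IsUnit A)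
    (hinj : Function.Injective al) (hal : ∀ a, HasOrder (combine A q a) (al a))
    {π : Equiv.Perm ι} (hπ : ∀ a, al (π a) = d a) (a : ι) : HasOrder (q a) (d a) := by
  set f := combine A q with hf
  have hqa : q a = ∑ b, A⁻¹ a b • f b := by
    have : combine (A⁻¹ * A) q = q := by
      rw [Matrix.nonsing_inv_mul _ ((Matrix.isUnit_iff_isUnit_det _).1 hA), combine_one]
    rw [combine_mul] at this
    exact (congrFun this a).symm
  have hne : ∃ b, A⁻¹ a b ≠ 0 := by
    by_contra! h
    have h1 := hq a a
    rw [hqa] at h1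
    simp [h] at h1
  obtain ⟨b, hb, hmin⟩ := Finset.exists_min_image (Finset.univ.filter fun b => A⁻¹ a b ≠ 0) al
    (by simpa [Finset.filter_nonempty_iff] using hne)
  simp only [Finset.mem_filter, Finset.mem_univ, true_and] at hb hmin
  have hord : HasOrder (q a) (al b) := by
    refine ⟨?_, ?_⟩
    · rw [hqa]
      refine Finset.dvd_sum fun c _ => ?_
      by_cases hc : A⁻¹ a c = 0
      · simp [hc]
      · rw [smul_eq_C_mul]
        exact dvd_mul_of_dvd_right ((pow_dvd_pow X (hmin c hc)).trans (hal c).1) _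
    · rw [hqa, finsetSum_coeff, Finset.sum_eq_single b]
      · rw [coeff_smul]
        exact mul_ne_zero hb (hal b).2
      · intro c _ hcb
        by_cases hc : A⁻¹ a c = 0
        · simp [hc]
        · rw [coeff_smul, X_pow_dvd_iff.1 (hal c).1 (al b)
            ((hmin c hc).lt_of_ne fun e => hcb (hinj e).symm), smul_zero]
      · simp
  have hb' : al b = d (π.symm b) := by rw [← hπ, Equiv.apply_symm_apply]
  have h2 := hord.2
  rw [hb', hq] at h2
  have h3 : a = π.symm b := by
    by_contra h
    rw [if_neg h] at h2
    exact h2 rfl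
  rwa [hb', ← h3] at hord

/-- A comparison of orders. After elimination the exact order formula must match L, while the gauge
conditions give ∑ al ≤ ∑ d and ∑ (be + 1) ≤ ∑ (e + 1). By `hL` there is no slack, so both bounds are
equalities and no column carries a constant. -/
theorem gramWronskian_zero_fibre {q : κ ⊕ Fin K → ℂ[X]} {p : κ → ℂ[X]}
    {c : Matrix (κ ⊕ Fin K) κ ℂ} {d : κ ⊕ Fin K → ℕ} {e : κ → ℕ}
    (hq : ∀ a b, (q a).coeff (d b) = if a = b then 1 else 0)
    (hp : ∀ i j, (p i).coeff (e j) = if i = j then 1 else 0) {L : ℕ}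
    (hL : L + ∑ k : Fin K, (k : ℕ) = ∑ a, d a + ∑ i, (e i + 1)) {x : ℂ}
    (h : (gramWronskian q p c).det = C x * X ^ L) :
    c = 0 ∧ (∀ a, HasOrder (q a) (d a)) ∧ ∀ i, HasOrder (p i) (e i) := by
  classical
  obtain ⟨A₁, al, hA₁, hal, hA₁q⟩ := exists_injective_orders (linearIndependent_of_dual_coeff hq)
  obtain ⟨B₁, be, hB₁, hbe, hB₁p⟩ := exists_injective_orders (linearIndependent_of_dual_coeff hp)
  -- The threshold exceeds every order, so initially no row needs to be isolated.
  obtain ⟨A₂, B₂, hA₂, hB₂, hAq, hBp, hAB⟩ := exists_isolatedRow hal hbe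
    (Finset.univ.sup al + 1) _ _ (A₁ * c * B₁.transpose) hA₁q hB₁p (fun a ha =>
      absurd (Finset.le_sup (f := al) (Finset.mem_univ a)) (by omega))
  have hA := hA₂.mul hA₁
  have hB := hB₂.mul hB₁
  simp only [← combine_mul] at hAq hBp
  have hM : A₂ * (A₁ * c * B₁.transpose) * B₂.transpose =
      (A₂ * A₁) * c * (B₂ * B₁).transpose := by
    rw [Matrix.transpose_mul]
    simp only [Matrix.mul_assoc]
  rw [hM] at hAB
  generalize A₂ * A₁ = A at hA hAq hAB
  generalize B₂ * B₁ = B at hB hBp hAB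
  obtain ⟨g, s, hg, -, hdet⟩ := det_gramWronskian_order hal hbe hAq hBp hAB
  have hAd := (Matrix.isUnit_iff_isUnit_det _).1 hA
  have hBd := (Matrix.isUnit_iff_isUnit_det _).1 hB
  set R := ∑ a, al a + ∑ i with (∀ a, (A * c * B.transpose) a i = 0), (be i + 1) with hR
  -- One side of `hdet` is a multiple of a single power of X; the other has coefficient `g(0) ≠ 0`
  -- at X^R.
  have hexp : R = L + (s + ∑ k : Fin K, (k : ℕ)) := by
    rw [det_gramWronskian_combine, h, ← mul_assoc, ← C_mul, mul_assoc, ← pow_add] at hdet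
    by_contra hne
    have h1 := congrArg (fun f : ℂ[X] => f.coeff R) hdet
    have h2 := coeff_X_pow_mul g R 0
    rw [zero_add] at h2
    simp only [coeff_C_mul, coeff_X_pow, if_neg hne, mul_zero, h2] at h1
    exact hg h1.symm
  obtain ⟨π, hπ⟩ := exists_perm_order_le hq hA hAq
  obtain ⟨τ, hτ⟩ := exists_perm_order_le hp hB hBp
  have h1 : ∑ a, al a ≤ ∑ a, d a := by
    rw [← Equiv.sum_comp π al]
    exact Finset.sum_le_sum fun a _ => hπ a
  have h2 : ∑ i, (be i + 1) ≤ ∑ i, (e i + 1) := by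
    rw [← Equiv.sum_comp τ fun i => be i + 1]
    exact Finset.sum_le_sum fun i _ => Nat.succ_le_succ (hτ i)
  have h3 := Finset.sum_filter_add_sum_filter_not Finset.univ
    (fun i => ∀ a, (A * c * B.transpose) a i = 0) (fun i => be i + 1)
  -- The columns carrying constants would contribute positive numbers `be i + 1`, for which the
  -- inequalities leave no room.
  have h4 : ∑ i with ¬ (∀ a, (A * c * B.transpose) a i = 0), (be i + 1) = 0 := by omega
  have h5 : ∑ a, al (π a) = ∑ a, d a := by
    rw [Equiv.sum_comp π al]; omega
  have h6 : ∑ i, (be (τ i) + 1) = ∑ i, (e i + 1) := by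
    rw [Equiv.sum_comp τ fun i => be i + 1]; omega
  refine ⟨?_, ?_, ?_⟩
  · have h7 : A * c * B.transpose = 0 := by
      ext a i
      by_contra hne
      have h8 := Finset.sum_eq_zero_iff.1 h4 i
        (Finset.mem_filter.2 ⟨Finset.mem_univ i, fun h => hne (h a)⟩)
      omega
    have h8 : A⁻¹ * (A * c * B.transpose) * (B.transpose)⁻¹ = c := by
      rw [Matrix.mul_assoc A, Matrix.nonsing_inv_mul_cancel_left _ _ hAd,
        Matrix.mul_nonsing_inv_cancel_right _ _ (by rwa [Matrix.det_transpose])]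
    rw [← h8, h7, Matrix.mul_zero, Matrix.zero_mul]
  · exact hasOrder_of_perm_order_eq hq hA hal hAq fun a =>
      (Finset.sum_eq_sum_iff_of_le fun a _ => hπ a).1 h5 a (Finset.mem_univ a)
  · exact hasOrder_of_perm_order_eq hp hB hbe hBp fun i => Nat.succ_injective
      ((Finset.sum_eq_sum_iff_of_le fun i _ => Nat.succ_le_succ (hτ i)).1 h6 i (Finset.mem_univ i))

end ZeroFibre

/-! ### The leading part of the twist-less Wronskian -/

section LeadingPart

variable {σ : Type*} {w : σ → ℕ} {K : ℕ}

theorem hasseDeriv_X_pow (k t : ℕ) : hasseDeriv k (X ^ t : (MvPolynomial σ ℂ)[X]) =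
    (t.choose k : ℂ) • X ^ (t - k) := by
  rw [X_pow_eq_monomial, hasseDeriv_monomial, mul_one, X_pow_eq_monomial, smul_monomial]
  congr 1
  rw [Algebra.smul_def, map_natCast, mul_one]

theorem hasseDeriv_mem_weightEq (k : ℕ) {N : ℤ} {f : (MvPolynomial σ ℂ)[X]}
    (hf : f ∈ weightEq w N) : hasseDeriv k f ∈ weightEq w (N - k) := by
  refine linearMap_mem_weightEq (A := hasseDeriv k) (δ := -k) (fun t => ?_) hf
  rw [hasseDeriv_X_pow]
  rcases lt_or_ge t k with h | h
  · rw [Nat.choose_eq_zero_of_lt h, Nat.cast_zero, zero_smul]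
    exact zero_mem _
  · refine Submodule.smul_mem _ _ ?_
    have := X_pow_mem_weightEq (w := w) (t - k)
    rwa [Nat.cast_sub h] at this

theorem X_add_C_pow_eq (h : ℂ) (t : ℕ) :
    ((X + C (algebraMap ℂ (MvPolynomial σ ℂ) h)) ^ t : (MvPolynomial σ ℂ)[X]) =
      ∑ l ∈ Finset.range (t + 1), (h ^ l * (t.choose l : ℂ)) • X ^ (t - l) := by
  rw [add_comm, add_pow]
  refine Finset.sum_congr rfl fun l _ => ?_
  rw [← algebraMap_smul (MvPolynomial σ ℂ) (h ^ l * (t.choose l : ℂ)), smul_eq_C_mul, map_mul,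
    map_pow, map_mul, map_pow, map_natCast, map_natCast]
  ring

/-- A shift by `h` is the sum of `h ^ l` times the `l`-th divided derivative. The inverse
Vandermonde matrix isolates `l = k` among `l < K`, and terms with `l ≥ K > k` have lower weight. -/
theorem sum_taylor_sub_hasseDeriv_mem {h : Fin K → ℂ} {U : Matrix (Fin K) (Fin K) ℂ}
    (hU : U * Matrix.vandermonde h = 1) (k : Fin K) {N : ℤ} {f : (MvPolynomial σ ℂ)[X]}
    (hf : f ∈ weightLE w N) :
    ∑ j, U k j • taylor (algebraMap ℂ (MvPolynomial σ ℂ) (h j)) f - hasseDeriv k f ∈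
      weightLE w (N - k - 1) := by
  have key := linearMap_mem_weightLE (w := w) (δ := -k - 1)
    (A := ∑ j, algebraMap ℂ (MvPolynomial σ ℂ) (U k j) •
      taylor (algebraMap ℂ (MvPolynomial σ ℂ) (h j)) - hasseDeriv (k : ℕ)) (fun t => ?_) hf
  · simp only [LinearMap.sub_apply, LinearMap.sum_apply, LinearMap.smul_apply,
      algebraMap_smul] at key
    rwa [show N + (-(k : ℤ) - 1) = N - k - 1 by ring] at key
  · simp only [LinearMap.sub_apply, LinearMap.sum_apply, LinearMap.smul_apply, algebraMap_smul,
      taylor_X_pow, X_add_C_pow_eq, hasseDeriv_X_pow, Finset.smul_sum, smul_smul]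
    rw [Finset.sum_comm]
    have h1 : ((t.choose k : ℂ) • X ^ (t - k) : (MvPolynomial σ ℂ)[X]) =
        ∑ l ∈ Finset.range (t + 1), (if (k : ℕ) = l then (t.choose l : ℂ) else 0) • X ^ (t - l) := by
      simp only [ite_smul, zero_smul, Finset.sum_ite_eq, Finset.mem_range]
      split_ifs with h
      · rfl
      · rw [Nat.choose_eq_zero_of_lt (by omega), Nat.cast_zero, zero_smul]
    rw [h1, ← Finset.sum_sub_distrib]
    refine sum_mem fun l hl => ?_
    rw [← Finset.sum_smul, ← sub_smul]
    rcases lt_or_ge l K with hlK | hlK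
    · have h2 := congrFun (congrFun hU k) ⟨l, hlK⟩
      rw [Matrix.mul_apply] at h2
      simp only [Matrix.vandermonde_apply, Matrix.one_apply] at h2
      simp only [← mul_assoc]
      rw [← Finset.sum_mul, h2]
      have h3 : (k = ⟨l, hlK⟩) ↔ (k : ℕ) = l := Fin.ext_iff
      simp only [h3, ite_mul, one_mul, zero_mul, sub_self, zero_smul]
      exact zero_mem _
    · refine Submodule.smul_mem _ _ (weightLE_mono ?_ (X_pow_mem_weightLE (t - l)))
      have := k.2
      have := Finset.mem_range.1 hl
      omega

theorem qshift_zero_eq (ħ : ℂ) (k : ℤ) (f : (MvPolynomial σ ℂ)[X]) :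
    qshift ħ 0 k f = taylor (algebraMap ℂ (MvPolynomial σ ℂ) (ħ * k / 2)) f := by
  simp [qshift]

/-- Multiplication on the right by a constant invertible matrix `W` rescales the mixed columns by
`ħ` and recombines the shifted columns into divided derivatives. Leading parts of the entries then
form the `gramWronskian`, and `μ` is the inverse of `det W`. -/
theorem wronskianDet_twistless {ħ : ℂ} (hħ : ħ ≠ 0) {n : ℕ}
    {q : Fin (n + K) → (MvPolynomial σ ℂ)[X]} {p : Fin n → (MvPolynomial σ ℂ)[X]}
    {c : Fin (n + K) → Fin n → MvPolynomial σ ℂ}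
    {d : Fin (n + K) → ℕ} {e : Fin n → ℕ} (hq : ∀ a, q a ∈ weightEq w (d a))
    (hp : ∀ i, p i ∈ weightEq w (e i)) (hc : ∀ a i, C (c a i) ∈ weightEq w (d a + e i + 1))
    {L : ℕ} (hL : L + ∑ k : Fin K, (k : ℕ) = ∑ a, d a + ∑ i, (e i + 1)) :
    ∃ μ : ℂ, μ ≠ 0 ∧
      μ • (gramWronskian (fun a => q (finSumFinEquiv a)) p
        (fun a i => c (finSumFinEquiv a) i)).det ∈ weightEq w L ∧
      wronskianDet ħ (n + K) n (fun _ => 0) (fun _ => 0) q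
        (fun a i => twistlessSolution ħ (q a * p i) + ħ⁻¹ • C (c a i)) -
        μ • (gramWronskian (fun a => q (finSumFinEquiv a)) p
          (fun a i => c (finSumFinEquiv a) i)).det ∈ weightLE w (L - 1) := by
  set h : Fin K → ℂ := fun j => ħ * ((K : ℂ) - 1 - 2 * (j : ℕ)) / 2 with hh
  have hinj : Function.Injective h := by
    intro i j hij
    simp only [hh] at hij
    have h1 : ((i : ℕ) : ℂ) = (j : ℕ) := by
      have h2 : ħ * (((i : ℕ) : ℂ) - (j : ℕ)) = 0 := by linear_combination -hij
      exact sub_eq_zero.1 ((mul_eq_zero.1 h2).resolve_left hħ)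
    exact Fin.ext (Nat.cast_injective h1)
  have hV : IsUnit (Matrix.vandermonde h).det :=
    isUnit_iff_ne_zero.2 (Matrix.det_vandermonde_ne_zero_iff.2 hinj)
  set U := (Matrix.vandermonde h)⁻¹ with hU
  have hUV : U * Matrix.vandermonde h = 1 := Matrix.nonsing_inv_mul _ hV
  have hUd : U.det ≠ 0 := by
    intro h0
    have := congrArg Matrix.det hUV
    rw [Matrix.det_mul, h0, zero_mul, Matrix.det_one] at this
    exact zero_ne_one this
  set W : Matrix (Fin n ⊕ Fin K) (Fin n ⊕ Fin K) ℂ :=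
    Matrix.fromBlocks (Matrix.diagonal fun _ => ħ) 0 0 U.transpose with hW
  have hWd : W.det ≠ 0 := by
    rw [hW, Matrix.det_fromBlocks_zero₂₁, Matrix.det_transpose, Matrix.det_diagonal]
    exact mul_ne_zero (Finset.prod_ne_zero_iff.2 fun _ _ => hħ) hUd
  set F : Fin (n + K) → Fin n → (MvPolynomial σ ℂ)[X] :=
    fun a i => twistlessSolution ħ (q a * p i) + ħ⁻¹ • C (c a i) with hF
  set E : Matrix (Fin n ⊕ Fin K) (Fin n ⊕ Fin K) (MvPolynomial σ ℂ)[X] :=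
    Matrix.of fun a => Sum.elim (fun i => qshift ħ 0 K (F (finSumFinEquiv a) i))
      (fun k => qshift ħ 0 ((K : ℤ) - 1 - 2 * (k : ℕ)) (q (finSumFinEquiv a))) with hE
  have hwd : wronskianDet ħ (n + K) n (fun _ => 0) (fun _ => 0) q F = E.det := by
    rw [wronskianDet, ← Matrix.det_submatrix_equiv_self finSumFinEquiv]
    congr 1
    ext1 a j
    rcases j with i | k
    · simp only [Matrix.submatrix_apply, Matrix.of_apply, finSumFinEquiv_apply_left, hE,
        Sum.elim_inl, Fin.val_castAdd, Fin.is_lt, dif_pos, Fin.eta, add_zero]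
      push_cast
      rw [add_sub_cancel_left]
    · simp only [Matrix.submatrix_apply, Matrix.of_apply, finSumFinEquiv_apply_right, hE,
        Sum.elim_inr, Fin.val_natAdd]
      rw [dif_neg (by omega)]
      push_cast
      rw [add_sub_cancel_left, add_sub_cancel_left]
  set G := gramWronskian (fun a => q (finSumFinEquiv a)) p
        (fun a i => c (finSumFinEquiv a) i) with hG
  set r : Fin n ⊕ Fin K → ℤ := fun a => d (finSumFinEquiv a) with hr
  set s : Fin n ⊕ Fin K → ℤ := Sum.elim (fun i => (e i : ℤ) + 1) (fun k => -(k : ℕ)) with hs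
  have hsum : ∑ a, r a + ∑ j, s j = L := by
    have h1 : (L : ℤ) + ∑ k : Fin K, ((k : ℕ) : ℤ) = ∑ a, (d a : ℤ) + ∑ i, ((e i : ℤ) + 1) := by
      exact_mod_cast hL
    rw [Fintype.sum_sum_type s, hr, Equiv.sum_comp finSumFinEquiv fun a => (d a : ℤ)]
    simp only [hs, Sum.elim_inl, Sum.elim_inr, Finset.sum_neg_distrib]
    linarith
  have hI : ∀ a i, q a * p i ∈ weightEq w (d a + e i) := fun a i => weightEq_mul (hq a) (hp i)
  have hGE := det_sub_det_mem (E := E * (algebraMap ℂ (MvPolynomial σ ℂ)[X]).mapMatrix W) (T := G)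
    (r := r) (s := s) (w := w) (fun a j => by
      rcases j with i | k
      · simp only [hG, gramWronskian, Matrix.of_apply, Sum.elim_inl, hr, hs, ← add_assoc]
        exact add_mem (antideriv_mem_weightEq (hI _ i)) (hc _ i)
      · simp only [hG, gramWronskian, Matrix.of_apply, Sum.elim_inr, hr, hs]
        exact hasseDeriv_mem_weightEq k (hq _)) (fun a j => by
      rw [Matrix.mul_apply, Fintype.sum_sum_type]
      rcases j with i | k
      · have e1 : ∑ x, E a (Sum.inl x) *
            (algebraMap ℂ (MvPolynomial σ ℂ)[X]).mapMatrix W (Sum.inl x) (Sum.inl i) +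
            ∑ x, E a (Sum.inr x) *
            (algebraMap ℂ (MvPolynomial σ ℂ)[X]).mapMatrix W (Sum.inr x) (Sum.inl i) =
            ħ • E a (Sum.inl i) := by
          simp [hW, Matrix.diagonal_apply, apply_ite, Algebra.smul_def, mul_comm]
        rw [e1]
        simp only [hG, gramWronskian, hE, Matrix.of_apply, Sum.elim_inl, hr, hs, ← add_assoc,
          add_sub_cancel_right]
        have h1 := weightEq_le_weightLE le_rfl (hI (finSumFinEquiv a) i)
        have h2 := twistlessSolution_sub_mem ħ hħ h1
        have h3 : ħ⁻¹ • antideriv (q (finSumFinEquiv a) * p i) +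
            ħ⁻¹ • C (c (finSumFinEquiv a) i) ∈ weightLE w (d (finSumFinEquiv a) + e i + 1) :=
          weightEq_le_weightLE le_rfl (add_mem (Submodule.smul_mem _ _
            (antideriv_mem_weightEq (hI _ i))) (Submodule.smul_mem _ _ (hc _ i)))
        have h4 : F (finSumFinEquiv a) i ∈ weightLE w (d (finSumFinEquiv a) + e i + 1) := by
          have := add_mem (weightLE_mono (by omega) h2) h3
          rwa [← add_assoc, sub_add_cancel] at this
        have h5 := qshift_sub_mem ħ 0 K h4
        rw [zero_mul, zero_div, Complex.exp_zero, one_smul, add_sub_cancel_right] at h5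
        have h6 := Submodule.smul_mem _ ħ (add_mem h5 h2)
        have h7 : ∀ D : (MvPolynomial σ ℂ)[X], ħ • ħ⁻¹ • D = D := fun D => by
          rw [smul_smul, mul_inv_cancel₀ hħ, one_smul]
        convert h6 using 1
        simp only [hF, smul_add, smul_sub, h7]
        ring
      · have e1 : ∑ x, E a (Sum.inl x) *
            (algebraMap ℂ (MvPolynomial σ ℂ)[X]).mapMatrix W (Sum.inl x) (Sum.inr k) +
            ∑ x, E a (Sum.inr x) *
            (algebraMap ℂ (MvPolynomial σ ℂ)[X]).mapMatrix W (Sum.inr x) (Sum.inr k) =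
            ∑ x, U k x • E a (Sum.inr x) := by
          simp [hW, Algebra.smul_def, mul_comm]
        rw [e1]
        have h1 := sum_taylor_sub_hasseDeriv_mem hUV k (weightEq_le_weightLE (w := w) le_rfl
          (hq (finSumFinEquiv a)))
        simp only [hG, gramWronskian, hE, Matrix.of_apply, Sum.elim_inr, hr, hs, qshift_zero_eq,
          ← sub_eq_add_neg]
        convert h1 using 1
        simp only [hh]
        push_cast
        rfl)
  rw [Matrix.det_mul, ← RingHom.map_det, hsum, mul_comm, ← Algebra.smul_def] at hGE
  refine ⟨W.det⁻¹, inv_ne_zero hWd, Submodule.smul_mem _ _ hGE.1, ?_⟩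
  have h1 := Submodule.smul_mem _ W.det⁻¹ hGE.2
  rwa [smul_sub, smul_smul, inv_mul_cancel₀ hWd, one_smul, ← hwd] at h1

theorem map_gramWronskian {κ : Type*} [Fintype κ] [DecidableEq κ] (x : σ → ℂ)
    (q : κ ⊕ Fin K → (MvPolynomial σ ℂ)[X]) (p : κ → (MvPolynomial σ ℂ)[X])
    (c : κ ⊕ Fin K → κ → MvPolynomial σ ℂ) :
    (gramWronskian q p c).det.map (MvPolynomial.eval x) =
      (gramWronskian (fun a => (q a).map (MvPolynomial.eval x))
        (fun i => (p i).map (MvPolynomial.eval x)) fun a i => MvPolynomial.eval x (c a i)).det := by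
  have h1 : ∀ f : (MvPolynomial σ ℂ)[X], (antideriv f).map (MvPolynomial.eval x) =
      antideriv (f.map (MvPolynomial.eval x)) := by
    intro f
    ext t
    rcases t with _ | t
    · rw [coeff_map, antideriv_coeff_zero, antideriv_coeff_zero, map_zero]
    · rw [coeff_map, antideriv_coeff_succ, antideriv_coeff_succ, map_mul, coeff_map,
        MvPolynomial.algebraMap_eq, MvPolynomial.eval_C]
      rfl
  have h2 : ∀ (k : ℕ) (f : (MvPolynomial σ ℂ)[X]), (hasseDeriv k f).map (MvPolynomial.eval x) =
      hasseDeriv k (f.map (MvPolynomial.eval x)) := by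
    intro k f
    ext t
    rw [coeff_map, hasseDeriv_coeff, hasseDeriv_coeff, map_mul, coeff_map, map_natCast]
  rw [← coe_mapRingHom, RingHom.map_det]
  congr 1
  ext1 a j
  rcases j with i | k
  · simp [gramWronskian, h1]
  · simp [gramWronskian, h2]

/-- Stated for abstract families rather than the concrete Q-functions, so that it can be used again
with the two families exchanged when `m < n`. -/
theorem isFreeOfConstantRank_of_gauge [Fintype σ] (hw : ∀ v, 0 < w v) {L : ℕ}
    (hcard : Fintype.card σ = L) {ħ : ℂ} (hħ : ħ ≠ 0) {n : ℕ}
    {q : Fin (n + K) → (MvPolynomial σ ℂ)[X]} {p : Fin n → (MvPolynomial σ ℂ)[X]}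
    {c : Fin (n + K) → Fin n → MvPolynomial σ ℂ}
    {d : Fin (n + K) → ℕ} {e : Fin n → ℕ} (hq : ∀ a, q a ∈ weightEq w (d a))
    (hp : ∀ i, p i ∈ weightEq w (e i)) (hc : ∀ a i, C (c a i) ∈ weightEq w (d a + e i + 1))
    (hL : L + ∑ k : Fin K, (k : ℕ) = ∑ a, d a + ∑ i, (e i + 1))
    (hqd : ∀ x a b, ((q a).map (MvPolynomial.eval x)).coeff (d b) = if a = b then 1 else 0)
    (hpe : ∀ x i j, ((p i).map (MvPolynomial.eval x)).coeff (e j) = if i = j then 1 else 0)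
    (hq0 : ∀ a, HasOrder ((q a).map (MvPolynomial.eval 0)) (d a))
    (hp0 : ∀ i, HasOrder ((p i).map (MvPolynomial.eval 0)) (e i))
    (hc0 : ∀ a i, MvPolynomial.eval 0 (c a i) = 0)
    (hx : ∀ x : σ → ℂ, (∀ a, HasOrder ((q a).map (MvPolynomial.eval x)) (d a)) →
      (∀ i, HasOrder ((p i).map (MvPolynomial.eval x)) (e i)) →
      (∀ a i, MvPolynomial.eval x (c a i) = 0) → x = 0) :
    IsFreeOfConstantRank (signedCoeffs L (normalise L
      (wronskianDet ħ (n + K) n (fun _ => 0) (fun _ => 0) q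
        (fun a i => twistlessSolution ħ (q a * p i) + ħ⁻¹ • C (c a i))))) := by
  obtain ⟨μ, hμ, hT, hD⟩ := wronskianDet_twistless hħ hq hp hc hL
  set f : Fin n ⊕ Fin K ≃ Fin (n + K) := finSumFinEquiv with hf
  have hL' : L + ∑ k : Fin K, (k : ℕ) = ∑ a, d (f a) + ∑ i, (e i + 1) := by
    rwa [Equiv.sum_comp f d]
  have hqd' : ∀ x a b, ((q (f a)).map (MvPolynomial.eval x)).coeff (d (f b)) =
      if a = b then 1 else 0 := fun x a b => by
    rw [hqd]
    simp only [f.injective.eq_iff]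
  have hmap : ∀ x : σ → ℂ, (μ • (gramWronskian (fun a => q (f a)) p
      (fun a i => c (f a) i)).det).map (MvPolynomial.eval x) =
      C μ * (gramWronskian (fun a => (q (f a)).map (MvPolynomial.eval x))
        (fun i => (p i).map (MvPolynomial.eval x))
        fun a i => MvPolynomial.eval x (c (f a) i)).det := by
    intro x
    rw [Algebra.smul_def, Polynomial.map_mul, map_gramWronskian,
      IsScalarTower.algebraMap_apply ℂ (MvPolynomial σ ℂ), algebraMap_eq,
        map_C, MvPolynomial.algebraMap_eq, MvPolynomial.eval_C]
  -- At `c = 0` the orders are exactly `d` and `e` and no constants are present, so the order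
  -- formula gives a nonzero coefficient at u^L.
  have hne : MvPolynomial.constantCoeff ((μ • (gramWronskian (fun a => q (f a)) p
      (fun a i => c (f a) i)).det).coeff L) ≠ 0 := by
    rw [← MvPolynomial.eval_zero, ← coeff_map, hmap, coeff_C_mul]
    refine mul_ne_zero hμ ?_
    obtain ⟨g, s, hg, hs, hdet⟩ := det_gramWronskian_order
      (q := fun a => (q (f a)).map (MvPolynomial.eval 0))
      (p := fun i => (p i).map (MvPolynomial.eval 0))
      (c := fun a i => MvPolynomial.eval 0 (c (f a) i))
      (injective_of_dual_coeff (hqd' 0)) (injective_of_dual_coeff (hpe 0))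
      (fun a => hq0 (f a)) hp0 (fun a i hi => absurd (hc0 _ _) hi)
    have hs0 : s = 0 := hs (Matrix.ext fun a i => hc0 _ _)
    have hf0 : (Finset.univ.filter fun i : Fin n =>
        ∀ a, MvPolynomial.eval 0 (c (f a) i) = 0) = Finset.univ :=
      Finset.filter_true_of_mem fun i _ a => hc0 _ _
    rw [hs0, zero_add, hf0, ← hL'] at hdet
    have h1 := congrArg (fun P : ℂ[X] => P.coeff (L + ∑ k : Fin K, (k : ℕ))) hdet
    have h2 := coeff_X_pow_mul g (L + ∑ k : Fin K, (k : ℕ)) 0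
    rw [zero_add] at h2
    simp only [coeff_mul_X_pow, h2] at h1
    rwa [h1]
  refine isFreeOfConstantRank_of_leading_part hw hcard hT hD hne fun x hxT => ?_
  rw [hmap] at hxT
  obtain ⟨h1, h2, h3⟩ := gramWronskian_zero_fibre (hqd' x) (hpe x) hL'
    (mul_left_cancel₀ (C_ne_zero.2 hμ) (hxT.trans (by
      rw [← mul_assoc, ← C_mul, mul_div_cancel₀ _ hμ])))
  refine hx x (fun a => ?_) h3 fun a i => ?_
  · simpa using h2 (f.symm a)
  · have := congrFun (congrFun h1 (f.symm a)) i
    simpa using this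

end LeadingPart

/-! ### The twist-less case for given degrees -/

section Twistless

theorem gauged_coeff_degree {m : ℕ} {d : Fin m → ℕ} (hd : Function.Injective d)
    (a b : Fin m) (y : {k : Fin (d a) // ∀ b, d b ≠ k} → ℂ) :
    (X ^ d a + ∑ k, C (y k) * X ^ (k.1 : ℕ) : ℂ[X]).coeff (d b) = if a = b then 1 else 0 := by
  rw [coeff_add, finsetSum_coeff, Finset.sum_eq_zero, add_zero, coeff_X_pow]
  · simp only [hd.eq_iff, eq_comm]
  · intro k _
    rw [coeff_C_mul, coeff_X_pow, if_neg (k.2 b), mul_zero]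

theorem gauged_coeff {m : ℕ} {d : Fin m → ℕ} (a : Fin m)
    (y : {k : Fin (d a) // ∀ b, d b ≠ k} → ℂ) (k : {k : Fin (d a) // ∀ b, d b ≠ k}) :
    (X ^ d a + ∑ k, C (y k) * X ^ (k.1 : ℕ) : ℂ[X]).coeff (k.1 : ℕ) = y k := by
  rw [coeff_add, coeff_X_pow, if_neg k.1.2.ne, zero_add, finsetSum_coeff, Finset.sum_eq_single k]
  · simp
  · intro l _ hl
    rw [coeff_C_mul, coeff_X_pow, if_neg, mul_zero]
    exact fun h => hl (Subtype.ext (Fin.ext h.symm))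
  · simp

theorem hasOrder_X_pow (k : ℕ) : HasOrder (X ^ k) k := ⟨dvd_rfl, by simp⟩

variable {m n : ℕ} (d : Fin m → ℕ) (e : Fin n → ℕ)

/-- The weights for which the Q-functions of the twist-less case are homogeneous up to terms of
lower weight. -/
def twistlessWeight : TwistlessVar d e → ℕ :=
  Sum.elim (fun v => d v.1 - v.2.1)
    (Sum.elim (fun v => e v.1 - v.2.1) (fun v => d v.1 + e v.2 + 1))

theorem twistlessWeight_pos (v) : 0 < twistlessWeight d e v := by
  rcases v with ⟨a, k⟩ | ⟨i, k⟩ | v <;> simp [twistlessWeight]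

theorem twistlessBoson_mem (a) : twistlessBoson d e a ∈ weightEq (twistlessWeight d e) (d a) := by
  refine add_mem (X_pow_mem_weightEq _) (sum_mem fun k _ => C_X_mul_X_pow_mem_weightEq ?_)
  have := k.1.2
  simp only [twistlessWeight, Sum.elim_inl]
  omega

theorem twistlessFermion_mem (i) :
    twistlessFermion d e i ∈ weightEq (twistlessWeight d e) (e i) := by
  refine add_mem (X_pow_mem_weightEq _) (sum_mem fun k _ => C_X_mul_X_pow_mem_weightEq ?_)
  have := k.1.2
  simp only [twistlessWeight, Sum.elim_inl, Sum.elim_inr]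
  omega

theorem map_twistlessBoson (x : TwistlessVar d e → ℂ) (a) :
    (twistlessBoson d e a).map (MvPolynomial.eval x) =
      X ^ d a + ∑ k : {k : Fin (d a) // ∀ b, d b ≠ k}, C (x (Sum.inl ⟨a, k⟩)) * X ^ (k.1 : ℕ) := by
  simp [twistlessBoson, Polynomial.map_sum]

theorem map_twistlessFermion (x : TwistlessVar d e → ℂ) (i) :
    (twistlessFermion d e i).map (MvPolynomial.eval x) =
      X ^ e i + ∑ k : {k : Fin (e i) // ∀ j, e j ≠ k},
        C (x (Sum.inr (Sum.inl ⟨i, k⟩))) * X ^ (k.1 : ℕ) := by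
  simp [twistlessFermion, Polynomial.map_sum]

/-- The rescaled integration constant of `Q_{a|i}`. -/
def mixedConst (a : Fin m) (i : Fin n) : MvPolynomial (TwistlessVar d e) ℂ :=
  MvPolynomial.C ((d a : ℂ) + e i + 1)⁻¹ * MvPolynomial.X (Sum.inr (Sum.inr (a, i)))

theorem C_mixedConst_mem (a i) :
    C (mixedConst d e a i) ∈ weightEq (twistlessWeight d e) (d a + e i + 1) := by
  have := weightEq_mul (C_C_mem_weightEq (w := twistlessWeight d e) ((d a : ℂ) + e i + 1)⁻¹)
    (C_X_mem_weightEq (Sum.inr (Sum.inr (a, i))))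
  rw [← C_mul, zero_add] at this
  exact this

theorem eval_mixedConst (x : TwistlessVar d e → ℂ) (a i) :
    MvPolynomial.eval x (mixedConst d e a i) =
      ((d a : ℂ) + e i + 1)⁻¹ * x (Sum.inr (Sum.inr (a, i))) := by
  simp [mixedConst]

theorem twistlessMixed_eq (ħ : ℂ) (a i) : twistlessMixed ħ d e a i =
    twistlessSolution ħ (twistlessBoson d e a * twistlessFermion d e i) +
      ħ⁻¹ • C (mixedConst d e a i) := by
  rw [twistlessMixed, mixedConst, smul_C, mul_inv, MvPolynomial.C_mul, MvPolynomial.smul_eq_C_mul,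
    mul_assoc]

theorem eq_zero_of_hasOrder (x : TwistlessVar d e → ℂ)
    (hq : ∀ a, HasOrder ((twistlessBoson d e a).map (MvPolynomial.eval x)) (d a))
    (hp : ∀ i, HasOrder ((twistlessFermion d e i).map (MvPolynomial.eval x)) (e i))
    (hc : ∀ a i, MvPolynomial.eval x (mixedConst d e a i) = 0) : x = 0 := by
  ext v
  rcases v with ⟨a, k⟩ | ⟨i, k⟩ | ⟨a, i⟩
  · have h1 := X_pow_dvd_iff.1 (hq a).1 k.1 k.1.2
    rwa [map_twistlessBoson, gauged_coeff a (fun k => x (Sum.inl ⟨a, k⟩))] at h1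
  · have h1 := X_pow_dvd_iff.1 (hp i).1 k.1 k.1.2
    rwa [map_twistlessFermion, gauged_coeff i (fun k => x (Sum.inr (Sum.inl ⟨i, k⟩)))] at h1
  · have h1 := hc a i
    rw [eval_mixedConst] at h1
    refine (mul_eq_zero.1 h1).resolve_left (inv_ne_zero ?_)
    have : ((d a + e i + 1 : ℕ) : ℂ) ≠ 0 := Nat.cast_ne_zero.2 (Nat.succ_ne_zero _)
    exact_mod_cast this

/-- The hypotheses `h₁` and `h₂` say that the leading determinant has weight `L`, for the two
possible shapes of the Wronskian. -/
theorem twistless_isFreeOfConstantRank {ħ : ℂ} (hħ : ħ ≠ 0) (hd : Function.Injective d)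
    (he : Function.Injective e) {L : ℕ} (hcard : Fintype.card (TwistlessVar d e) = L)
    (h₁ : ∀ K, m = n + K → L + ∑ k : Fin K, (k : ℕ) = ∑ a, d a + ∑ i, (e i + 1))
    (h₂ : ∀ K, n = m + K → L + ∑ k : Fin K, (k : ℕ) = ∑ i, e i + ∑ a, (d a + 1)) :
    IsFreeOfConstantRank (signedCoeffs L (twistlessSWPoly ħ L d e)) := by
  have hw := twistlessWeight_pos d e
  have hq := twistlessBoson_mem d e
  have hp := twistlessFermion_mem d e
  have hc := C_mixedConst_mem d e
  have hqd : ∀ x a b, ((twistlessBoson d e a).map (MvPolynomial.eval x)).coeff (d b) =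
      if a = b then 1 else 0 := fun x a b => by
    rw [map_twistlessBoson, gauged_coeff_degree hd]
  have hpe : ∀ x i j, ((twistlessFermion d e i).map (MvPolynomial.eval x)).coeff (e j) =
      if i = j then 1 else 0 := fun x i j => by
    rw [map_twistlessFermion, gauged_coeff_degree he]
  have hq0 : ∀ a, HasOrder ((twistlessBoson d e a).map (MvPolynomial.eval 0)) (d a) := fun a => by
    rw [map_twistlessBoson]
    simpa using hasOrder_X_pow (d a)
  have hp0 : ∀ i, HasOrder ((twistlessFermion d e i).map (MvPolynomial.eval 0)) (e i) :=
    fun i => by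
      rw [map_twistlessFermion]
      simpa using hasOrder_X_pow (e i)
  have hc0 : ∀ a i, MvPolynomial.eval 0 (mixedConst d e a i) = 0 := fun a i => by
    rw [eval_mixedConst, Pi.zero_apply, mul_zero]
  have hx := eq_zero_of_hasOrder d e
  have hmix : twistlessMixed ħ d e = fun a i =>
      twistlessSolution ħ (twistlessBoson d e a * twistlessFermion d e i) +
      ħ⁻¹ • C (mixedConst d e a i) := by
    ext1 a; ext1 i; exact twistlessMixed_eq d e ħ a i
  rw [twistlessSWPoly, hmix]
  by_cases hmn : n ≤ m
  · simp only [superWronskian, if_pos hmn]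
    obtain ⟨K, rfl⟩ := Nat.exists_eq_add_of_le hmn
    exact isFreeOfConstantRank_of_gauge hw hcard hħ hq hp hc (h₁ K rfl) hqd hpe hq0 hp0 hc0 hx
  · simp only [superWronskian, if_neg hmn, mul_comm (twistlessBoson d e _)]
    obtain ⟨K, rfl⟩ := Nat.exists_eq_add_of_le (le_of_not_ge hmn)
    exact isFreeOfConstantRank_of_gauge (c := fun i a => mixedConst d e a i) hw hcard hħ hp hq
      (fun i a => by rw [add_comm (e i : ℤ)]; exact hc a i) (h₂ K rfl) hpe hqd hp0 hq0
      (fun i a => hc0 a i) (fun x h1 h2 h3 => hx x h2 h1 fun a i => h3 i a)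

end Twistless

/-! ### Young diagrams: the reduced rectangle and the count of variables -/

section Young

variable {Y : YoungDiagram} {m n : ℕ}

theorem hookDefect_mem (Y : YoungDiagram) (m n : ℕ) :
    m ≤ hookDefect Y m n ∨
      n ≤ Y.rowLen (m - hookDefect Y m n - 1) + hookDefect Y m n :=
  Nat.sInf_mem (s := {k : ℕ | m ≤ k ∨ n ≤ Y.rowLen (m - k - 1) + k}) ⟨m, Or.inl le_rfl⟩

/-- The inequality defining r says that the last row of the reduced rectangle has at least n − r
boxes. -/
theorem mem_of_lt_sub_hookDefect {a i : ℕ} (ha : a < m - hookDefect Y m n)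
    (hi : i < n - hookDefect Y m n) : (a, i) ∈ Y := by
  rcases hookDefect_mem Y m n with h | h
  · omega
  · refine YoungDiagram.mem_iff_lt_rowLen.2 (lt_of_lt_of_le ?_
      (Y.rowLen_anti a (m - hookDefect Y m n - 1) (by omega)))
    omega

/-- For r > 0 this is the failure of the defining inequality at r − 1; for r = 0 it is the hook
condition. Indices start at 0, so the cell is the one diagonally beyond the corner of the rectangle.
-/
theorem sub_hookDefect_notMem (hY : Y.rowLen m ≤ n) :
    (m - hookDefect Y m n, n - hookDefect Y m n) ∉ Y := by
  rw [YoungDiagram.mem_iff_lt_rowLen, not_lt]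
  rcases Nat.eq_zero_or_pos (hookDefect Y m n) with h | h
  · rwa [h]
  · have h1 : hookDefect Y m n - 1 ∉ {k : ℕ | m ≤ k ∨ n ≤ Y.rowLen (m - k - 1) + k} :=
      Nat.notMem_of_lt_sInf (Nat.sub_lt h one_pos)
    simp only [Set.mem_ofPred_eq, not_or, not_le] at h1
    rw [show m - (hookDefect Y m n - 1) - 1 = m - hookDefect Y m n by omega] at h1
    omega

theorem sum_fin_mul_two (k : ℕ) : (∑ i : Fin k, ((i : ℕ) : ℤ)) * 2 = k * (k - 1) := by
  induction k with
  | zero => simp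
  | succ k ih =>
    rw [Fin.sum_univ_castSucc, add_mul]
    simp only [Fin.val_castSucc, Fin.val_last]
    rw [ih]
    push_cast
    ring

theorem le_rowLen_of_rectangle (h : ∀ a < m, ∀ i < n, (a, i) ∈ Y) {a : ℕ} (ha : a < m) :
    n ≤ Y.rowLen a := by
  rcases Nat.eq_zero_or_pos n with h0 | h0
  · omega
  · have := YoungDiagram.mem_iff_lt_rowLen.1 (h a ha (n - 1) (by omega))
    omega

theorem le_colLen_of_rectangle (h : ∀ a < m, ∀ i < n, (a, i) ∈ Y) {i : ℕ} (hi : i < n) :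
    m ≤ Y.colLen i := by
  rcases Nat.eq_zero_or_pos m with h0 | h0
  · omega
  · have := YoungDiagram.mem_iff_lt_colLen.1 (h (m - 1) (by omega) i hi)
    omega

/-- Inclusion–exclusion: the missing cell forces `Y` into the union of the first `m` rows and first
`n` columns, which meet in the full rectangle. -/
theorem card_add_mul_eq (h : ∀ a < m, ∀ i < n, (a, i) ∈ Y) (h' : (m, n) ∉ Y) :
    Y.card + m * n = ∑ a : Fin m, Y.rowLen a + ∑ i : Fin n, Y.colLen i := by
  have h1 : (Y.cells.filter fun c => c.1 < m) ∪ (Y.cells.filter fun c => c.2 < n) = Y.cells := by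
    rw [← Finset.filter_or]
    refine Finset.filter_true_of_mem fun c hc => ?_
    by_contra hcon
    rw [not_or, not_lt, not_lt] at hcon
    exact h' (Y.up_left_mem hcon.1 hcon.2 ((YoungDiagram.mem_cells c).1 hc))
  have h2 : (Y.cells.filter fun c => c.1 < m) ∩ (Y.cells.filter fun c => c.2 < n) =
      Finset.range m ×ˢ Finset.range n := by
    ext ⟨a, i⟩
    simp only [Finset.mem_inter, Finset.mem_filter, Finset.mem_product, Finset.mem_range,
      YoungDiagram.mem_cells]
    exact ⟨fun hc => ⟨hc.1.2, hc.2.2⟩, fun hc => ⟨⟨h a hc.1 i hc.2, hc.1⟩, h a hc.1 i hc.2, hc.2⟩⟩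
  have h3 : (Y.cells.filter fun c => c.1 < m).card = ∑ a : Fin m, Y.rowLen a := by
    rw [Finset.card_eq_sum_card_fiberwise (f := Prod.fst) (t := Finset.range m)
      (fun c hc => by simpa using (Finset.mem_filter.1 hc).2), Fin.sum_univ_eq_sum_range]
    refine Finset.sum_congr rfl fun a ha => ?_
    rw [YoungDiagram.rowLen_eq_card, YoungDiagram.row, Finset.filter_filter]
    congr 1
    refine Finset.filter_congr fun c _ => ?_
    have := Finset.mem_range.1 ha
    constructor
    · exact fun hc => hc.2
    · rintro rfl
      exact ⟨this, rfl⟩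
  have h4 : (Y.cells.filter fun c => c.2 < n).card = ∑ i : Fin n, Y.colLen i := by
    rw [Finset.card_eq_sum_card_fiberwise (f := Prod.snd) (t := Finset.range n)
      (fun c hc => by simpa using (Finset.mem_filter.1 hc).2), Fin.sum_univ_eq_sum_range]
    refine Finset.sum_congr rfl fun a ha => ?_
    rw [YoungDiagram.colLen_eq_card, YoungDiagram.col, Finset.filter_filter]
    congr 1
    refine Finset.filter_congr fun c _ => ?_
    have := Finset.mem_range.1 ha
    constructor
    · exact fun hc => hc.2
    · rintro rfl
      exact ⟨this, rfl⟩
  have h5 := Finset.card_union_add_card_inter (Y.cells.filter fun c => c.1 < m)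
    (Y.cells.filter fun c => c.2 < n)
  rwa [h1, h2, h3, h4, Finset.card_product, Finset.card_range, Finset.card_range] at h5

/-- The rectangle makes the truncated subtraction exact. -/
theorem shiftedRow_cast (h : ∀ a < m, ∀ i < n, (a, i) ∈ Y) (a : Fin m) :
    (shiftedRow Y m n a : ℤ) = Y.rowLen a + m - n - a - 1 := by
  have := le_rowLen_of_rectangle h a.2
  have := a.2
  rw [shiftedRow]
  omega

theorem shiftedCol_cast (h : ∀ a < m, ∀ i < n, (a, i) ∈ Y) (i : Fin n) :
    (shiftedCol Y m n i : ℤ) = Y.colLen i + n - m - i - 1 := by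
  have := le_colLen_of_rectangle h i.2
  have := i.2
  rw [shiftedCol]
  omega

theorem shiftedRow_strictAnti (h : ∀ a < m, ∀ i < n, (a, i) ∈ Y) :
    StrictAnti (shiftedRow Y m n) := by
  intro a b hab
  have h1 := shiftedRow_cast h a
  have h2 := shiftedRow_cast h b
  have h3 := Y.rowLen_anti a b (Fin.lt_def.1 hab).le
  have h4 := Fin.lt_def.1 hab
  omega

theorem shiftedCol_strictAnti (h : ∀ a < m, ∀ i < n, (a, i) ∈ Y) :
    StrictAnti (shiftedCol Y m n) := by
  intro a b hab
  have h1 := shiftedCol_cast h a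
  have h2 := shiftedCol_cast h b
  have h3 := Y.colLen_anti a b (Fin.lt_def.1 hab).le
  have h4 := Fin.lt_def.1 hab
  omega

theorem sum_shiftedRow (h : ∀ a < m, ∀ i < n, (a, i) ∈ Y) :
    (∑ a, (shiftedRow Y m n a : ℤ)) * 2 =
      (∑ a : Fin m, (Y.rowLen a : ℤ)) * 2 + m * (m - 2 * n - 1) := by
  have := sum_fin_mul_two m
  simp only [shiftedRow_cast h, Finset.sum_sub_distrib, Finset.sum_add_distrib, Finset.sum_const,
    Finset.card_univ, Fintype.card_fin, nsmul_eq_mul]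
  linear_combination -this

theorem sum_shiftedCol (h : ∀ a < m, ∀ i < n, (a, i) ∈ Y) :
    (∑ i, (shiftedCol Y m n i : ℤ)) * 2 =
      (∑ i : Fin n, (Y.colLen i : ℤ)) * 2 + n * (n - 2 * m - 1) := by
  have := sum_fin_mul_two n
  simp only [shiftedCol_cast h, Finset.sum_sub_distrib, Finset.sum_add_distrib, Finset.sum_const,
    Finset.card_univ, Fintype.card_fin, nsmul_eq_mul]
  linear_combination -this

/-- The exponents excluded below `d a` are the `d b` with `b > a`. -/
theorem card_gauged_add {d : Fin m → ℕ} (hd : StrictAnti d) (a : Fin m) :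
    Fintype.card {k : Fin (d a) // ∀ b, d b ≠ k} + (m - 1 - a) = d a := by
  have h1 : Fintype.card {k : Fin (d a) // ¬ ∀ b, d b ≠ k} = m - 1 - a := by
    rw [← Fin.card_Ioi, ← Fintype.card_coe]
    symm
    refine Fintype.card_of_bijective (f := fun b : Finset.Ioi a =>
      (⟨⟨d b, hd (Finset.mem_Ioi.1 b.2)⟩, fun h => h b rfl⟩ :
        {k : Fin (d a) // ¬ ∀ b, d b ≠ k})) ⟨fun b c hbc => ?_, fun k => ?_⟩
    · exact Subtype.ext (hd.injective (congrArg (fun k => (k.1 : ℕ)) hbc))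
    · obtain ⟨b, hb⟩ := not_forall.1 k.2
      rw [not_not] at hb
      refine ⟨⟨b, Finset.mem_Ioi.2 (hd.lt_iff_gt.1 ?_)⟩, Subtype.ext (Fin.ext hb)⟩
      rw [hb]
      exact k.1.2
  have h2 := Fintype.card_subtype_compl (fun k : Fin (d a) => ∀ b, d b ≠ k)
  have h3 := Fintype.card_subtype_le (fun k : Fin (d a) => ∀ b, d b ≠ k)
  rw [Fintype.card_fin] at h2 h3
  omega

theorem sum_card_gauged {d : Fin m → ℕ} (hd : StrictAnti d) :
    (∑ a, (Fintype.card {k : Fin (d a) // ∀ b, d b ≠ k} : ℤ)) * 2 =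
      (∑ a, (d a : ℤ)) * 2 - m * (m - 1) := by
  have h1 : ∀ a, (Fintype.card {k : Fin (d a) // ∀ b, d b ≠ k} : ℤ) = d a - m + 1 + a :=
    fun a => by
      have := card_gauged_add hd a
      have := a.2
      omega
  have := sum_fin_mul_two m
  simp only [h1, Finset.sum_sub_distrib, Finset.sum_add_distrib, Finset.sum_const,
    Finset.card_univ, Fintype.card_fin, nsmul_eq_mul]
  linear_combination this

/-- The number of variables and the weight of the determinant both come out as `Y.card` from
`card_add_mul_eq` and triangular sums; identities are doubled to avoid halves. -/
theorem young_isFreeOfConstantRank {ħ : ℂ} (hħ : ħ ≠ 0) (h : ∀ a < m, ∀ i < n, (a, i) ∈ Y)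
    (h' : (m, n) ∉ Y) :
    IsFreeOfConstantRank (signedCoeffs Y.card (twistlessSWPoly ħ Y.card (shiftedRow Y m n)
      (shiftedCol Y m n))) := by
  have hd := shiftedRow_strictAnti h
  have he := shiftedCol_strictAnti h
  have h0 : (Y.card : ℤ) + m * n = ∑ a : Fin m, (Y.rowLen a : ℤ) + ∑ i : Fin n, (Y.colLen i : ℤ) := by
    exact_mod_cast card_add_mul_eq h h'
  have h1 := sum_shiftedRow h
  have h2 := sum_shiftedCol h
  refine twistless_isFreeOfConstantRank _ _ hħ hd.injective he.injective ?_ ?_ ?_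
  · have h3 := sum_card_gauged hd
    have h4 := sum_card_gauged he
    rw [Fintype.card_sum, Fintype.card_sum, Fintype.card_sigma, Fintype.card_sigma,
      Fintype.card_prod, Fintype.card_fin, Fintype.card_fin]
    refine Nat.cast_injective (R := ℤ) ?_
    push_cast
    refine mul_right_cancel₀ (two_ne_zero (α := ℤ)) ?_
    linear_combination h3 + h4 + h1 + h2 - 2 * h0
  · rintro K rfl
    have h3 := sum_fin_mul_two K
    zify
    refine mul_right_cancel₀ (two_ne_zero (α := ℤ)) ?_
    simp only [Finset.sum_add_distrib, Finset.sum_const, Finset.card_univ, Fintype.card_fin,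
      nsmul_eq_mul]
    push_cast at h0 h1 h2 ⊢
    linear_combination h3 - h1 - h2 + 2 * h0
  · rintro K rfl
    have h3 := sum_fin_mul_two K
    zify
    refine mul_right_cancel₀ (two_ne_zero (α := ℤ)) ?_
    simp only [Finset.sum_add_distrib, Finset.sum_const, Finset.card_univ, Fintype.card_fin,
      nsmul_eq_mul]
    push_cast at h0 h1 h2 ⊢
    linear_combination h3 - h1 - h2 + 2 * h0

end Young

end WronskianBethe

end

theorem mainTheorem3 (ħ : ℂ) (hħ : ħ ≠ 0) (m n : ℕ) :
    -- twisted case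
    (∀ (x : Fin m → ℂ) (y : Fin n → ℂ), (∀ a, x a ≠ 0) → (∀ i, y i ≠ 0) →
      Function.Injective (Sum.elim x y) →
      ∀ (lam : Fin m → ℕ) (nu : Fin n → ℕ),
        let W := WronskianBethe.WronskianAlgebra (WronskianBethe.twistedSW ħ x y lam nu)
        let A := MvPolynomial (Fin (WronskianBethe.twistedLength lam nu)) ℂ
        Module.Free A W ∧ Module.Finite A W ∧
        (∃ e : W ≃ₐ[ℂ] MvPolynomial (WronskianBethe.TwistedVar lam nu) ℂ,
          (∀ v, e (Ideal.Quotient.mk _ (MvPolynomial.X v)) = MvPolynomial.X v) ∧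
          ∀ l, e (algebraMap A W (MvPolynomial.X l)) =
            WronskianBethe.twistedSW ħ x y lam nu l) ∧
        ∀ chi : Fin (WronskianBethe.twistedLength lam nu) → ℂ,
          Module.Finite ℂ
            (WronskianBethe.SpecialisedAlgebra (WronskianBethe.twistedSW ħ x y lam nu) chi) ∧
          WronskianBethe.algebraicNumberOfSolutions
            (WronskianBethe.twistedSW ħ x y lam nu) chi = Module.finrank A W) ∧
    -- twist-less case
    (∀ Y : YoungDiagram, Y.rowLen m ≤ n →
        let W := WronskianBethe.WronskianAlgebra (WronskianBethe.twistlessSW ħ m n Y)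
        let A := MvPolynomial (Fin Y.card) ℂ
        Module.Free A W ∧ Module.Finite A W ∧
        (∃ e : W ≃ₐ[ℂ] MvPolynomial (WronskianBethe.YoungVar m n Y) ℂ,
          (∀ v, e (Ideal.Quotient.mk _ (MvPolynomial.X v)) = MvPolynomial.X v) ∧
          ∀ l, e (algebraMap A W (MvPolynomial.X l)) = WronskianBethe.twistlessSW ħ m n Y l) ∧
        ∀ chi : Fin Y.card → ℂ,
          Module.Finite ℂ
            (WronskianBethe.SpecialisedAlgebra (WronskianBethe.twistlessSW ħ m n Y) chi) ∧
          WronskianBethe.algebraicNumberOfSolutions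
            (WronskianBethe.twistlessSW ħ m n Y) chi = Module.finrank A W) := by
  refine ⟨fun x y hx hy hxy lam nu => ?_, fun Y hY => ?_⟩
  · exact WronskianBethe.twisted_isFreeOfConstantRank lam nu ħ hx hy hxy
  · exact WronskianBethe.young_isFreeOfConstantRank hħ
      (fun _ ha _ hi => WronskianBethe.mem_of_lt_sub_hookDefect ha hi)
      (WronskianBethe.sub_hookDefect_notMem hY)
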